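/- Let $q\in\mathbb{C}^*$ be not a root of unity, fix a square root $q^{1/2}$ of $q$, and let $\dot z\in\mathbb{C}^*$. Let $U_q(\mathfrak{s})$ be the quantum Schrödinger algebra: the unital associative $\mathbb{C}$-algebra generated by $E,F,K,K^{-1},X,Y,Z$ with $KK^{-1}=K^{-1}K=1$, $Z$ central, and relations $$[E,F]=\tfrac{K-K^{-1}}{q-q^{-1}},\quad KXK^{-1}=qX,\quad KEK^{-1}=q^2E,\quad KFK^{-1}=q^{-2}F,\quad KYK^{-1}=q^{-1}Y,$$ $$qYX-XY=Z,\quad EX=qXE,\quad EY=X+q^{-1}YE,\quad FX=YK^{-1}+XF,\quad FY=YF.$$ Put $C=FE+\frac{qK+q^{-1}K^{-1}}{(q-q^{-1})^2}$ and let $\tilde C=Z\big((1+q^{-1})C+\frac{1}{q^2-1}K^{-1}\big)+X^2F-Y^2EK^{-1}+XY(q^{-1}FE-qEF)$, a central element. For $\lambda\in\mathbb{C}^*$ let $\Delta(\lambda,\dot z)$ be the Verma module, i.e. the quotient of $U_q(\mathfrak{s})$ by the left ideal generated by $E$, $X$, $K-\lambda$, $Z-\dot z$; let $L(\lambda,\dot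 z)$ be its quotient by its largest proper submodule, and let $\tilde c_\lambda=\frac{\dot z}{(q-q^{-1})^2}\big((q+q^2)\lambda+(q^{-1}+q^{-2})\lambda^{-1}\big)$, the scalar by which $\tilde C$ acts on the highest weight vector of $L(\lambda,\dot z)$. Let $\mathcal{O}$ be the category of finitely generated $U_q(\mathfrak{s})$-modules on which $K$ acts diagonalizably and the subalgebra generated by $E,X$ acts locally finitely. For $\xi\subset\mathbb{C}^*$ a coset of $q^{\mathbb{Z}}$ and $\tilde c\in\mathbb{C}$, let $\mathcal{O}[\xi,\tilde c,\dot z]$ be the full subcategory of all $M$ in $\mathcal{O}$ such that all $K$-eigenvalues on $M$ lie in $\xi$, $Z$ acts on $M$ as the scalar $\dot z$ (central charge $\dot z$), and some power of $\tilde C-\tilde c$ annihilates $M$. Let $\xi=q^{1/2+\mathbb{Z}}$. Then: 1. $\Delta(q^{-3/2},\dot z)$ is, up to isomorphism, the unique simple object of $\mathcal{O}[\xi,\tilde c_{q^{-3/2}},\dot z]$, and this block is semisimple (every object is a finite direct sum of simple objects). 2. For every integer $n\ge 0$, the modules $\Delta(q^{-n-5/2},\dot z)$ and $L(q^{n-1/2},\dot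 z)$ are non-isomorphic and are, up to isomorphism, all the simple objects of $\mathcal{O}[\xi,\tilde c_{q^{n-1/2}},\dot z]$. 3. For every integer $n\ge 0$, the category $\mathcal{O}[\xi,\tilde c_{q^{n-1/2}},\dot z]$ is equivalent, as a $\mathbb{C}$-linear category, to the category of finite-dimensional complex representations of the quiver with two vertices $1,2$ and two arrows $a:1\to2$, $b:2\to1$, subject to the relation $ab=0$ (first $b$, then $a$). -/

import Mathlib

noncomputable section

open CategoryTheory CategoryTheory.Limits

namespace QSchr

/-! ### The quantum Schrödinger algebra -/

/-- Names of the generators; `Ki` stands for `K⁻¹`. -/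
inductive Gen : Type
  | E | F | K | Ki | X | Y | Z

/-- The free algebra on the generators. -/
abbrev Free : Type := FreeAlgebra ℂ Gen

/-- A generator, in the free algebra. -/
abbrev g (x : Gen) : Free := FreeAlgebra.ι ℂ x

open Gen in
/-- The defining relations of `U_q(𝔰)`, together with `K K⁻¹ = K⁻¹ K = 1` and centrality of `Z`. -/
inductive Rel (q : ℂ) : Free → Free → Prop
  | K_Ki : Rel q (g K * g Ki) 1
  | Ki_K : Rel q (g Ki * g K) 1
  | Z_central (x : Gen) : Rel q (g Z * g x) (g x * g Z)
  | E_F : Rel q (g E * g F - g F * g E) ((q - q⁻¹)⁻¹ • (g K - g Ki))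
  | K_X : Rel q (g K * g X * g Ki) (q • g X)
  | K_E : Rel q (g K * g E * g Ki) (q ^ 2 • g E)
  | K_F : Rel q (g K * g F * g Ki) ((q ^ 2)⁻¹ • g F)
  | K_Y : Rel q (g K * g Y * g Ki) (q⁻¹ • g Y)
  | Y_X : Rel q (q • (g Y * g X) - g X * g Y) (g Z)
  | E_X : Rel q (g E * g X) (q • (g X * g E))
  | E_Y : Rel q (g E * g Y) (g X + q⁻¹ • (g Y * g E))
  | F_X : Rel q (g F * g X) (g Y * g Ki + g X * g F)
  | F_Y : Rel q (g F * g Y) (g Y * g F)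

/-- The quantum Schrödinger algebra `U_q(𝔰)`, an associative unital `ℂ`-algebra. -/
def UqS (q : ℂ) : Type := RingQuot (Rel q)

instance (q : ℂ) : Ring (UqS q) := inferInstanceAs (Ring (RingQuot (Rel q)))

instance (q : ℂ) : Algebra ℂ (UqS q) := inferInstanceAs (Algebra ℂ (RingQuot (Rel q)))

/-- The projection from the free algebra. -/
def proj (q : ℂ) : Free →ₐ[ℂ] UqS q := RingQuot.mkAlgHom ℂ (Rel q)

/-- The image of a generator in `U_q(𝔰)`. -/
def gen (q : ℂ) (x : Gen) : UqS q := proj q (g x)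

/-- The Casimir element `C = FE + (qK + q⁻¹K⁻¹)/(q - q⁻¹)²` of `U_q(𝔰𝔩₂)`. -/
def casimir (q : ℂ) : UqS q :=
  gen q .F * gen q .E + ((q - q⁻¹) ^ 2)⁻¹ • (q • gen q .K + q⁻¹ • gen q .Ki)

/-- The central element
`C̃ = Z((1+q⁻¹)C + K⁻¹/(q²-1)) + X²F - Y²EK⁻¹ + XY(q⁻¹FE - qEF)` of `U_q(𝔰)`. -/
def Ctilde (q : ℂ) : UqS q :=
  gen q .Z * ((1 + q⁻¹) • casimir q + (q ^ 2 - 1)⁻¹ • gen q .Ki)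
    + gen q .X ^ 2 * gen q .F - gen q .Y ^ 2 * gen q .E * gen q .Ki
    + gen q .X * gen q .Y * (q⁻¹ • (gen q .F * gen q .E) - q • (gen q .E * gen q .F))

/-- `U_q(𝔫⁺)`, the subalgebra generated by `E` and `X`. -/
def UqNPlus (q : ℂ) : Subalgebra ℂ (UqS q) := Algebra.adjoin ℂ {gen q .E, gen q .X}

/-! ### Weight modules and category `𝒪` -/

section Modules

variable (q : ℂ) (M : Type) [AddCommGroup M] [Module ℂ M] [Module (UqS q) M]
  [IsScalarTower ℂ (UqS q) M]

/-- The weight space `M_μ = {v | K v = μ v}`. -/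
def weightSpace (μ : ℂ) : Submodule ℂ M :=
  Module.End.eigenspace (Algebra.lsmul ℂ ℂ M (gen q .K)) μ

/-- The support of `M` (automatically contained in `ℂ \ {0}`, as `K` is invertible). -/
def supp : Set ℂ := {μ | weightSpace q M μ ≠ ⊥}

/-- Category `𝒪`: finitely generated weight modules with a locally finite action of `U_q(𝔫⁺)`.
The sum of the weight spaces is automatically direct. -/
structure InO : Prop where
  finitelyGenerated : Module.Finite (UqS q) M
  weight : ⨆ μ : ℂ, weightSpace q M μ = ⊤
  locallyFinite : ∀ v : M, FiniteDimensional ℂ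
    ((Subalgebra.toSubmodule (UqNPlus q)).map ((LinearMap.toSpanSingleton (UqS q) M v).restrictScalars ℂ))

/-- Membership in the block `𝒪[ξ, c, z]`: objects of `𝒪` with support in `ξ` and with central
charge `z`, on which some power of `C̃ - c` vanishes. -/
structure InBlock (ξ : Set ℂ) (c z : ℂ) : Prop where
  inO : InO q M
  supp_subset : supp q M ⊆ ξ
  centralCharge : ∀ v : M, gen q .Z • v = z • v
  ctilde_nilpotent : ∃ k : ℕ, ∀ v : M, (Ctilde q - algebraMap ℂ (UqS q) c) ^ k • v = 0

end Modules

open scoped ModuleCat in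
/-- The block, as a property of `U_q(𝔰)`-modules. A `U_q(𝔰)`-module is regarded as a complex
vector space through `ℂ → U_q(𝔰)`. -/
def block (q : ℂ) (ξ : Set ℂ) (c z : ℂ) : ObjectProperty (ModuleCat.{0} (UqS q)) :=
  fun M => InBlock q M ξ c z

/-- The block `𝒪[ξ, c, z]`, a full subcategory of the category of `U_q(𝔰)`-modules. -/
abbrev Block (q : ℂ) (ξ : Set ℂ) (c z : ℂ) : Type 1 := (block q ξ c z).FullSubcategory

/-- The coset `μ q^ℤ`. -/
def coset (q μ : ℂ) : Set ℂ := {ν | ∃ k : ℤ, ν = μ * q ^ k}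

/-! ### Verma modules and their simple quotients -/

/-- The left ideal generated by `E`, `X`, `K - μ` and `Z - z`. -/
def vermaIdeal (q μ z : ℂ) : Submodule (UqS q) (UqS q) :=
  Submodule.span (UqS q) {gen q .E, gen q .X, gen q .K - algebraMap ℂ (UqS q) μ,
    gen q .Z - algebraMap ℂ (UqS q) z}

/-- The Verma module `Δ(μ, z)`. -/
abbrev Verma (q μ z : ℂ) : Type := UqS q ⧸ vermaIdeal q μ z

/-- `R(μ, z)`, the largest proper submodule of `Δ(μ, z)` (for `μ ≠ 0` the sum of all proper
submodules is proper). -/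
def vermaRad (q μ z : ℂ) : Submodule (UqS q) (Verma q μ z) := sSup {N | N ≠ ⊤}

/-- `L(μ, z) = Δ(μ, z) / R(μ, z)`. -/
abbrev SimpleQuot (q μ z : ℂ) : Type := Verma q μ z ⧸ vermaRad q μ z

/-- The Verma module `Δ(μ, z)` as an object of the module category. -/
def Delta (q μ z : ℂ) : ModuleCat.{0} (UqS q) := ModuleCat.of (UqS q) (Verma q μ z)

/-- The simple module `L(μ, z)` as an object of the module category. -/
def L (q μ z : ℂ) : ModuleCat.{0} (UqS q) := ModuleCat.of (UqS q) (SimpleQuot q μ z)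

/-- The highest weight vector of `L(μ, z)`. -/
def hwv (q μ z : ℂ) : SimpleQuot q μ z :=
  (vermaRad q μ z).mkQ ((vermaIdeal q μ z).mkQ 1)

/-- The scalar `c̃_μ` by which `C̃` acts on the highest weight vector of `L(μ, z)`; that it is this
scalar is `Ctilde_smul_hwv`. -/
def ctilde (q μ z : ℂ) : ℂ :=
  z / (q - q⁻¹) ^ 2 * ((q + q ^ 2) * μ + (q⁻¹ + (q ^ 2)⁻¹) * μ⁻¹)

lemma gen_rel {q : ℂ} {a b : Free} (h : Rel q a b) : proj q a = proj q b :=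
  RingQuot.mkAlgHom_rel ℂ h

/-- `C̃` acts by `c̃_μ` on any highest weight vector of weight `μ` and central charge `z`. -/
lemma Ctilde_smul_of_highest {q μ z : ℂ} (hq : q ≠ 0) (hq2 : q ^ 2 ≠ 1) (hμ : μ ≠ 0)
    {M : Type} [AddCommGroup M] [Module ℂ M] [Module (UqS q) M] [IsScalarTower ℂ (UqS q) M]
    (v : M) (hE : gen q .E • v = 0) (hX : gen q .X • v = 0) (hK : gen q .K • v = μ • v)
    (hZ : gen q .Z • v = z • v) : Ctilde q • v = ctilde q μ z • v := by
  have comm : ∀ (u : UqS q) (c : ℂ) (w : M), u • c • w = c • u • w := fun u c w => by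
    rw [← algebraMap_smul (UqS q) c w, ← mul_smul, ← Algebra.commutes, mul_smul, algebraMap_smul]
  have hKi : gen q .Ki • v = μ⁻¹ • v := by
    have h := gen_rel (Rel.Ki_K (q := q))
    rw [map_mul, map_one] at h
    have h2 : (gen q .Ki * gen q .K) • v = v := by
      change (proj q (g .Ki) * proj q (g .K)) • v = v
      rw [h, one_smul]
    rw [mul_smul, hK, comm] at h2
    rw [← h2, smul_smul, inv_mul_cancel₀ hμ, one_smul, h2]
  have hEF : gen q .E * gen q .F = gen q .F * gen q .E + (q - q⁻¹)⁻¹ • (gen q .K - gen q .Ki) := by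
    have h := gen_rel (Rel.E_F (q := q))
    simp only [map_sub, map_mul, map_smul] at h
    rw [sub_eq_iff_eq_add'] at h
    exact h
  have hXY : gen q .X * gen q .Y = q • (gen q .Y * gen q .X) - gen q .Z := by
    have h := gen_rel (Rel.Y_X (q := q))
    simp only [map_sub, map_mul, map_smul] at h
    exact (sub_eq_of_eq_add (sub_eq_iff_eq_add'.mp h)).symm
  have hFX : gen q .X * gen q .F = gen q .F * gen q .X - gen q .Y * gen q .Ki := by
    have h := gen_rel (Rel.F_X (q := q))
    simp only [map_add, map_mul] at h
    exact (sub_eq_of_eq_add' h).symm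
  have eXY : gen q .X • gen q .Y • v = (-z) • v := by
    rw [← mul_smul, hXY, sub_smul, smul_assoc, mul_smul, hX, hZ]; simp
  have eXF : gen q .X • gen q .F • v = (-μ⁻¹) • gen q .Y • v := by
    rw [← mul_smul, hFX, sub_smul, mul_smul, hX, mul_smul, hKi, comm]; simp
  have eEF : gen q .E • gen q .F • v = ((q - q⁻¹)⁻¹ * (μ - μ⁻¹)) • v := by
    rw [← mul_smul, hEF, add_smul, mul_smul, hE, smul_assoc, sub_smul, hK, hKi, smul_zero,
      zero_add, ← sub_smul, smul_smul]
  have hqq : q - q⁻¹ ≠ 0 := by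
    intro h
    apply hq2
    field_simp at h
    linear_combination h
  have hq21 : q ^ 2 - 1 ≠ 0 := sub_ne_zero.mpr hq2
  have hqi : q - q⁻¹ = (q ^ 2 - 1) / q := by field_simp
  have assoc : ∀ (c : ℂ) (u : UqS q) (w : M), (c • u) • w = c • u • w :=
    fun c u w => smul_assoc c u w
  have mulU : ∀ (u u' : UqS q) (w : M), (u * u') • w = u • u' • w := mul_smul
  have mulC : ∀ (c c' : ℂ) (w : M), c • c' • w = (c * c') • w := smul_smul
  simp only [Ctilde, casimir, add_smul, sub_smul, mulU, assoc, pow_two, hE, hKi, hK, hZ,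
    eXF, eEF, eXY, comm, smul_zero, smul_add, smul_sub, mulC]
  simp only [ctilde, ← add_smul, zero_add, zero_sub, sub_zero, ← neg_smul]
  congr 1
  rw [hqi]
  field_simp
  ring

/-- `C̃` acts by `c̃_μ` on the highest weight vector of `L(μ, z)`. -/
lemma Ctilde_smul_hwv {q μ z : ℂ} (hq : q ≠ 0) (hq2 : q ^ 2 ≠ 1) (hμ : μ ≠ 0) :
    Ctilde q • hwv q μ z = ctilde q μ z • hwv q μ z := by
  have key : ∀ u ∈ vermaIdeal q μ z, u • hwv q μ z = 0 := by
    intro u hu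
    have : (vermaIdeal q μ z).mkQ u = 0 := by simpa using hu
    rw [hwv, ← map_smul, ← map_smul, smul_eq_mul, mul_one, this, map_zero]
  have sub : ∀ u ∈ ({gen q .E, gen q .X, gen q .K - algebraMap ℂ (UqS q) μ,
      gen q .Z - algebraMap ℂ (UqS q) z} : Set (UqS q)), u • hwv q μ z = 0 :=
    fun u hu => key u (Submodule.subset_span hu)
  refine Ctilde_smul_of_highest hq hq2 hμ _ (sub _ (by simp)) (sub _ (by simp)) ?_ ?_
  · have h := sub (gen q .K - algebraMap ℂ (UqS q) μ) (by simp)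
    rwa [sub_smul, algebraMap_smul, sub_eq_zero] at h
  · have h := sub (gen q .Z - algebraMap ℂ (UqS q) z) (by simp)
    rwa [sub_smul, algebraMap_smul, sub_eq_zero] at h

/-! ### Semisimple categories -/

/-- Every object is a finite direct sum of simple objects. -/
def IsSemisimpleCategory (C : Type 1) [Category.{0} C] [Preadditive C] : Prop :=
  ∀ X : C, ∃ (n : ℕ) (S : Fin n → C) (b : Bicone S),
    (∀ i, Simple (S i)) ∧ Nonempty b.IsBilimit ∧ Nonempty (b.pt ≅ X)

/-! ### Representations of the quiver -/

/-- The two vertices of the quiver. -/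
inductive Vertex : Type
  | one | two

/-- The two arrows of the quiver, in opposite directions. -/
inductive Arrow : Vertex → Vertex → Type
  | a : Arrow .one .two
  | b : Arrow .two .one

instance : Quiver Vertex := ⟨Arrow⟩

/-- The arrow `a`, in the path category. -/
def pathA : (Paths.of Vertex).obj .one ⟶ (Paths.of Vertex).obj .two :=
  (Paths.of Vertex).map Arrow.a

/-- The arrow `b`, in the path category. -/
def pathB : (Paths.of Vertex).obj .two ⟶ (Paths.of Vertex).obj .one :=
  (Paths.of Vertex).map Arrow.b

/-- A representation of the quiver (a functor from its path category to vector spaces) that is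
finite dimensional and satisfies `ab = 0`, meaning that `a` after `b` vanishes. -/
structure IsQuiverRep (V : Paths Vertex ⥤ ModuleCat.{0} ℂ) : Prop where
  finiteDimensional : ∀ i, FiniteDimensional ℂ (V.obj i)
  relation : V.map pathB ≫ V.map pathA = 0

/-- Finite dimensional representations of the quiver with relation `ab = 0`. -/
abbrev QuiverRep : Type 1 := ObjectProperty.FullSubcategory IsQuiverRep

end QSchr

end

noncomputable section

open CategoryTheory CategoryTheory.Limits

set_option linter.unusedSectionVars false
set_option linter.unusedSimpArgs false
set_option linter.unusedTactic false
set_option linter.unreachableTactic false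
set_option linter.unnecessarySeqFocus false

namespace QSchr

/-! ### Basic facts on `U_q(𝔰)`-modules -/

/-! Because `z ≠ 0`, the elements `X` and `Y` act as a deformed Weyl algebra, `XY = qYX - z`, and
`X` is locally nilpotent on every module of category `𝒪`. As for a Heisenberg algebra, such a module
is `ℂ[Y] ⊗ ker X` (`kerLift_bijective`). `E` and `K` preserve `ker X`; `F` does not, but `F -
((q+1)z)⁻¹Y²K⁻¹` does. The resulting operators `e`, `f`, `k` satisfy the relations of `U_q(𝔰𝔩₂)` up
to rescaling, with `q^(1/2)k` in the role of `K` (`kerOps`), and every system of such operators on a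
space `N` makes `ℂ[Y] ⊗ N` a module (`Sl2Ops.op_rel`). On a vector of weight `ν` in `ker X`, `C̃`
acts as `c̃_ν + z(q+1)fe` (`Ctilde_smul_kerX`). The half-integral blocks thus become integral blocks
of category `𝒪` for quantum `𝔰𝔩₂`.

Put `λ = q^(m-3/2)`; part 1 is `m = 0` and parts 2, 3 are `m = n+1`. The function `ν ↦ c̃_ν` takes
equal values exactly on the orbits of `ν ↦ q⁻³ν⁻¹`, so `c̃_ν = c̃_λ` only for `ν = λ` and `ν =
λq^(-2m)`. The weights of `ker X` have the form `λq^(-2k)`, and there `fe` has one generalized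
eigenvalue, which vanishes only for `k = 0` and `k = m` (`cc_ne_zero`). Hence `f` is bijective
between consecutive weight spaces, except possibly on entering `k = m`. What is left is the weight
space of `λ` (vertex `two`) and that of `λq^(-2m)` (vertex `one`), with `b = f^m` and with `a`
determined by `f^(m-1)a = e`; `ab = 0` since `e f^m` vanishes on the weight space of `λ`
(`Nice.exists_data`, `Nice.extend_bijective`). Conversely these data rebuild the module
(`QData.ops`) and its morphisms (`exists_modMap_eq`), and finite generation amounts to finite
dimension (`QData.inBlock`, `QData.finiteDimensional`). This is the equivalence. For `m = 0` no
degenerate step is left, a module is just a vector space, and a basis splits it.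

A simple object has a highest weight vector of weight `λ` or `λq^(-2m)`. The module `Δ(λq^(-2m))` is
simple since a nonzero submodule contains a highest weight vector, which can only be a multiple of
the generator. No PBW theorem is needed: nonvanishing of Verma modules is read off from the explicit
modules `ℂ[Y] ⊗ N` (`VermaNice.of_surjective`). -/

/-- Standing assumptions on the parameters. -/
structure Par (q s z : ℂ) : Prop where
  q0 : q ≠ 0
  nr : ∀ k : ℕ, 0 < k → q ^ k ≠ 1
  sq : s ^ 2 = q
  z0 : z ≠ 0

namespace Par

variable {q s z : ℂ} (hp : Par q s z)
include hp

lemma s0 : s ≠ 0 := by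
  rintro rfl; exact hp.q0 (by rw [← hp.sq]; simp)

lemma q1 : q - 1 ≠ 0 := sub_ne_zero.mpr (by simpa using hp.nr 1 one_pos)

lemma q2 : q ^ 2 ≠ 1 := hp.nr 2 two_pos

lemma q21 : q ^ 2 - 1 ≠ 0 := sub_ne_zero.mpr hp.q2

lemma qp1 : q + 1 ≠ 0 := fun h => hp.q21 (by linear_combination (q - 1) * h)

lemma pow_ne (k : ℕ) : q ^ (k + 1) - 1 ≠ 0 := sub_ne_zero.mpr (hp.nr _ k.succ_pos)

/-- If a positive power of `s` were `1`, so would be the same power of `q = s²`. Every weight that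
occurs is a power of `s`, so equations between weights reduce to linear equations between integer
exponents. -/
lemma s_zpow_inj {i j : ℤ} (h : s ^ i = s ^ j) : i = j := by
  by_contra hne
  have key : ∀ k : ℕ, 0 < k → s ^ (k : ℤ) ≠ 1 := fun k hk h1 => hp.nr k hk (by
    rw [zpow_natCast] at h1
    rw [← hp.sq, ← pow_mul, mul_comm, pow_mul, h1, one_pow])
  rcases lt_or_gt_of_ne hne with hl | hl
  · refine key (j - i).toNat (by omega) ?_
    rw [Int.toNat_of_nonneg (by omega), zpow_sub₀ hp.s0, h, div_self (zpow_ne_zero _ hp.s0)]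
  · refine key (i - j).toNat (by omega) ?_
    rw [Int.toNat_of_nonneg (by omega), zpow_sub₀ hp.s0, h, div_self (zpow_ne_zero _ hp.s0)]

lemma q_pow_eq (k : ℕ) : q ^ k = s ^ (2 * k : ℤ) := by
  rw [← hp.sq, zpow_mul, zpow_natCast]; norm_cast

lemma mul_q_pow_inj {ν : ℂ} (hν : ν ≠ 0) : Function.Injective fun k : ℕ => ν * q ^ k := by
  intro i j h
  have h2 := mul_left_cancel₀ hν h
  rw [hp.q_pow_eq, hp.q_pow_eq] at h2
  have := hp.s_zpow_inj h2
  omega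

end Par

section Modules

variable {q : ℂ} {M : Type} [AddCommGroup M] [Module ℂ M] [Module (UqS q) M]
  [IsScalarTower ℂ (UqS q) M]

lemma gen_smul_comm (u : UqS q) (c : ℂ) (v : M) : u • c • v = c • u • v := by
  rw [← algebraMap_smul (UqS q) c v, ← mul_smul, ← Algebra.commutes, mul_smul, algebraMap_smul]

lemma K_Ki_smul (v : M) : gen q .K • gen q .Ki • v = v := by
  have h := gen_rel (Rel.K_Ki (q := q))
  rw [map_mul, map_one] at h
  rw [← mul_smul]; erw [h]; rw [one_smul]

lemma Ki_K_smul (v : M) : gen q .Ki • gen q .K • v = v := by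
  have h := gen_rel (Rel.Ki_K (q := q))
  rw [map_mul, map_one] at h
  rw [← mul_smul]; erw [h]; rw [one_smul]

lemma Z_gen (x : Gen) : gen q .Z * gen q x = gen q x * gen q .Z := by
  have h := gen_rel (Rel.Z_central (q := q) x)
  simp only [map_mul] at h
  exact h

lemma E_F_smul (v : M) : gen q .E • gen q .F • v =
    gen q .F • gen q .E • v + (q - q⁻¹)⁻¹ • (gen q .K • v - gen q .Ki • v) := by
  have h := gen_rel (Rel.E_F (q := q))
  simp only [map_sub, map_mul, map_smul] at h
  have h2 := congrArg (fun u : UqS q => u • v) h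
  change (gen q .E * gen q .F - gen q .F * gen q .E) • v =
    ((q - q⁻¹)⁻¹ • (gen q .K - gen q .Ki)) • v at h2
  rw [sub_smul, mul_smul, mul_smul, smul_assoc, sub_smul] at h2
  rw [← h2]; abel

lemma conj_smul {x : Gen} {c : ℂ} (h : Rel q (g .K * g x * g .Ki) (c • g x)) (v : M) :
    gen q .K • gen q x • v = c • gen q x • gen q .K • v := by
  have h := gen_rel h
  simp only [map_mul, map_smul] at h
  have h2 := congrArg (fun u : UqS q => u • (gen q .K • v)) h
  change (gen q .K * gen q x * gen q .Ki) • _ = (c • gen q x) • _ at h2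
  rwa [mul_smul, mul_smul, Ki_K_smul, smul_assoc] at h2

lemma K_X_smul (v : M) : gen q .K • gen q .X • v = q • gen q .X • gen q .K • v :=
  conj_smul Rel.K_X v

lemma K_E_smul (v : M) : gen q .K • gen q .E • v = q ^ 2 • gen q .E • gen q .K • v :=
  conj_smul Rel.K_E v

lemma K_F_smul (v : M) : gen q .K • gen q .F • v = (q ^ 2)⁻¹ • gen q .F • gen q .K • v :=
  conj_smul Rel.K_F v

lemma K_Y_smul (v : M) : gen q .K • gen q .Y • v = q⁻¹ • gen q .Y • gen q .K • v :=
  conj_smul Rel.K_Y v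

lemma Ki_smul_of_K {x : Gen} {c : ℂ} (hc : c ≠ 0)
    (h : ∀ v : M, gen q .K • gen q x • v = c • gen q x • gen q .K • v) (v : M) :
    gen q .Ki • gen q x • v = c⁻¹ • gen q x • gen q .Ki • v := by
  have h1 := congrArg (fun w => gen q .Ki • w) (h (gen q .Ki • v))
  simp only [K_Ki_smul, Ki_K_smul, gen_smul_comm] at h1
  rw [h1, inv_smul_smul₀ hc]

lemma X_Y_smul (v : M) :
    gen q .X • gen q .Y • v = q • gen q .Y • gen q .X • v - gen q .Z • v := by
  have h := gen_rel (Rel.Y_X (q := q))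
  simp only [map_sub, map_mul, map_smul] at h
  have h2 := congrArg (fun u : UqS q => u • v) h
  change (q • (gen q .Y * gen q .X) - gen q .X * gen q .Y) • v = gen q .Z • v at h2
  rw [← h2, sub_smul, smul_assoc, mul_smul, mul_smul]; abel

lemma E_X_smul (v : M) : gen q .E • gen q .X • v = q • gen q .X • gen q .E • v := by
  have h := gen_rel (Rel.E_X (q := q))
  simp only [map_mul, map_smul] at h
  have h2 := congrArg (fun u : UqS q => u • v) h
  change (gen q .E * gen q .X) • v = (q • (gen q .X * gen q .E)) • v at h2
  rwa [smul_assoc, mul_smul, mul_smul] at h2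

lemma E_Y_smul (v : M) :
    gen q .E • gen q .Y • v = gen q .X • v + q⁻¹ • gen q .Y • gen q .E • v := by
  have h := gen_rel (Rel.E_Y (q := q))
  simp only [map_add, map_mul, map_smul] at h
  have h2 := congrArg (fun u : UqS q => u • v) h
  change (gen q .E * gen q .Y) • v = (gen q .X + q⁻¹ • (gen q .Y * gen q .E)) • v at h2
  rwa [add_smul, smul_assoc, mul_smul, mul_smul] at h2

lemma X_F_smul (v : M) :
    gen q .X • gen q .F • v = gen q .F • gen q .X • v - gen q .Y • gen q .Ki • v := by
  have h := gen_rel (Rel.F_X (q := q))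
  simp only [map_add, map_mul] at h
  have h2 := congrArg (fun u : UqS q => u • v) h
  change (gen q .F * gen q .X) • v = (gen q .Y * gen q .Ki + gen q .X * gen q .F) • v at h2
  rw [add_smul, mul_smul, mul_smul, mul_smul] at h2
  rw [h2]; abel

lemma F_Y_smul (v : M) : gen q .F • gen q .Y • v = gen q .Y • gen q .F • v := by
  have h := gen_rel (Rel.F_Y (q := q))
  simp only [map_mul] at h
  have h2 := congrArg (fun u : UqS q => u • v) h
  change (gen q .F * gen q .Y) • v = (gen q .Y * gen q .F) • v at h2
  rwa [mul_smul, mul_smul] at h2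

/-- Induction principle: a property of elements of `U_q(𝔰)` that holds for scalars and generators
and is stable under sums and products holds everywhere. -/
lemma UqS_induction {P : UqS q → Prop} (hc : ∀ c : ℂ, P (algebraMap ℂ _ c))
    (hg : ∀ x, P (gen q x)) (ha : ∀ u v, P u → P v → P (u + v))
    (hm : ∀ u v, P u → P v → P (u * v)) (u : UqS q) : P u := by
  obtain ⟨a, rfl⟩ : ∃ a, proj q a = u := RingQuot.mkAlgHom_surjective ℂ (Rel q) u
  induction a using FreeAlgebra.induction with
  | grade0 r => rw [AlgHom.commutes]; exact hc r
  | grade1 x => exact hg x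
  | mul a b h1 h2 => rw [map_mul]; exact hm _ _ h1 h2
  | add a b h1 h2 => rw [map_add]; exact ha _ _ h1 h2

variable {M' : Type} [AddCommGroup M'] [Module ℂ M'] [Module (UqS q) M']
  [IsScalarTower ℂ (UqS q) M']

/-- A `ℂ`-linear map commuting with the generators is `U_q(𝔰)`-linear. -/
def linearOfGen (f : M →ₗ[ℂ] M') (h : ∀ x v, f (gen q x • v) = gen q x • f v) :
    M →ₗ[UqS q] M' where
  toFun := f
  map_add' := map_add f
  map_smul' u v := by
    revert v
    refine UqS_induction (P := fun u => ∀ v, f (u • v) = u • f v) ?_ h ?_ ?_ u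
    · intro c v; rw [algebraMap_smul, algebraMap_smul, map_smul]
    · intro a b h1 h2 v; rw [add_smul, map_add, h1, h2, add_smul]
    · intro a b h1 h2 v; rw [mul_smul, h1, h2, mul_smul]

lemma map_smul_complex (f : M →ₗ[UqS q] M') (c : ℂ) (v : M) : f (c • v) = c • f v := by
  rw [← algebraMap_smul (UqS q) c v, map_smul, algebraMap_smul]

lemma mem_weightSpace {ν : ℂ} {v : M} : v ∈ weightSpace q M ν ↔ gen q .K • v = ν • v := by
  rw [weightSpace, Module.End.mem_eigenspace_iff]; rfl

lemma Ki_smul_of_mem {ν : ℂ} (hν : ν ≠ 0) {v : M} (h : v ∈ weightSpace q M ν) :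
    gen q .Ki • v = ν⁻¹ • v := by
  have h2 := Ki_K_smul (q := q) v
  rw [mem_weightSpace.mp h, gen_smul_comm] at h2
  rw [eq_inv_smul_iff₀ hν, h2]

lemma weight_ne_zero {ν : ℂ} {v : M} (h : v ∈ weightSpace q M ν) (hv : v ≠ 0) : ν ≠ 0 := by
  rintro rfl
  apply hv
  rw [← Ki_K_smul (q := q) v, mem_weightSpace.mp h, zero_smul, smul_zero]

lemma shift_mem {x : Gen} {c : ℂ}
    (h : ∀ v : M, gen q .K • gen q x • v = c • gen q x • gen q .K • v) {ν : ℂ} {v : M}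
    (hv : v ∈ weightSpace q M ν) : gen q x • v ∈ weightSpace q M (c * ν) := by
  rw [mem_weightSpace] at hv ⊢
  rw [h, hv, gen_smul_comm, smul_smul]

lemma pow_mem_weightSpace {x : Gen} {c : ℂ}
    (h : ∀ v : M, gen q .K • gen q x • v = c • gen q x • gen q .K • v) {ν : ℂ} {v : M}
    (hv : v ∈ weightSpace q M ν) (i : ℕ) : gen q x ^ i • v ∈ weightSpace q M (c ^ i * ν) := by
  induction i with
  | zero => simpa using hv
  | succ i ih =>
    rw [pow_succ' (gen q x), mul_smul, pow_succ', mul_assoc]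
    exact shift_mem h ih

lemma weight_iSup_induction {P : M → Prop} (hM : ⨆ ν : ℂ, weightSpace q M ν = ⊤)
    (hw : ∀ ν, ∀ v ∈ weightSpace q M ν, P v) (h0 : P 0) (ha : ∀ u v, P u → P v → P (u + v))
    (v : M) : P v := by
  have hv : v ∈ ⨆ ν : ℂ, weightSpace q M ν := hM ▸ Submodule.mem_top
  exact Submodule.iSup_induction (weightSpace q M) (motive := P) hv hw h0 ha

lemma exists_weight_vector (hM : ⨆ ν : ℂ, weightSpace q M ν = ⊤) [Nontrivial M] :
    ∃ ν, ∃ v ∈ weightSpace q M ν, v ≠ 0 := by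
  by_contra! h
  obtain ⟨v, hv⟩ := exists_ne (0 : M)
  exact hv (weight_iSup_induction (P := fun v => v = 0) hM h rfl (by rintro u v rfl rfl; simp) v)

/-- If weight vectors with weights in `A` span, all weights are in `A`. -/
lemma supp_subset_of_span {A : Set ℂ} (hM : ⨆ ν ∈ A, weightSpace q M ν = ⊤) : supp q M ⊆ A := by
  intro ν hν
  by_contra hA
  apply hν
  have hd := Module.End.eigenspaces_iSupIndep (Algebra.lsmul ℂ ℂ M (gen q .K)) ν
  have : ⨆ μ, ⨆ (_ : μ ≠ ν), weightSpace q M μ = ⊤ := by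
    rw [eq_top_iff, ← hM]
    exact iSup_mono fun μ => iSup_le fun hμ => le_iSup_of_le (fun h => hA (h ▸ hμ)) le_rfl
  exact (hd.mono_right (this.ge)).eq_bot_of_le le_top

omit [Module (UqS q) M] [IsScalarTower ℂ (UqS q) M] in
/-- A subspace stable under `f` contains the `f`-eigencomponents of its elements. -/
lemma le_iSup_inf_eigenspace (f : Module.End ℂ M) (hf : ⨆ ν : ℂ, f.eigenspace ν = ⊤)
    (p : Submodule ℂ M) (hp : ∀ x ∈ p, f x ∈ p) : p ≤ ⨆ ν : ℂ, p ⊓ f.eigenspace ν := by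
  classical
  intro x hx
  obtain ⟨m, hm, rfl⟩ := (Submodule.mem_iSup_iff_exists_finsupp _ x).mp
    (show x ∈ ⨆ ν : ℂ, f.eigenspace ν from hf ▸ Submodule.mem_top)
  refine (Submodule.mem_iSup_iff_exists_finsupp _ _).mpr ⟨m, fun ν => ⟨?_, hm ν⟩, rfl⟩
  -- Work in the quotient by `p`: the images of the eigencomponents of `x` sum to zero and are
  -- eigenvectors of the induced map for distinct eigenvalues, so each of them vanishes.
  have hind := Module.End.eigenspaces_iSupIndep (p.mapQ p f hp)
  have hz := (iSupIndep_iff_finsetSum_eq_zero_imp_eq_zero _).mp hind m.support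
    (fun ν => p.mkQ (m ν)) (fun ν _ => by
      rw [Module.End.mem_eigenspace_iff]
      have := Module.End.mem_eigenspace_iff.mp (hm ν)
      rw [Submodule.mkQ_apply, Submodule.mapQ_apply, this, Submodule.Quotient.mk_smul])
    (by rw [← map_sum]; exact (Submodule.Quotient.mk_eq_zero p).mpr hx)
  by_cases h : ν ∈ m.support
  · simpa using hz ν h
  · rw [Finsupp.notMem_support_iff.mp h]; exact p.zero_mem

/-- Submodules of weight modules are weight modules. -/
lemma weight_submodule (hM : ⨆ ν : ℂ, weightSpace q M ν = ⊤) (N : Submodule (UqS q) M) :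
    (N.restrictScalars ℂ) ≤ ⨆ ν : ℂ, (N.restrictScalars ℂ) ⊓ weightSpace q M ν :=
  le_iSup_inf_eigenspace _ hM _ fun _ hx => N.smul_mem _ hx

end Modules

/-! ### Submodules and quotients of objects of a block -/

section Closure

variable {q s z : ℂ} {M : Type} [AddCommGroup M] [Module ℂ M] [Module (UqS q) M]
  [IsScalarTower ℂ (UqS q) M]
  {M' : Type} [AddCommGroup M'] [Module ℂ M'] [Module (UqS q) M'] [IsScalarTower ℂ (UqS q) M']

/-- The subspace `U_q(𝔫⁺) v`. -/
abbrev nPlusSpan (q : ℂ) {M : Type} [AddCommGroup M] [Module ℂ M] [Module (UqS q) M]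
    [IsScalarTower ℂ (UqS q) M] (v : M) : Submodule ℂ M :=
  (Subalgebra.toSubmodule (UqNPlus q)).map
    ((LinearMap.toSpanSingleton (UqS q) M v).restrictScalars ℂ)

lemma smul_mem_nPlusSpan {u : UqS q} (hu : u ∈ UqNPlus q) (v : M) : u • v ∈ nPlusSpan q v :=
  ⟨u, hu, rfl⟩

lemma map_nPlusSpan (f : M →ₗ[UqS q] M') (v : M) :
    nPlusSpan q (f v) = (nPlusSpan q v).map (f.restrictScalars ℂ) := by
  rw [nPlusSpan, nPlusSpan, ← Submodule.map_comp]
  congr 1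
  ext
  simp

lemma nPlusSpan_le {W : Submodule ℂ M} {v : M} (hv : v ∈ W)
    (hE : ∀ w ∈ W, gen q .E • w ∈ W) (hX : ∀ w ∈ W, gen q .X • w ∈ W) : nPlusSpan q v ≤ W := by
  rintro _ ⟨u, hu, rfl⟩
  change u • v ∈ W
  have : ∀ u ∈ Algebra.adjoin ℂ {gen q .E, gen q .X}, ∀ w ∈ W, u • w ∈ W := fun u hu => by
    induction hu using Algebra.adjoin_induction with
    | mem x hx =>
      rcases hx with rfl | rfl
      · exact hE
      · exact hX
    | algebraMap r => intro w hw; rw [algebraMap_smul]; exact W.smul_mem r hw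
    | add x y _ _ h1 h2 => intro w hw; rw [add_smul]; exact W.add_mem (h1 w hw) (h2 w hw)
    | mul x y _ _ h1 h2 => intro w hw; rw [mul_smul]; exact h1 _ (h2 w hw)
  exact this u hu v hv

/-- On a module with locally finite `U_q(𝔫⁺)`-action, `E` and `X` act locally nilpotently on
weight vectors. -/
lemma exists_pow_smul_eq_zero_of_weight {x : Gen} {c : ℂ} (hx : gen q x ∈ UqNPlus q)
    (hc : ∀ v : M, gen q .K • gen q x • v = c • gen q x • gen q .K • v)
    (hinj : ∀ ν : ℂ, ν ≠ 0 → Function.Injective fun i : ℕ => c ^ i * ν)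
    (hlf : ∀ v : M, FiniteDimensional ℂ (nPlusSpan q v)) {ν : ℂ} {v : M}
    (hv : v ∈ weightSpace q M ν) : ∃ i : ℕ, gen q x ^ i • v = 0 := by
  by_contra! h
  have hν : ν ≠ 0 := weight_ne_zero hv (by simpa using h 0)
  -- If no power killed `v`, the vectors `x^i v` would be eigenvectors of `K` for pairwise distinct
  -- eigenvalues, an infinite independent family inside a finite-dimensional space.
  have hli := Module.End.eigenvectors_linearIndependent' (Algebra.lsmul ℂ ℂ M (gen q .K))
    (fun i : ℕ => c ^ i * ν) (hinj ν hν) (fun i => gen q x ^ i • v)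
    (fun i => ⟨pow_mem_weightSpace hc hv i, h i⟩)
  have hmem : ∀ i : ℕ, gen q x ^ i • v ∈ nPlusSpan q v :=
    fun i => smul_mem_nPlusSpan (pow_mem hx i) v
  have hli2 : LinearIndependent ℂ (fun i : ℕ => (⟨_, hmem i⟩ : nPlusSpan q v)) :=
    LinearIndependent.of_comp (nPlusSpan q v).subtype hli
  have := hlf v
  exact not_finite_iff_infinite.mpr inferInstance hli2.finite_of_isNoetherian

lemma E_mem_nPlus : gen q .E ∈ UqNPlus q := Algebra.subset_adjoin (by simp)

lemma X_mem_nPlus : gen q .X ∈ UqNPlus q := Algebra.subset_adjoin (by simp)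

lemma exists_pow_smul_of_weight {x : Gen} (hw : ⨆ ν : ℂ, weightSpace q M ν = ⊤)
    (h : ∀ ν, ∀ v ∈ weightSpace q M ν, ∃ i : ℕ, gen q x ^ i • v = 0) (v : M) :
    ∃ i : ℕ, gen q x ^ i • v = 0 := by
  refine weight_iSup_induction hw h ⟨0, by simp⟩ ?_ v
  rintro u v ⟨i, hi⟩ ⟨j, hj⟩
  refine ⟨i + j, ?_⟩
  rw [smul_add, pow_add, mul_smul _ _ v, hj, ← pow_add, add_comm i j, pow_add, mul_smul, hi,
    smul_zero, smul_zero, add_zero]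

lemma X_locally_nilpotent (hp : Par q s z) (hM : InO q M) (v : M) :
    ∃ i : ℕ, gen q .X ^ i • v = 0 :=
  exists_pow_smul_of_weight hM.weight (fun _ _ hv => exists_pow_smul_eq_zero_of_weight X_mem_nPlus
    K_X_smul (fun ν hν i j h => hp.mul_q_pow_inj hν (by simpa [mul_comm] using h))
    hM.locallyFinite hv) v

lemma E_locally_nilpotent (hp : Par q s z) (hM : InO q M) (v : M) :
    ∃ i : ℕ, gen q .E ^ i • v = 0 :=
  exists_pow_smul_of_weight hM.weight (fun _ _ hv => exists_pow_smul_eq_zero_of_weight E_mem_nPlus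
    K_E_smul (fun ν hν i j h => by
      have h2 : ν * q ^ (2 * i) = ν * q ^ (2 * j) := by
        rw [pow_mul, pow_mul, mul_comm ν, mul_comm ν]; exact h
      have := hp.mul_q_pow_inj hν h2
      omega)
    hM.locallyFinite hv) v

lemma InBlock.iSup_mem {ξ : Set ℂ} {c : ℂ} (hM : InBlock q M ξ c z) :
    ⨆ ν ∈ ξ, weightSpace q M ν = ⊤ := by
  rw [eq_top_iff, ← hM.inO.weight]
  refine iSup_le fun ν => ?_
  by_cases h : weightSpace q M ν = ⊥
  · rw [h]; exact bot_le
  · exact le_iSup₂_of_le ν (hM.supp_subset h) le_rfl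

lemma weight_map_le (f : M →ₗ[UqS q] M') (ν : ℂ) :
    (weightSpace q M ν).map (f.restrictScalars ℂ) ≤ weightSpace q M' ν := by
  rintro _ ⟨v, hv, rfl⟩
  rw [mem_weightSpace]
  change gen q .K • f v = ν • f v
  rw [← map_smul, mem_weightSpace.mp hv, map_smul_complex]

lemma map_mem_weightSpace (f : M →ₗ[UqS q] M') {ν : ℂ} {v : M} (hv : v ∈ weightSpace q M ν) :
    f v ∈ weightSpace q M' ν := weight_map_le f ν ⟨v, hv, rfl⟩

/-- Quotients of objects of a block lie in the block. -/
lemma InBlock.of_surjective {ξ : Set ℂ} {c : ℂ} (hM : InBlock q M ξ c z) (f : M →ₗ[UqS q] M')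
    (hf : Function.Surjective f) : InBlock q M' ξ c z := by
  have hs : ⨆ ν ∈ ξ, weightSpace q M' ν = ⊤ := by
    rw [eq_top_iff, ← LinearMap.range_eq_top.mpr (show Function.Surjective (f.restrictScalars ℂ)
      from hf), ← Submodule.map_top, ← hM.iSup_mem]
    simp only [Submodule.map_iSup]
    exact iSup₂_mono fun ν _ => weight_map_le f ν
  refine ⟨⟨?_, ?_, ?_⟩, supp_subset_of_span hs, ?_, ?_⟩
  · have := hM.inO.finitelyGenerated
    exact Module.Finite.of_surjective f hf
  · exact eq_top_iff.mpr (hs.ge.trans (iSup_mono fun ν => iSup_le fun _ => le_rfl))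
  · intro v
    obtain ⟨w, rfl⟩ := hf v
    have := hM.inO.locallyFinite w
    change FiniteDimensional ℂ (nPlusSpan q (f w))
    rw [map_nPlusSpan]
    exact Module.Finite.map _ _
  · intro v
    obtain ⟨w, rfl⟩ := hf v
    rw [← map_smul, hM.centralCharge, map_smul_complex]
  · obtain ⟨k, hk⟩ := hM.ctilde_nilpotent
    refine ⟨k, fun v => ?_⟩
    obtain ⟨w, rfl⟩ := hf v
    rw [← map_smul, hk, map_zero]

lemma weightSpace_submodule_top (hM : ⨆ ν : ℂ, weightSpace q M ν = ⊤) (N : Submodule (UqS q) M) :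
    ⨆ ν : ℂ, weightSpace q N ν = ⊤ := by
  rw [eq_top_iff]
  intro v _
  have h1 : (v : M) ∈ (⨆ ν : ℂ, weightSpace q N ν).map (N.subtype.restrictScalars ℂ) := by
    rw [Submodule.map_iSup]
    have hle : ∀ ν : ℂ, N.restrictScalars ℂ ⊓ weightSpace q M ν ≤
        (weightSpace q N ν).map (N.subtype.restrictScalars ℂ) := by
      rintro ν w ⟨hw, hw2⟩
      exact ⟨⟨w, hw⟩, mem_weightSpace.mpr (Subtype.ext (mem_weightSpace.mp hw2)), rfl⟩
    exact iSup_mono hle (weight_submodule hM N v.2)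
  obtain ⟨w, hw, hwv⟩ := h1
  rwa [← Subtype.ext (show (w : M) = v from hwv)]

/-- Finitely generated submodules of objects of a block lie in the block. -/
lemma InBlock.submodule {ξ : Set ℂ} {c : ℂ} (hM : InBlock q M ξ c z) (N : Submodule (UqS q) M)
    (hN : N.FG) : InBlock q N ξ c z := by
  refine ⟨⟨Module.Finite.iff_fg.mpr hN, weightSpace_submodule_top hM.inO.weight N, ?_⟩,
    ?_, ?_, ?_⟩
  · intro v
    have h1 := hM.inO.locallyFinite v
    have h2 := map_nPlusSpan N.subtype v
    change FiniteDimensional ℂ (nPlusSpan q v)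
    change FiniteDimensional ℂ (nPlusSpan q (N.subtype v)) at h1
    rw [h2] at h1
    exact (Submodule.equivMapOfInjective (N.subtype.restrictScalars ℂ)
      (Subtype.val_injective) (nPlusSpan q v)).symm.finiteDimensional
  · intro ν hν
    apply hM.supp_subset
    intro h
    apply hν
    rw [Submodule.eq_bot_iff] at h ⊢
    intro v hv
    exact Subtype.ext (h _ (map_mem_weightSpace N.subtype hv))
  · exact fun v => Subtype.ext (hM.centralCharge v)
  · obtain ⟨k, hk⟩ := hM.ctilde_nilpotent
    exact ⟨k, fun v => Subtype.ext (hk v)⟩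

/-- A highest weight vector of weight `ν` and central charge `z`. -/
structure IsHighest (q ν z : ℂ) {M : Type} [AddCommGroup M] [Module ℂ M] [Module (UqS q) M]
    (v : M) : Prop where
  E : gen q .E • v = 0
  X : gen q .X • v = 0
  K : gen q .K • v = ν • v
  Z : gen q .Z • v = z • v

lemma exists_last_pow {x : UqS q} {v : M} (hv : v ≠ 0) (h : ∃ i : ℕ, x ^ i • v = 0) :
    ∃ i : ℕ, x ^ i • v ≠ 0 ∧ x • x ^ i • v = 0 := by
  classical
  obtain ⟨i, hi⟩ : ∃ i, Nat.find h = i + 1 :=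
    Nat.exists_eq_succ_of_ne_zero (fun h0 => hv (by simpa [h0] using Nat.find_spec h))
  refine ⟨i, Nat.find_min h (by omega), ?_⟩
  rw [← mul_smul, ← pow_succ', ← hi]
  exact Nat.find_spec h

/-- `EX = qXE` lets `E` act on the kernel of `X`. -/
lemma X_E_smul_eq_zero (hq : q ≠ 0) {v : M} (hX : gen q .X • v = 0) :
    gen q .X • gen q .E • v = 0 := by
  have := E_X_smul (q := q) v
  rw [hX, smul_zero] at this
  exact (smul_eq_zero_iff_right hq).mp this.symm

/-- Apply `X` to a weight vector as long as the result is nonzero, then `E`. The second stage stays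
inside the kernel of `X`, so its last nonzero vector is killed by both. -/
lemma InO.exists_highest (hp : Par q s z) (hM : InO q M) (hz : ∀ v : M, gen q .Z • v = z • v)
    [Nontrivial M] : ∃ ν, ∃ v : M, v ≠ 0 ∧ ν ≠ 0 ∧ IsHighest q ν z v := by
  obtain ⟨ν, v, hv, hv0⟩ := exists_weight_vector hM.weight
  obtain ⟨i, hi, hi2⟩ := exists_last_pow hv0 (X_locally_nilpotent hp hM v)
  have hw := pow_mem_weightSpace K_X_smul hv i
  obtain ⟨j, hj, hj2⟩ := exists_last_pow hi (E_locally_nilpotent hp hM _)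
  have hw2 := pow_mem_weightSpace K_E_smul hw j
  refine ⟨_, _, hj, weight_ne_zero hw2 hj, hj2, ?_, mem_weightSpace.mp hw2, hz _⟩
  clear hj hj2 hw2
  induction j with
  | zero => simpa using hi2
  | succ j ih =>
    rw [pow_succ' (gen q .E), mul_smul]
    exact X_E_smul_eq_zero hp.q0 ih

end Closure

/-! ### Verma modules and their simple quotients -/

section VermaModules

variable {q s z : ℂ} {M : Type} [AddCommGroup M] [Module ℂ M] [Module (UqS q) M]
  [IsScalarTower ℂ (UqS q) M]

/-- The generator of the Verma module. -/
def vermaOne (q ν z : ℂ) : Verma q ν z := (vermaIdeal q ν z).mkQ 1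

lemma smul_vermaOne (ν : ℂ) (u : UqS q) :
    u • vermaOne q ν z = (vermaIdeal q ν z).mkQ u := by
  rw [vermaOne, ← map_smul, smul_eq_mul, mul_one]

lemma isHighest_vermaOne (ν : ℂ) : IsHighest q ν z (vermaOne q ν z) := by
  have key : ∀ u ∈ ({gen q .E, gen q .X, gen q .K - algebraMap ℂ (UqS q) ν,
      gen q .Z - algebraMap ℂ (UqS q) z} : Set (UqS q)), u • vermaOne q ν z = 0 := by
    intro u hu
    rw [smul_vermaOne]
    exact (Submodule.Quotient.mk_eq_zero _).mpr (Submodule.subset_span hu)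
  refine ⟨key _ (by simp), key _ (by simp), ?_, ?_⟩
  · have h := key (gen q .K - algebraMap ℂ (UqS q) ν) (by simp)
    rwa [sub_smul, algebraMap_smul, sub_eq_zero] at h
  · have h := key (gen q .Z - algebraMap ℂ (UqS q) z) (by simp)
    rwa [sub_smul, algebraMap_smul, sub_eq_zero] at h

lemma eq_top_of_vermaOne_mem {ν : ℂ} {N : Submodule (UqS q) (Verma q ν z)}
    (h : vermaOne q ν z ∈ N) : N = ⊤ := by
  rw [eq_top_iff]
  rintro v -
  obtain ⟨u, rfl⟩ := (vermaIdeal q ν z).mkQ_surjective v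
  rw [← smul_vermaOne]
  exact N.smul_mem u h

/-- The map from the Verma module given by a highest weight vector. -/
def vermaLift {ν : ℂ} (v : M) (hv : IsHighest q ν z v) : Verma q ν z →ₗ[UqS q] M :=
  (vermaIdeal q ν z).liftQ (LinearMap.toSpanSingleton (UqS q) M v) (by
    rw [vermaIdeal, Submodule.span_le]
    rintro u (rfl | rfl | rfl | rfl)
    · exact hv.E
    · exact hv.X
    · change (gen q .K - algebraMap ℂ (UqS q) ν) • v = 0
      rw [sub_smul, algebraMap_smul, hv.K, sub_self]
    · change (gen q .Z - algebraMap ℂ (UqS q) z) • v = 0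
      rw [sub_smul, algebraMap_smul, hv.Z, sub_self])

lemma vermaLift_one {ν : ℂ} (v : M) (hv : IsHighest q ν z v) :
    vermaLift v hv (vermaOne q ν z) = v := by
  simp [vermaLift, vermaOne]

/-- The Verma module is nonzero, a weight module, and its highest weight space is spanned by the
generator. -/
structure VermaNice (q ν z : ℂ) : Prop where
  ne_zero : vermaOne q ν z ≠ 0
  weight : ⨆ μ : ℂ, weightSpace q (Verma q ν z) μ = ⊤
  highest : ∀ v ∈ weightSpace q (Verma q ν z) ν, ∃ c : ℂ, v = c • vermaOne q ν z

namespace VermaNice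

variable {ν : ℂ} (h : VermaNice q ν z)
include h

/-- A submodule contains the weight components of its elements. A nonzero component of weight `ν`
would be a multiple of the generator and make the submodule everything. -/
lemma not_mem_of_ne_top {N : Submodule (UqS q) (Verma q ν z)} (hN : N ≠ ⊤) :
    N.restrictScalars ℂ ≤ ⨆ μ, ⨆ (_ : μ ≠ ν), weightSpace q (Verma q ν z) μ := by
  refine (weight_submodule h.weight N).trans (iSup_le fun μ => ?_)
  by_cases hμ : μ = ν
  · subst hμ
    rintro v ⟨hv, hv2⟩
    obtain ⟨c, rfl⟩ := h.highest v hv2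
    by_cases hc : c = 0
    · simp [hc]
    · refine absurd (eq_top_of_vermaOne_mem ?_) hN
      have := N.smul_mem (algebraMap ℂ (UqS q) c⁻¹) hv
      rwa [algebraMap_smul, inv_smul_smul₀ hc] at this
  · exact inf_le_right.trans (le_iSup₂_of_le μ hμ le_rfl)

/-- All proper submodules lie in the sum of the weight spaces other than `ν`, hence so does their
sum, whereas the generator does not. -/
lemma vermaRad_ne_top : vermaRad q ν z ≠ ⊤ := by
  intro htop
  have hmem : vermaOne q ν z ∈ ⨆ μ, ⨆ (_ : μ ≠ ν), weightSpace q (Verma q ν z) μ := by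
    have h1 : vermaOne q ν z ∈ vermaRad q ν z := htop ▸ Submodule.mem_top
    rw [vermaRad, sSup_eq_iSup'] at h1
    refine Submodule.iSup_induction _ (motive := fun v => v ∈ ⨆ μ, ⨆ (_ : μ ≠ ν),
      weightSpace q (Verma q ν z) μ) h1 (fun N v hv => h.not_mem_of_ne_top N.2 hv)
      (Submodule.zero_mem _) (fun u v => Submodule.add_mem _)
  have hd := Module.End.eigenspaces_iSupIndep
    (Algebra.lsmul ℂ ℂ (Verma q ν z) (gen q .K)) ν
  exact h.ne_zero (Submodule.disjoint_def.mp hd _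
    (mem_weightSpace.mpr (isHighest_vermaOne ν).K) hmem)

lemma le_vermaRad {N : Submodule (UqS q) (Verma q ν z)} (hN : N ≠ ⊤) : N ≤ vermaRad q ν z :=
  le_sSup hN

lemma isCoatom_vermaRad : IsCoatom (vermaRad q ν z) := by
  refine ⟨h.vermaRad_ne_top, fun N hN => ?_⟩
  by_contra hne
  exact absurd (h.le_vermaRad hne) hN.not_ge

lemma isSimple : IsSimpleModule (UqS q) (SimpleQuot q ν z) :=
  isSimpleModule_iff_isCoatom.mpr h.isCoatom_vermaRad

/-- A simple module with a highest weight vector is the simple quotient of a Verma module. -/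
lemma equiv_of_isSimple [IsSimpleModule (UqS q) M] {v : M} (hv : IsHighest q ν z v)
    (hv0 : v ≠ 0) : Nonempty (SimpleQuot q ν z ≃ₗ[UqS q] M) := by
  have hne : vermaLift v hv ≠ 0 := fun h0 => hv0 (by rw [← vermaLift_one v hv, h0]; rfl)
  have hsurj : Function.Surjective (vermaLift v hv) := LinearMap.surjective_of_ne_zero hne
  have e := (vermaLift v hv).quotKerEquivOfSurjective hsurj
  have hker : IsCoatom (LinearMap.ker (vermaLift v hv)) :=
    isSimpleModule_iff_isCoatom.mp (IsSimpleModule.congr e)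
  -- The kernel is a maximal submodule contained in the radical, and the radical is proper.
  have heq : vermaRad q ν z = LinearMap.ker (vermaLift v hv) :=
    (hker.le_iff.mp (h.le_vermaRad hker.1)).resolve_left h.vermaRad_ne_top
  exact ⟨(Submodule.quotEquivOfEq _ _ heq).trans e⟩

end VermaNice

end VermaModules

/-! ### Simple objects of a block -/

section SimpleObjects

open scoped ModuleCat

variable {q : ℂ} {ξ : Set ℂ} {c z : ℂ}

lemma block_of_surjective {M : Type} [AddCommGroup M] [Module ℂ M] [Module (UqS q) M]
    [IsScalarTower ℂ (UqS q) M] (h : InBlock q M ξ c z) (P : ModuleCat.{0} (UqS q))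
    (f : M →ₗ[UqS q] P) (hf : Function.Surjective f) : block q ξ c z P :=
  h.of_surjective f hf

lemma block_of_inBlock {M : Type} [AddCommGroup M] [Module ℂ M] [Module (UqS q) M]
    [IsScalarTower ℂ (UqS q) M] (h : InBlock q M ξ c z) :
    block q ξ c z (ModuleCat.of (UqS q) M) :=
  block_of_surjective h (ModuleCat.of (UqS q) M) LinearMap.id Function.surjective_id

lemma Block.inBlock (M : Block q ξ c z) : InBlock q M.obj ξ c z := M.property

/-- Finitely generated submodules, as objects of the block. -/
def Block.sub (M : Block q ξ c z) (N : Submodule (UqS q) M.obj) (hN : N.FG) : Block q ξ c z :=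
  ⟨ModuleCat.of (UqS q) N, block_of_inBlock (M.inBlock.submodule N hN)⟩

/-- The inclusion of a submodule. -/
def Block.subι (M : Block q ξ c z) (N : Submodule (UqS q) M.obj) (hN : N.FG) : M.sub N hN ⟶ M :=
  ObjectProperty.homMk (ModuleCat.ofHom N.subtype)

lemma Block.hom_ext' {M N : Block q ξ c z} {f g : M ⟶ N}
    (h : ∀ v, f.hom.hom v = g.hom.hom v) : f = g :=
  ObjectProperty.hom_ext _ (ModuleCat.hom_ext (LinearMap.ext h))

lemma Block.mono_of_injective {M N : Block q ξ c z} (f : M ⟶ N)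
    (hf : Function.Injective f.hom.hom) : Mono f := by
  refine ⟨fun a b hab => Block.hom_ext' fun v => hf ?_⟩
  have := congrArg (fun (k : _ ⟶ N) => k.hom.hom v) hab
  simpa using this

/-- The full kernel of `f` is not known to be finitely generated, so it may not be an object of the
block. The cyclic submodule generated by a single kernel vector is one, and it suffices as a test
object. -/
lemma Block.injective_of_mono {M N : Block q ξ c z} (f : M ⟶ N) [Mono f] :
    Function.Injective f.hom.hom := by
  rw [injective_iff_map_eq_zero]
  intro v hv
  have hfg : (Submodule.span (UqS q) {v}).FG := Submodule.fg_span_singleton v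
  have h0 : M.subι _ hfg ≫ f = 0 ≫ f := by
    apply Block.hom_ext'
    rintro ⟨w, hw⟩
    obtain ⟨u, rfl⟩ := Submodule.mem_span_singleton.mp hw
    change f.hom.hom (u • v) = f.hom.hom 0
    rw [map_smul, hv, smul_zero, map_zero]
  have h1 := (cancel_mono f).mp h0
  have := congrArg (fun (k : M.sub _ hfg ⟶ M) =>
    k.hom.hom ⟨v, Submodule.mem_span_singleton_self v⟩) h1
  exact this

lemma Block.isIso_iff {M N : Block q ξ c z} (f : M ⟶ N) :
    IsIso f ↔ Function.Bijective f.hom.hom := by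
  rw [← ObjectProperty.isIso_hom_iff]
  exact ConcreteCategory.isIso_iff_bijective f.hom

/-- The simple objects of a block are the simple modules in it. -/
lemma Block.simple_iff (M : Block q ξ c z) : Simple M ↔ IsSimpleModule (UqS q) M.obj := by
  constructor
  · intro hM
    have hnt : Nontrivial M.obj := by
      by_contra hn
      rw [not_nontrivial_iff_subsingleton] at hn
      exact id_nonzero M (Block.hom_ext' fun v => Subsingleton.elim _ _)
    rw [isSimpleModule_iff_toSpanSingleton_surjective]
    refine ⟨hnt, fun v hv => ?_⟩
    have hfg : (Submodule.span (UqS q) {v}).FG := Submodule.fg_span_singleton v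
    -- The inclusion of the cyclic submodule generated by `v ≠ 0` is a nonzero monomorphism into a
    -- simple object, hence an isomorphism; so every nonzero vector generates.
    have hmono : Mono (M.subι _ hfg) := Block.mono_of_injective _ Subtype.val_injective
    have hne : M.subι _ hfg ≠ 0 := fun h0 => hv
      (congrArg (fun (k : M.sub _ hfg ⟶ M) =>
        k.hom.hom ⟨v, Submodule.mem_span_singleton_self v⟩) h0)
    have hiso := isIso_of_mono_of_nonzero hne
    intro w
    obtain ⟨⟨w', hw'⟩, rfl⟩ := ((Block.isIso_iff _).mp hiso).2 w
    obtain ⟨u, rfl⟩ := Submodule.mem_span_singleton.mp hw'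
    exact ⟨u, rfl⟩
  · intro hM
    refine ⟨fun {N} f _ => ⟨?_, ?_⟩⟩
    · rintro hf rfl
      have := IsSimpleModule.nontrivial (UqS q) M.obj
      obtain ⟨v, hv⟩ := exists_ne (0 : M.obj)
      obtain ⟨w, rfl⟩ := ((Block.isIso_iff _).mp hf).2 v
      exact hv rfl
    · intro hf
      rw [Block.isIso_iff]
      refine ⟨Block.injective_of_mono f, LinearMap.surjective_of_ne_zero fun h0 => hf ?_⟩
      exact Block.hom_ext' fun v => by rw [h0]; rfl

/-- Isomorphisms in a block are linear equivalences. -/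
lemma Block.nonempty_iso_iff (M N : Block q ξ c z) :
    Nonempty (M ≅ N) ↔ Nonempty (M.obj ≃ₗ[UqS q] N.obj) := by
  constructor
  · rintro ⟨e⟩
    exact ⟨((block q ξ c z).ι.mapIso e).toLinearEquiv⟩
  · rintro ⟨e⟩
    exact ⟨(block q ξ c z).isoMk e.toModuleIso⟩

end SimpleObjects

/-! ### The module `ℂ[Y] ⊗ N` -/

/-- The operators of a (renormalized) `U_q(𝔰𝔩₂)`-action, as induced on the kernel of `X`. -/
structure Sl2Ops (q : ℂ) (N : Type) [AddCommGroup N] [Module ℂ N] where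
  e : Module.End ℂ N
  f : Module.End ℂ N
  k : Module.End ℂ N
  ki : Module.End ℂ N
  k_ki : ∀ n, k (ki n) = n
  ki_k : ∀ n, ki (k n) = n
  k_e : ∀ n, k (e n) = q ^ 2 • e (k n)
  k_f : ∀ n, k (f n) = (q ^ 2)⁻¹ • f (k n)
  e_f : ∀ n, e (f n) = f (e n) + (q ^ 2 - 1)⁻¹ • (q • k n - ki n)

section Rep

variable {q : ℂ} {N : Type} [AddCommGroup N] [Module ℂ N]

/-- The algebra morphism given by operators satisfying the defining relations. -/
def repHom (op : Gen → Module.End ℂ N)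
    (h : ∀ ⦃a b⦄, Rel q a b → FreeAlgebra.lift ℂ op a = FreeAlgebra.lift ℂ op b) :
    UqS q →ₐ[ℂ] Module.End ℂ N :=
  RingQuot.liftAlgHom ℂ ⟨FreeAlgebra.lift ℂ op, h⟩

lemma repHom_gen (op : Gen → Module.End ℂ N)
    (h : ∀ ⦃a b⦄, Rel q a b → FreeAlgebra.lift ℂ op a = FreeAlgebra.lift ℂ op b) (x : Gen) :
    repHom op h (gen q x) = op x := by
  have := RingQuot.liftAlgHom_mkAlgHom_apply ℂ (FreeAlgebra.lift ℂ op) h (g x)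
  rw [g, FreeAlgebra.lift_ι_apply] at this
  exact this

end Rep

namespace Sl2Ops

variable {q s z : ℂ} {N : Type} [AddCommGroup N] [Module ℂ N] (hp : Par q s z) (o : Sl2Ops q N)

lemma ki_e (hp : Par q s z) (n : N) : o.ki (o.e n) = (q ^ 2)⁻¹ • o.e (o.ki n) := by
  have h := congrArg o.ki (o.k_e (o.ki n))
  rw [o.ki_k, o.k_ki, map_smul] at h
  rw [h, inv_smul_smul₀ (pow_ne_zero 2 hp.q0)]

/-- The operator `y^j ⊗ n ↦ y^(σ j) ⊗ t_j n`. -/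
def shiftOp (σ : ℕ → ℕ) (t : ℕ → Module.End ℂ N) : Module.End ℂ (ℕ →₀ N) :=
  Finsupp.lsum ℂ fun j => Finsupp.lsingle (σ j) ∘ₗ t j

@[simp] lemma shiftOp_single (σ : ℕ → ℕ) (t : ℕ → Module.End ℂ N) (j : ℕ) (n : N) :
    shiftOp σ t (Finsupp.single j n) = Finsupp.single (σ j) (t j n) := by
  simp [shiftOp]

/-- The coefficients of the action of `X`. -/
def cX (q z : ℂ) (j : ℕ) : ℂ := -z * (q ^ j - 1) / (q - 1)

/-- The coefficients of the action of `E`. -/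
def cE (q z : ℂ) (j : ℕ) : ℂ :=
  -z * q * (q ^ j - 1) * (q ^ j - q) / (q ^ j * (q - 1) ^ 2 * (q + 1))

/-- The operators on `ℂ[Y] ⊗ N` given by the generators of `U_q(𝔰)`. -/
def op (z : ℂ) (o : Sl2Ops q N) : Gen → Module.End ℂ (ℕ →₀ N)
  | .E => shiftOp (· - 2) (fun j => cE q z j • 1) + shiftOp id (fun j => (q ^ j)⁻¹ • o.e)
  | .F => shiftOp id (fun _ => o.f) + shiftOp (· + 2) (fun _ => ((q + 1) * z)⁻¹ • o.ki)
  | .K => shiftOp id (fun j => (q ^ j)⁻¹ • o.k)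
  | .Ki => shiftOp id (fun j => q ^ j • o.ki)
  | .X => shiftOp (· - 1) (fun j => cX q z j • 1)
  | .Y => shiftOp (· + 1) (fun _ => 1)
  | .Z => z • 1

lemma op_E_single (j : ℕ) (n : N) : op z o .E (Finsupp.single j n) =
    cE q z j • Finsupp.single (j - 2) n + (q ^ j)⁻¹ • Finsupp.single j (o.e n) := by
  simp [op]

lemma op_F_single (j : ℕ) (n : N) : op z o .F (Finsupp.single j n) =
    Finsupp.single j (o.f n) + ((q + 1) * z)⁻¹ • Finsupp.single (j + 2) (o.ki n) := by
  simp [op]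

lemma op_K_single (j : ℕ) (n : N) : op z o .K (Finsupp.single j n) =
    (q ^ j)⁻¹ • Finsupp.single j (o.k n) := by
  simp [op]

lemma op_Ki_single (j : ℕ) (n : N) : op z o .Ki (Finsupp.single j n) =
    q ^ j • Finsupp.single j (o.ki n) := by
  simp [op]

lemma op_X_single (j : ℕ) (n : N) : op z o .X (Finsupp.single j n) =
    cX q z j • Finsupp.single (j - 1) n := by
  simp [op]

lemma op_Y_single (j : ℕ) (n : N) : op z o .Y (Finsupp.single j n) =
    Finsupp.single (j + 1) n := by
  simp [op]

lemma op_Z_apply (v : ℕ →₀ N) : op z o .Z v = z • v := rfl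

lemma cX_zero : cX q z 0 = 0 := by simp [cX]
lemma cE_zero : cE q z 0 = 0 := by simp [cE]
lemma cE_one : cE q z 1 = 0 := by simp [cE]

lemma single_smul (j : ℕ) (c : ℂ) (n : N) :
    (Finsupp.single j (c • n) : ℕ →₀ N) = c • Finsupp.single j n := by simp

-- Each relation is checked on the vectors `y^j ⊗ n`. The subtractions `j - 1` and `j - 2` truncate
-- for small `j`, so these cases are separated; the truncation does no harm because `cX` vanishes at
-- `0` and `cE` at `0` and `1`.
include hp in
lemma op_rel ⦃a b : Free⦄ (h : Rel q a b) :
    FreeAlgebra.lift ℂ (op z o) a = FreeAlgebra.lift ℂ (op z o) b := by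
  have hq0 := hp.q0
  have hq1 := hp.q1
  have hz0 := hp.z0
  have hqp := hp.qp1
  have hqq : q - q⁻¹ ≠ 0 := fun h => hp.q21 (by field_simp at h; linear_combination h)
  have hq21 := hp.q21
  have hqi : (q - q⁻¹)⁻¹ = q / ((q - 1) * (q + 1)) := by
    rw [inv_eq_iff_eq_inv]; field_simp; ring
  have hqi2 : (q ^ 2 - 1)⁻¹ = 1 / ((q - 1) * (q + 1)) := by
    rw [inv_eq_iff_eq_inv]; field_simp; ring
  have hpow : ∀ j : ℕ, q ^ j ≠ 0 := fun j => pow_ne_zero j hq0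
  refine Finsupp.lhom_ext fun j n => ?_
  cases h
  case K_Ki =>
    simp only [map_mul, FreeAlgebra.lift_ι_apply, Module.End.mul_apply, op_K_single, op_Ki_single,
      map_smul, o.k_ki, map_one, Module.End.one_apply, smul_smul, mul_inv_cancel₀ (hpow _),
      one_smul]
  case Ki_K =>
    simp only [map_mul, FreeAlgebra.lift_ι_apply, Module.End.mul_apply, op_K_single, op_Ki_single,
      map_smul, o.ki_k, map_one, Module.End.one_apply, smul_smul, inv_mul_cancel₀ (hpow _),
      one_smul]
  case Z_central x =>
    simp only [map_mul, FreeAlgebra.lift_ι_apply, Module.End.mul_apply, op_Z_apply, map_smul]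
  case E_F =>
    simp only [map_mul, map_sub, map_smul, FreeAlgebra.lift_ι_apply, Module.End.mul_apply,
      LinearMap.sub_apply, LinearMap.smul_apply, op_E_single, op_F_single, op_K_single,
      op_Ki_single, map_add, o.e_f, o.ki_e hp, Finsupp.single_add, Finsupp.single_sub,
      single_smul]
    rcases j with _ | _ | j <;> try simp only [zero_add, Nat.reduceAdd, Nat.reduceSub]
    · simp only [cE_zero, zero_add, Nat.sub_self]
      simp only [cE, hqi, hqi2]
      match_scalars <;> (try simp only [cX, cE]) <;> (try field_simp) <;> (try ring)
    · simp only [cE_one, zero_add, show 1 + 2 - 2 = 1 from rfl]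
      simp only [cE, hqi, hqi2]
      match_scalars <;> (try simp only [cX, cE]) <;> (try field_simp) <;> (try ring)
    · simp only [show j + 1 + 1 - 2 = j by omega, show j + 1 + 1 + 2 - 2 = j + 2 by omega]
      simp only [cE, hqi, hqi2]
      match_scalars <;> (try simp only [cX, cE]) <;> (try field_simp) <;> (try ring)
  case K_X =>
    simp only [map_mul, map_sub, map_smul, FreeAlgebra.lift_ι_apply, Module.End.mul_apply,
      LinearMap.smul_apply, op_X_single, op_K_single, op_Ki_single, o.k_ki]
    rcases j with _ | j <;> try simp only [zero_add, Nat.reduceAdd, Nat.reduceSub]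
    · simp only [cX_zero, zero_smul, smul_zero]
    · simp only [Nat.add_sub_cancel]
      match_scalars <;> (try simp only [cX, cE]) <;> (try field_simp) <;> (try ring)
  case K_E =>
    simp only [map_mul, map_sub, map_smul, map_add, FreeAlgebra.lift_ι_apply,
      Module.End.mul_apply, LinearMap.smul_apply, op_E_single, op_K_single, op_Ki_single, o.k_ki,
      o.k_e, single_smul]
    rcases j with _ | _ | j <;> try simp only [zero_add, Nat.reduceAdd, Nat.reduceSub]
    · simp only [cE_zero]
      match_scalars <;> (try simp only [cX, cE]) <;> (try field_simp) <;> (try ring)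
    · simp only [cE_one]
      match_scalars <;> (try simp only [cX, cE]) <;> (try field_simp) <;> (try ring)
    · simp only [show j + 1 + 1 - 2 = j by omega]
      match_scalars <;> (try simp only [cX, cE]) <;> (try field_simp) <;> (try ring)
  case K_F =>
    simp only [map_mul, map_sub, map_smul, map_add, FreeAlgebra.lift_ι_apply,
      Module.End.mul_apply, LinearMap.smul_apply, op_F_single, op_K_single, op_Ki_single, o.k_ki,
      o.k_f, single_smul]
    match_scalars <;> (try simp only [cX, cE]) <;> (try field_simp) <;> (try ring)
  case K_Y =>
    simp only [map_mul, map_sub, map_smul, map_add, FreeAlgebra.lift_ι_apply,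
      Module.End.mul_apply, LinearMap.smul_apply, op_Y_single, op_K_single, op_Ki_single, o.k_ki]
    match_scalars <;> (try simp only [cX, cE]) <;> (try field_simp) <;> (try ring)
  case Y_X =>
    simp only [map_mul, map_sub, map_smul, map_add, FreeAlgebra.lift_ι_apply,
      Module.End.mul_apply, LinearMap.smul_apply, LinearMap.sub_apply, op_Y_single, op_X_single,
      op_Z_apply]
    rcases j with _ | j <;> try simp only [zero_add, Nat.reduceAdd, Nat.reduceSub]
    · simp only [cX_zero, Nat.add_sub_cancel]
      match_scalars <;> (try simp only [cX, cE]) <;> (try field_simp) <;> (try ring)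
    · simp only [Nat.add_sub_cancel]
      match_scalars <;> (try simp only [cX, cE]) <;> (try field_simp) <;> (try ring)
  case E_X =>
    simp only [map_mul, map_sub, map_smul, map_add, FreeAlgebra.lift_ι_apply,
      Module.End.mul_apply, LinearMap.smul_apply, op_X_single, op_E_single]
    rcases j with _ | _ | _ | j <;> try simp only [zero_add, Nat.reduceAdd, Nat.reduceSub]
    · simp only [cX_zero, cE_zero]
      match_scalars <;> (try simp only [cX, cE]) <;> (try field_simp) <;> (try ring)
    · simp only [cE_one, cE_zero, Nat.add_sub_cancel]
      match_scalars <;> (try simp only [cX, cE]) <;> (try field_simp) <;> (try ring)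
    · simp only [cE_one, cX_zero, Nat.add_sub_cancel, show 0 + 1 + 1 - 1 = 1 from rfl,
        show 0 + 1 + 1 - 2 = 0 from rfl]
      match_scalars <;> (try simp only [cX, cE]) <;> (try field_simp) <;> (try ring)
    · simp only [show j + 1 + 1 + 1 - 1 = j + 2 by omega, show j + 1 + 1 + 1 - 2 = j + 1 by omega,
        Nat.add_sub_cancel]
      match_scalars <;> (try simp only [cX, cE]) <;> (try field_simp) <;> (try ring)
  case E_Y =>
    simp only [map_mul, map_sub, map_smul, map_add, FreeAlgebra.lift_ι_apply,
      Module.End.mul_apply, LinearMap.smul_apply, LinearMap.add_apply, op_X_single, op_E_single,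
      op_Y_single]
    rcases j with _ | _ | j <;> try simp only [zero_add, Nat.reduceAdd, Nat.reduceSub]
    · simp only [cX_zero, cE_zero, cE_one]
      match_scalars <;> (try simp only [cX, cE]) <;> (try field_simp) <;> (try ring)
    · simp only [cE_one, Nat.add_sub_cancel, show 1 + 1 - 2 = 0 from rfl]
      match_scalars <;> (try simp only [cX, cE]) <;> (try field_simp) <;> (try ring)
    · simp only [show j + 1 + 1 - 1 = j + 1 by omega, show j + 1 + 1 - 2 = j by omega,
        show j + 1 + 1 + 1 - 2 = j + 1 by omega]
      match_scalars <;> (try simp only [cX, cE]) <;> (try field_simp) <;> (try ring)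
  case F_X =>
    simp only [map_mul, map_sub, map_smul, map_add, FreeAlgebra.lift_ι_apply,
      Module.End.mul_apply, LinearMap.smul_apply, LinearMap.add_apply, op_X_single, op_F_single,
      op_Y_single, op_Ki_single]
    rcases j with _ | j <;> try simp only [zero_add, Nat.reduceAdd, Nat.reduceSub]
    · simp only [cX_zero, show 0 + 2 - 1 = 0 + 1 from rfl]
      match_scalars <;> (try simp only [cX, cE]) <;> (try field_simp) <;> (try ring)
    · simp only [Nat.add_sub_cancel, show j + 1 + 2 - 1 = j + 2 by omega]
      match_scalars <;> (try simp only [cX, cE]) <;> (try field_simp) <;> (try ring)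
  case F_Y =>
    simp only [map_mul, FreeAlgebra.lift_ι_apply,
      Module.End.mul_apply, op_F_single, op_Y_single, map_add, map_smul]

end Sl2Ops

/-- The `U_q(𝔰)`-module `ℂ[Y] ⊗ N`. -/
def Induced {q s z : ℂ} (_ : Par q s z) {N : Type} [AddCommGroup N] [Module ℂ N]
    (_ : Sl2Ops q N) : Type := ℕ →₀ N

namespace Induced

variable {q s z : ℂ} (hp : Par q s z) {N : Type} [AddCommGroup N] [Module ℂ N] (o : Sl2Ops q N)

instance : AddCommGroup (Induced hp o) := inferInstanceAs (AddCommGroup (ℕ →₀ N))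
instance : Module ℂ (Induced hp o) := inferInstanceAs (Module ℂ (ℕ →₀ N))

/-- The action of `U_q(𝔰)`. -/
def rep : UqS q →ₐ[ℂ] Module.End ℂ (ℕ →₀ N) := repHom (o.op z) (o.op_rel hp)

instance : Module (UqS q) (Induced hp o) := Module.compHom (ℕ →₀ N) (rep hp o).toRingHom

lemma smul_eq (u : UqS q) (v : Induced hp o) : u • v = rep hp o u v := rfl

instance : IsScalarTower ℂ (UqS q) (Induced hp o) where
  smul_assoc c u v := by
    rw [smul_eq, smul_eq, map_smul]; rfl

/-- The vector `y^j ⊗ n`. -/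
def y (j : ℕ) : N →ₗ[ℂ] Induced hp o := Finsupp.lsingle j

lemma gen_smul (x : Gen) (v : Induced hp o) : gen q x • v = o.op z x v := by
  rw [smul_eq, rep, repHom_gen]

lemma E_y (j : ℕ) (n : N) : gen q .E • y hp o j n =
    Sl2Ops.cE q z j • y hp o (j - 2) n + (q ^ j)⁻¹ • y hp o j (o.e n) := by
  rw [gen_smul]; exact o.op_E_single j n

lemma F_y (j : ℕ) (n : N) : gen q .F • y hp o j n =
    y hp o j (o.f n) + ((q + 1) * z)⁻¹ • y hp o (j + 2) (o.ki n) := by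
  rw [gen_smul]; exact o.op_F_single j n

lemma K_y (j : ℕ) (n : N) : gen q .K • y hp o j n = (q ^ j)⁻¹ • y hp o j (o.k n) := by
  rw [gen_smul]; exact o.op_K_single j n

lemma Ki_y (j : ℕ) (n : N) : gen q .Ki • y hp o j n = q ^ j • y hp o j (o.ki n) := by
  rw [gen_smul]; exact o.op_Ki_single j n

lemma X_y (j : ℕ) (n : N) :
    gen q .X • y hp o j n = Sl2Ops.cX q z j • y hp o (j - 1) n := by
  rw [gen_smul]; exact o.op_X_single j n

lemma Y_y (j : ℕ) (n : N) : gen q .Y • y hp o j n = y hp o (j + 1) n := by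
  rw [gen_smul]; exact o.op_Y_single j n

lemma Z_smul (v : Induced hp o) : gen q .Z • v = z • v := by
  rw [gen_smul]; rfl

variable {hp o} in
lemma induction {P : Induced hp o → Prop} (h0 : P 0) (ha : ∀ u v, P u → P v → P (u + v))
    (hy : ∀ j n, P (y hp o j n)) (v : Induced hp o) : P v :=
  Finsupp.induction_linear (motive := P) v h0 ha hy

lemma y_injective (j : ℕ) : Function.Injective (y hp o j) := Finsupp.single_injective j

/-- The coefficient of `y^j`. -/
def coeff (j : ℕ) : Induced hp o →ₗ[ℂ] N := Finsupp.lapply j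

lemma coeff_y_self (j : ℕ) (n : N) : coeff hp o j (y hp o j n) = n :=
  Finsupp.single_eq_same

lemma coeff_y_ne {i j : ℕ} (h : i ≠ j) (n : N) : coeff hp o i (y hp o j n) = 0 :=
  Finsupp.single_eq_of_ne h

lemma ext_coeff {u v : Induced hp o} (h : ∀ j, coeff hp o j u = coeff hp o j v) : u = v :=
  Finsupp.ext (f := (show ℕ →₀ N from u)) h

lemma coeff_X_smul (v : Induced hp o) (j : ℕ) : coeff hp o j (gen q .X • v) =
    Sl2Ops.cX q z (j + 1) • coeff hp o (j + 1) v := by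
  refine induction (P := fun v => coeff hp o j (gen q .X • v) =
    Sl2Ops.cX q z (j + 1) • coeff hp o (j + 1) v) (by simp)
    (fun u v hu hv => by rw [smul_add, map_add, map_add, smul_add, hu, hv]) (fun i n => ?_) v
  rw [X_y, map_smul]
  rcases i with _ | i
  · rw [Sl2Ops.cX_zero, zero_smul, coeff_y_ne hp o (by omega), smul_zero]
  · rw [Nat.add_sub_cancel]
    by_cases h : j = i
    · subst h; rw [coeff_y_self, coeff_y_self]
    · rw [coeff_y_ne hp o h, coeff_y_ne hp o (by omega), smul_zero, smul_zero]

/-- A vector killed by `X` is of the form `1 ⊗ n`. -/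
lemma exists_of_X_smul_eq_zero {v : Induced hp o} (hv : gen q .X • v = 0) :
    ∃ n, v = y hp o 0 n := by
  refine ⟨coeff hp o 0 v, ext_coeff hp o fun j => ?_⟩
  rcases j with _ | j
  · rw [coeff_y_self]
  · have h1 := coeff_X_smul hp o v j
    rw [hv, map_zero] at h1
    rw [coeff_y_ne hp o (by omega)]
    -- The coefficient by which `X` lowers `y^(j+1)` is nonzero because `z ≠ 0` and `q` is not a
    -- root of unity.
    refine (smul_eq_zero_iff_right ?_).mp h1.symm
    exact div_ne_zero (mul_ne_zero (neg_ne_zero.mpr hp.z0) (hp.pow_ne j)) hp.q1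

lemma X_pow_y (j : ℕ) (n : N) : gen q .X ^ (j + 1) • y hp o j n = 0 := by
  induction j with
  | zero => rw [zero_add, pow_one, X_y, Sl2Ops.cX_zero, zero_smul]
  | succ j ih => rw [pow_succ, mul_smul, X_y, gen_smul_comm, Nat.add_sub_cancel, ih, smul_zero]

lemma X_locally_nilpotent (v : Induced hp o) : ∃ i : ℕ, gen q .X ^ i • v = 0 := by
  refine induction (P := fun v => ∃ i : ℕ, gen q .X ^ i • v = 0) ⟨0, by simp⟩ ?_
    (fun j n => ⟨_, X_pow_y hp o j n⟩) v
  rintro u v ⟨i, hi⟩ ⟨j, hj⟩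
  refine ⟨i + j, ?_⟩
  rw [smul_add, pow_add, mul_smul _ _ v, hj, ← pow_add, add_comm i j, pow_add, mul_smul, hi,
    smul_zero, smul_zero, add_zero]

variable {M : Type} [AddCommGroup M] [Module ℂ M] [Module (UqS q) M] [IsScalarTower ℂ (UqS q) M]

/-- A map from `ℂ[Y] ⊗ N` that is injective on `1 ⊗ N` is injective. -/
lemma injective_of_y_zero (φ : Induced hp o →ₗ[UqS q] M)
    (h : ∀ n, φ (y hp o 0 n) = 0 → n = 0) : Function.Injective φ := by
  rw [injective_iff_map_eq_zero]
  intro v hv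
  by_contra hne
  -- A nonzero kernel vector can be lowered by `X` to a nonzero kernel vector that `X` kills; this
  -- one lies in `1 ⊗ N`, where injectivity is assumed.
  obtain ⟨i, hi, hi2⟩ := exists_last_pow hne (X_locally_nilpotent hp o v)
  obtain ⟨n, hn⟩ := exists_of_X_smul_eq_zero hp o hi2
  apply hi
  rw [hn, h n (by rw [← hn, map_smul, hv, smul_zero]), map_zero]

/-- The compatibility of a linear map `N → M` with the `U_q(𝔰𝔩₂)`-action on the kernel of `X`. -/
structure Compat (φ : N →ₗ[ℂ] M) : Prop where
  X : ∀ n, gen q .X • φ n = 0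
  E : ∀ n, gen q .E • φ n = φ (o.e n)
  K : ∀ n, gen q .K • φ n = φ (o.k n)
  F : ∀ n, gen q .F • φ n =
    φ (o.f n) + ((q + 1) * z)⁻¹ • gen q .Y • gen q .Y • φ (o.ki n)
  Z : ∀ v : M, gen q .Z • v = z • v

variable {hp o} {φ : N →ₗ[ℂ] M} (hφ : Compat (z := z) o φ)
include hφ

lemma Compat.Ki (n : N) : gen q .Ki • φ n = φ (o.ki n) := by
  have h := hφ.K (o.ki n)
  rw [o.k_ki] at h
  rw [← h, Ki_K_smul]

lemma Compat.K_Y (j : ℕ) (n : N) :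
    gen q .K • gen q .Y ^ j • φ n = (q ^ j)⁻¹ • gen q .Y ^ j • φ (o.k n) := by
  induction j with
  | zero => simp [hφ.K]
  | succ j ih =>
    rw [pow_succ' (gen q .Y), mul_smul, K_Y_smul, ih, gen_smul_comm, mul_smul (gen q .Y),
      pow_succ, mul_inv_rev, mul_smul q⁻¹]

lemma Compat.Ki_Y (hp : Par q s z) (j : ℕ) (n : N) :
    gen q .Ki • gen q .Y ^ j • φ n = q ^ j • gen q .Y ^ j • φ (o.ki n) := by
  have h := hφ.K_Y j (o.ki n)
  rw [o.k_ki] at h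
  have h2 := congrArg (fun w => q ^ j • gen q .Ki • w) h
  simp only [gen_smul_comm (gen q .Ki) (q ^ j)⁻¹] at h2
  rw [Ki_K_smul, smul_inv_smul₀ (pow_ne_zero j hp.q0)] at h2
  exact h2.symm

/-- Each exchange of `X` with a factor `Y` multiplies by `q` and splits off `-z`. The result is the
geometric sum `-z(1 + q + ⋯ + q^(j-1))`, which is `cX`. -/
lemma Compat.X_Y (hp : Par q s z) (j : ℕ) (n : N) :
    gen q .X • gen q .Y ^ j • φ n = Sl2Ops.cX q z j • gen q .Y ^ (j - 1) • φ n := by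
  obtain ⟨t, ht⟩ : ∃ t : ℕ → M, ∀ j, gen q .Y ^ j • φ n = t j := ⟨_, fun _ => rfl⟩
  have hY : ∀ j, gen q .Y • t j = t (j + 1) := fun j => by
    rw [← ht, ← ht, pow_succ', mul_smul]
  have hX : gen q .X • t 0 = 0 := by rw [← ht, pow_zero, one_smul, hφ.X]
  simp only [ht]
  have hq1 := hp.q1
  induction j with
  | zero => simp [hX, Sl2Ops.cX_zero]
  | succ j ih =>
    rw [← hY, X_Y_smul, ih, hφ.Z, gen_smul_comm, Nat.add_sub_cancel]
    rcases j with _ | j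
    · simp only [Sl2Ops.cX_zero, zero_smul, smul_zero, zero_sub]
      simp only [Sl2Ops.cX]
      match_scalars
      field_simp
      ring
    · rw [Nat.add_sub_cancel, hY]
      simp only [Sl2Ops.cX]
      match_scalars
      field_simp
      ring

/-- Moving `E` past one `Y` leaves an `X` that still has to cross the remaining factors. This gives
the recursion `cE (j+1) = cX j + q⁻¹ cE j`, whose closed form is the definition of `cE`. -/
lemma Compat.E_Y (hp : Par q s z) (j : ℕ) (n : N) :
    gen q .E • gen q .Y ^ j • φ n = Sl2Ops.cE q z j • gen q .Y ^ (j - 2) • φ n +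
      (q ^ j)⁻¹ • gen q .Y ^ j • φ (o.e n) := by
  have hX := fun j => hφ.X_Y hp j n
  obtain ⟨t, ht⟩ : ∃ t : ℕ → M, ∀ j, gen q .Y ^ j • φ n = t j := ⟨_, fun _ => rfl⟩
  obtain ⟨t', ht'⟩ : ∃ t : ℕ → M, ∀ j, gen q .Y ^ j • φ (o.e n) = t j := ⟨_, fun _ => rfl⟩
  have hY : ∀ j, gen q .Y • t j = t (j + 1) := fun j => by
    rw [← ht, ← ht, pow_succ', mul_smul]
  have hY' : ∀ j, gen q .Y • t' j = t' (j + 1) := fun j => by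
    rw [← ht', ← ht', pow_succ', mul_smul]
  have hE : gen q .E • t 0 = t' 0 := by
    rw [← ht, ← ht', pow_zero, one_smul, one_smul, hφ.E]
  simp only [ht, ht'] at hX ⊢
  have hq0 := hp.q0
  have hq1 := hp.q1
  have hqp := hp.qp1
  induction j with
  | zero => simp [hE, Sl2Ops.cE_zero]
  | succ j ih =>
    rw [← hY, E_Y_smul, hX, ih, smul_add, gen_smul_comm, gen_smul_comm, hY']
    rcases j with _ | _ | j
    · simp only [Sl2Ops.cE_zero, Sl2Ops.cX_zero, zero_add, Sl2Ops.cE_one, zero_smul, smul_zero]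
      match_scalars <;> field_simp
    · simp only [Sl2Ops.cE_one, hY, show 1 - 1 = 0 from rfl, show 1 + 1 - 2 = 0 from rfl, zero_add]
      simp only [Sl2Ops.cX, Sl2Ops.cE]
      match_scalars <;> field_simp <;> ring
    · simp only [hY, show j + 1 + 1 - 1 = j + 1 by omega, show j + 1 + 1 - 2 = j by omega,
        show j + 1 + 1 + 1 - 2 = j + 1 by omega]
      simp only [Sl2Ops.cX, Sl2Ops.cE]
      match_scalars <;> field_simp <;> ring

lemma Compat.F_Y (j : ℕ) (n : N) :
    gen q .F • gen q .Y ^ j • φ n = gen q .Y ^ j • φ (o.f n) +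
      ((q + 1) * z)⁻¹ • gen q .Y ^ (j + 2) • φ (o.ki n) := by
  induction j with
  | zero => simp [hφ.F, pow_two, mul_smul]
  | succ j ih =>
    rw [pow_succ' (gen q .Y), mul_smul, F_Y_smul, ih, smul_add, gen_smul_comm, mul_smul,
      show j + 1 + 2 = j + 2 + 1 by omega, pow_succ' (gen q .Y) (j + 2), mul_smul]

omit hφ

/-- The linear map `y^j ⊗ n ↦ Y^j φ(n)`. -/
def liftLin (hp : Par q s z) (o : Sl2Ops q N) (φ : N →ₗ[ℂ] M) : Induced hp o →ₗ[ℂ] M :=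
  Finsupp.lsum ℂ fun j => (Algebra.lsmul ℂ ℂ M (gen q .Y ^ j)) ∘ₗ φ

lemma liftLin_y (j : ℕ) (n : N) : liftLin hp o φ (y hp o j n) = gen q .Y ^ j • φ n :=
  Finsupp.lsum_single _ _ _ _

/-- The `U_q(𝔰)`-linear map `ℂ[Y] ⊗ N → M` extending a compatible map `N → M`. -/
def lift (hp : Par q s z) (hφ : Compat (z := z) o φ) : Induced hp o →ₗ[UqS q] M :=
  linearOfGen (liftLin hp o φ) (by
  intro x v
  refine induction (P := fun v => liftLin hp o φ (gen q x • v) = gen q x • liftLin hp o φ v)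
    (by simp) (fun u v hu hv => by rw [smul_add, map_add, map_add, smul_add, hu, hv])
    (fun j n => ?_) v
  cases x
  · rw [E_y, map_add, map_smul, map_smul, liftLin_y, liftLin_y, liftLin_y, hφ.E_Y hp]
  · rw [F_y, map_add, map_smul, liftLin_y, liftLin_y, liftLin_y, hφ.F_Y]
  · rw [K_y, map_smul, liftLin_y, liftLin_y, hφ.K_Y]
  · rw [Ki_y, map_smul, liftLin_y, liftLin_y, hφ.Ki_Y hp]
  · rw [X_y, map_smul, liftLin_y, liftLin_y, hφ.X_Y hp]
  · rw [Y_y, liftLin_y, liftLin_y, pow_succ', mul_smul]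
  · rw [Z_smul, map_smul, hφ.Z])

lemma lift_y (hφ : Compat (z := z) o φ) (j : ℕ) (n : N) :
    lift hp hφ (y hp o j n) = gen q .Y ^ j • φ n := liftLin_y j n

end Induced

/-! ### The kernel of `X` and the Casimir element -/

section KerX

variable {q s z : ℂ} {M : Type} [AddCommGroup M] [Module ℂ M] [Module (UqS q) M]
  [IsScalarTower ℂ (UqS q) M]

-- With the action written through opaque functions, the ordered words in the generators become
-- atoms, and identities between them are compared coefficient by coefficient.
variable (q M) in
lemma exists_action : ∃ A : Gen → M → M, ∀ x v, gen q x • v = A x v := ⟨_, fun _ _ => rfl⟩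

/-- The kernel of `X`. -/
def kerX (q : ℂ) (M : Type) [AddCommGroup M] [Module ℂ M] [Module (UqS q) M]
    [IsScalarTower ℂ (UqS q) M] : Submodule ℂ M :=
  LinearMap.ker (Algebra.lsmul ℂ ℂ M (gen q .X))

lemma mem_kerX {v : M} : v ∈ kerX q M ↔ gen q .X • v = 0 := Iff.rfl

lemma Ki_E_smul (hq : q ≠ 0) (v : M) :
    gen q .Ki • gen q .E • v = (q ^ 2)⁻¹ • gen q .E • gen q .Ki • v :=
  Ki_smul_of_K (pow_ne_zero 2 hq) K_E_smul v

lemma Ki_X_smul (hq : q ≠ 0) (v : M) :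
    gen q .Ki • gen q .X • v = q⁻¹ • gen q .X • gen q .Ki • v :=
  Ki_smul_of_K hq K_X_smul v

lemma Ki_Y_smul (hq : q ≠ 0) (v : M) :
    gen q .Ki • gen q .Y • v = q • gen q .Y • gen q .Ki • v := by
  rw [Ki_smul_of_K (inv_ne_zero hq) K_Y_smul v, inv_inv]

lemma Z_gen_smul (x : Gen) (v : M) : gen q .Z • gen q x • v = gen q x • gen q .Z • v := by
  rw [← mul_smul, Z_gen, mul_smul]

/-- `C̃` commutes with `Y`. -/
lemma Ctilde_Y_smul (hp : Par q s z) (v : M) :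
    Ctilde q • gen q .Y • v = gen q .Y • Ctilde q • v := by
  have hq0 := hp.q0
  have hq1 := hp.q1
  have hqp := hp.qp1
  have hqi : (q - q⁻¹)⁻¹ = q / ((q - 1) * (q + 1)) := by
    have hqq : q - q⁻¹ ≠ 0 := fun h => hp.q21 (by field_simp at h; linear_combination h)
    rw [inv_eq_iff_eq_inv]; field_simp; ring
  have hqi2 : ((q - q⁻¹) ^ 2)⁻¹ = (q / ((q - 1) * (q + 1))) ^ 2 := by
    rw [← inv_pow, hqi]
  have hqi3 : (q ^ 2 - 1)⁻¹ = 1 / ((q - 1) * (q + 1)) := by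
    have := hp.q21
    rw [inv_eq_iff_eq_inv]; field_simp; ring
  have assoc : ∀ (c : ℂ) (u : UqS q) (w : M), (c • u) • w = c • u • w :=
    fun c u w => smul_assoc c u w
  have mulU : ∀ (u u' : UqS q) (w : M), (u * u') • w = u • u' • w := mul_smul
  simp only [Ctilde, casimir, add_smul, sub_smul, mulU, assoc, pow_two, gen_smul_comm, smul_add,
    smul_sub, F_Y_smul, E_Y_smul, X_Y_smul, K_Y_smul, Ki_Y_smul hq0, E_F_smul, E_X_smul,
    X_F_smul, K_X_smul, Ki_X_smul hq0, K_E_smul, Ki_E_smul hq0, K_F_smul,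
    Z_gen_smul, K_Ki_smul, Ki_K_smul]
  simp only [← pow_two, hqi, hqi2, hqi3]
  obtain ⟨A, hA⟩ := exists_action q M
  simp only [hA]
  match_scalars <;> (try field_simp) <;> (try ring)

/-- The operators induced on the kernel of `X`. -/
def kerOps (hp : Par q s z) (hz : ∀ v : M, gen q .Z • v = z • v) : Sl2Ops q (kerX q M) where
  e := (Algebra.lsmul ℂ ℂ M (gen q .E)).restrict (p := kerX q M) (q := kerX q M)
    fun _ hv => X_E_smul_eq_zero hp.q0 hv
  -- For `v` in the kernel of `X` one has `XFv = -YK⁻¹v` and `XY²K⁻¹v = -(q+1)zYK⁻¹v`. This dictates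
  -- the constant in the correction term.
  f := (Algebra.lsmul ℂ ℂ M (gen q .F) -
      ((q + 1) * z)⁻¹ • Algebra.lsmul ℂ ℂ M (gen q .Y * (gen q .Y * gen q .Ki))).restrict
      (p := kerX q M) (q := kerX q M) (by
    intro v hv
    rw [mem_kerX] at hv ⊢
    change gen q .X • (gen q .F • v - ((q + 1) * z)⁻¹ • (gen q .Y * (gen q .Y * gen q .Ki)) • v) = 0
    have hqp := hp.qp1
    have hz0 := hp.z0
    simp only [mul_smul, smul_sub, gen_smul_comm, X_F_smul, X_Y_smul, hz, hv, smul_zero,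
      ← Ki_X_smul hp.q0]
    have hX : gen q .X • gen q .Ki • v = 0 := by
      have := Ki_X_smul hp.q0 v
      rw [hv, smul_zero] at this
      exact (smul_eq_zero_iff_right (inv_ne_zero hp.q0)).mp this.symm
    rw [hX]
    simp only [smul_zero, zero_sub, gen_smul_comm]
    obtain ⟨A, hA⟩ := exists_action q M
    simp only [hA]
    match_scalars
    field_simp
    ring)
  k := (Algebra.lsmul ℂ ℂ M (gen q .K)).restrict (p := kerX q M) (q := kerX q M) (by
    intro v hv
    rw [mem_kerX] at hv ⊢
    have := K_X_smul (q := q) v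
    rw [hv, smul_zero] at this
    exact (smul_eq_zero_iff_right hp.q0).mp this.symm)
  ki := (Algebra.lsmul ℂ ℂ M (gen q .Ki)).restrict (p := kerX q M) (q := kerX q M) (by
    intro v hv
    rw [mem_kerX] at hv ⊢
    have := Ki_X_smul hp.q0 v
    rw [hv, smul_zero] at this
    exact (smul_eq_zero_iff_right (inv_ne_zero hp.q0)).mp this.symm)
  k_ki n := Subtype.ext (K_Ki_smul (n : M))
  ki_k n := Subtype.ext (Ki_K_smul (n : M))
  k_e n := Subtype.ext (K_E_smul (n : M))
  k_f n := Subtype.ext (by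
    change gen q .K • (gen q .F • (n : M) -
        ((q + 1) * z)⁻¹ • (gen q .Y * (gen q .Y * gen q .Ki)) • (n : M)) =
      (q ^ 2)⁻¹ • (gen q .F • gen q .K • (n : M) -
        ((q + 1) * z)⁻¹ • (gen q .Y * (gen q .Y * gen q .Ki)) • gen q .K • (n : M))
    have hqp := hp.qp1
    have hz0 := hp.z0
    have hq0 := hp.q0
    simp only [mul_smul, smul_sub, gen_smul_comm, K_F_smul, K_Y_smul, Ki_K_smul, K_Ki_smul]
    obtain ⟨A, hA⟩ := exists_action q M
    simp only [hA]
    match_scalars <;> field_simp)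
  e_f n := Subtype.ext (by
    change gen q .E • (gen q .F • (n : M) -
        ((q + 1) * z)⁻¹ • (gen q .Y * (gen q .Y * gen q .Ki)) • (n : M)) =
      (gen q .F • gen q .E • (n : M) -
        ((q + 1) * z)⁻¹ • (gen q .Y * (gen q .Y * gen q .Ki)) • gen q .E • (n : M)) +
      (q ^ 2 - 1)⁻¹ • (q • gen q .K • (n : M) - gen q .Ki • (n : M))
    have hX : gen q .X • gen q .Ki • (n : M) = 0 := by
      have := Ki_X_smul hp.q0 (n : M)
      rw [mem_kerX.mp n.2, smul_zero] at this
      exact (smul_eq_zero_iff_right (inv_ne_zero hp.q0)).mp this.symm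
    have hqp := hp.qp1
    have hq1 := hp.q1
    have hz0 := hp.z0
    have hq0 := hp.q0
    have hqi : (q - q⁻¹)⁻¹ = q / ((q - 1) * (q + 1)) := by
      have hqq : q - q⁻¹ ≠ 0 := fun h => hp.q21 (by field_simp at h; linear_combination h)
      rw [inv_eq_iff_eq_inv]; field_simp; ring
    have hqi3 : (q ^ 2 - 1)⁻¹ = 1 / ((q - 1) * (q + 1)) := by
      have := hp.q21
      rw [inv_eq_iff_eq_inv]; field_simp; ring
    simp only [mul_smul, smul_sub, smul_add, gen_smul_comm, E_F_smul, E_Y_smul, Ki_E_smul hq0, hX,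
      X_Y_smul, hz, smul_zero, hqi, hqi3]
    obtain ⟨A, hA⟩ := exists_action q M
    simp only [hA]
    match_scalars <;> (try field_simp) <;> (try ring))

variable (hp : Par q s z) (hz : ∀ v : M, gen q .Z • v = z • v)

lemma coe_kerOps_e (n : kerX q M) : ((kerOps hp hz).e n : M) = gen q .E • (n : M) := rfl

lemma coe_kerOps_ki (n : kerX q M) : ((kerOps hp hz).ki n : M) = gen q .Ki • (n : M) := rfl

lemma coe_kerOps_f (n : kerX q M) : ((kerOps hp hz).f n : M) = gen q .F • (n : M) -
    ((q + 1) * z)⁻¹ • gen q .Y • gen q .Y • gen q .Ki • (n : M) := by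
  rw [← mul_smul (gen q .Y) (gen q .Ki), ← mul_smul]; rfl

/-- On the kernel of `X`, the element `C̃` acts through the Casimir operator of `U_q(𝔰𝔩₂)`. -/
lemma Ctilde_smul_kerX {ν : ℂ} (n : kerX q M) (hn : (kerOps hp hz).k n = ν • n) (hν : ν ≠ 0) :
    Ctilde q • (n : M) = ctilde q ν z • (n : M) +
      (z * (q + 1)) • ((kerOps hp hz).f ((kerOps hp hz).e n) : M) := by
  rw [coe_kerOps_f, coe_kerOps_e]
  have hX := mem_kerX.mp n.2
  have hK : gen q .K • (n : M) = ν • (n : M) := congrArg Subtype.val hn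
  generalize (n : M) = v at *
  have hXE := X_E_smul_eq_zero hp.q0 hX
  have hKi : gen q .Ki • v = ν⁻¹ • v := Ki_smul_of_mem hν (mem_weightSpace.mpr hK)
  have hq0 := hp.q0
  have hz0 := hp.z0
  have hq1 := hp.q1
  have hqp := hp.qp1
  have hqi : (q - q⁻¹)⁻¹ = q / ((q - 1) * (q + 1)) := by
    have hqq : q - q⁻¹ ≠ 0 := fun h => hp.q21 (by field_simp at h; linear_combination h)
    rw [inv_eq_iff_eq_inv]; field_simp; ring
  have hqi2 : ((q - q⁻¹) ^ 2)⁻¹ = (q / ((q - 1) * (q + 1))) ^ 2 := by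
    rw [← inv_pow, hqi]
  have hqi4 : z / (q - q⁻¹) ^ 2 = z * (q / ((q - 1) * (q + 1))) ^ 2 := by
    rw [div_eq_mul_inv, hqi2]
  have hqi3 : (q ^ 2 - 1)⁻¹ = 1 / ((q - 1) * (q + 1)) := by
    have := hp.q21
    rw [inv_eq_iff_eq_inv]; field_simp; ring
  have assoc : ∀ (c : ℂ) (u : UqS q) (w : M), (c • u) • w = c • u • w :=
    fun c u w => smul_assoc c u w
  have mulU : ∀ (u u' : UqS q) (w : M), (u * u') • w = u • u' • w := mul_smul
  simp only [Ctilde, casimir, ctilde, add_smul, sub_smul, mulU, assoc, gen_smul_comm, smul_add,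
    smul_sub, pow_two, F_Y_smul, E_Y_smul, X_Y_smul, K_Y_smul, Ki_Y_smul hq0, E_F_smul, E_X_smul,
    X_F_smul, K_X_smul, Ki_X_smul hq0, K_E_smul, Ki_E_smul hq0, K_F_smul,
    hz, hX, hXE, hK, hKi, smul_zero]
  simp only [← pow_two, hqi, hqi2, hqi3, hqi4]
  obtain ⟨A, hA⟩ := exists_action q M
  simp only [hA]
  match_scalars <;> (try field_simp) <;> (try ring)

lemma compat_kerOps : Induced.Compat (z := z) (kerOps hp hz) (kerX q M).subtype where
  X n := mem_kerX.mp n.2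
  E _ := rfl
  K _ := rfl
  F n := by
    change _ = ((kerOps hp hz).f n : M) + _ • gen q .Y • gen q .Y • ((kerOps hp hz).ki n : M)
    rw [coe_kerOps_f, coe_kerOps_ki, sub_add_cancel]
    rfl
  Z := hz

/-- The canonical map `ℂ[Y] ⊗ ker X → M`. -/
def kerLift : Induced hp (kerOps hp hz) →ₗ[UqS q] M := Induced.lift hp (compat_kerOps hp hz)

lemma kerLift_y (j : ℕ) (n : kerX q M) :
    kerLift hp hz (Induced.y hp _ j n) = gen q .Y ^ j • (n : M) :=
  Induced.lift_y _ _ _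

/-- Injectivity need only be tested on `1 ⊗ ker X`. For surjectivity, induct on the power of `X`
killing `v`: `Xv` has a preimage, `X` is onto on `ℂ[Y] ⊗ ker X`, so `v` is in the image up to a
vector of `ker X`. -/
lemma kerLift_bijective (hX : ∀ v : M, ∃ i : ℕ, gen q .X ^ i • v = 0) :
    Function.Bijective (kerLift hp hz) := by
  refine ⟨Induced.injective_of_y_zero hp _ _ fun n hn => ?_, fun v => ?_⟩
  · rw [kerLift_y, pow_zero, one_smul] at hn
    exact Subtype.ext hn
  · have hsurj : ∀ w : Induced hp (kerOps hp hz), ∃ w', gen q .X • w' = w := by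
      refine Induced.induction ⟨0, smul_zero _⟩ ?_ fun j n => ?_
      · rintro _ _ ⟨a, rfl⟩ ⟨b, rfl⟩
        exact ⟨a + b, smul_add _ _ _⟩
      · have hc : Sl2Ops.cX q z (j + 1) ≠ 0 :=
          div_ne_zero (mul_ne_zero (neg_ne_zero.mpr hp.z0) (hp.pow_ne j)) hp.q1
        refine ⟨(Sl2Ops.cX q z (j + 1))⁻¹ • Induced.y hp _ (j + 1) n, ?_⟩
        rw [gen_smul_comm, Induced.X_y, Nat.add_sub_cancel, inv_smul_smul₀ hc]
    obtain ⟨i, hi⟩ := hX v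
    induction i generalizing v with
    | zero => exact ⟨0, by rw [map_zero]; simpa using hi.symm⟩
    | succ i ih =>
      rw [pow_succ, mul_smul] at hi
      obtain ⟨w, hw⟩ := ih _ hi
      obtain ⟨w', rfl⟩ := hsurj w
      have hker : gen q .X • (v - kerLift hp hz w') = 0 := by
        rw [smul_sub, ← hw, map_smul, sub_self]
      refine ⟨w' + Induced.y hp _ 0 ⟨_, hker⟩, ?_⟩
      rw [map_add, kerLift_y, pow_zero, one_smul]
      simp

end KerX

/-! ### Weights and central characters -/

section Weights

variable {q s z : ℂ} (hp : Par q s z)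

/-- The weights `λ q^(-2k)`, where `λ = s^(2m-3)`. -/
def wt (s : ℂ) (m k : ℕ) : ℂ := s ^ (2 * m - 3 - 4 * k : ℤ)

/-- The eigenvalue of `FE` on the weight space of `λ q^(-2k)`, up to nilpotents. -/
def cc (q s z : ℂ) (m k : ℕ) : ℂ :=
  (ctilde q (wt s m 0) z - ctilde q (wt s m k) z) / (z * (q + 1))

include hp

lemma wt_ne (m k : ℕ) : wt s m k ≠ 0 := zpow_ne_zero _ hp.s0

lemma wt_succ (m k : ℕ) : wt s m k = q ^ 2 * wt s m (k + 1) := by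
  rw [hp.q_pow_eq, wt, wt, ← zpow_add₀ hp.s0]
  congr 1; push_cast; ring

lemma wt_succ' (m k : ℕ) : (q ^ 2)⁻¹ * wt s m k = wt s m (k + 1) := by
  rw [wt_succ hp, inv_mul_cancel_left₀ (pow_ne_zero 2 hp.q0)]

lemma wt_injective (m : ℕ) : Function.Injective (wt s m) := fun i j h => by
  have := hp.s_zpow_inj h
  omega

lemma wt_zero_mul_wt_self (m : ℕ) : wt s m 0 * wt s m m = (q ^ 3)⁻¹ := by
  rw [hp.q_pow_eq, wt, wt, ← zpow_add₀ hp.s0, ← zpow_neg]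
  congr 1; push_cast; ring

lemma q_sub_inv : q - q⁻¹ = (q - 1) * (q + 1) / q := by
  have := hp.q0
  field_simp; ring

/-- `c̃_ν` is proportional to `ν + q⁻³ν⁻¹`, hence invariant under `ν ↦ q⁻³ν⁻¹`, the shifted action
of the Weyl group. The two factors of the difference record the two ways to be in the same orbit. -/
lemma ctilde_sub (ν ν' : ℂ) (hν : ν ≠ 0) (hν' : ν' ≠ 0) : ctilde q ν z - ctilde q ν' z =
    z * (q + q ^ 2) / (q - q⁻¹) ^ 2 * (ν - ν') * (ν * ν' - (q ^ 3)⁻¹) / (ν * ν') := by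
  have hq0 := hp.q0
  have hq1 := hp.q1
  have hqp := hp.qp1
  rw [ctilde, ctilde, q_sub_inv hp]
  field_simp
  ring

lemma ctilde_eq_iff {ν ν' : ℂ} (hν : ν ≠ 0) (hν' : ν' ≠ 0) :
    ctilde q ν z = ctilde q ν' z ↔ ν = ν' ∨ ν * ν' = (q ^ 3)⁻¹ := by
  have hq0 := hp.q0
  have hq1 := hp.q1
  have hqp := hp.qp1
  have hz := hp.z0
  have h1 : q + q ^ 2 ≠ 0 := by
    rw [show q + q ^ 2 = q * (q + 1) by ring]; exact mul_ne_zero hq0 hqp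
  have h2 : q - q⁻¹ ≠ 0 := by
    rw [q_sub_inv hp]; exact div_ne_zero (mul_ne_zero hq1 hqp) hq0
  rw [← sub_eq_zero, ctilde_sub hp ν ν' hν hν', ← sub_eq_zero (a := ν), ← sub_eq_zero (a := ν * ν')]
  simp [h1, h2, hz, hν, hν']

lemma ctilde_eq_wt_zero_iff (m : ℕ) {ν : ℂ} (hν : ν ≠ 0) :
    ctilde q (wt s m 0) z = ctilde q ν z ↔ ν = wt s m 0 ∨ ν = wt s m m := by
  rw [ctilde_eq_iff hp (wt_ne hp m 0) hν, eq_comm, ← wt_zero_mul_wt_self hp m,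
    mul_right_inj' (wt_ne hp m 0)]

lemma cc_zero (m : ℕ) : cc q s z m 0 = 0 := by simp [cc]

lemma cc_self (m : ℕ) : cc q s z m m = 0 := by
  rw [cc, (ctilde_eq_wt_zero_iff hp m (wt_ne hp m m)).mpr (Or.inr rfl), sub_self, zero_div]

/-- The orbit of `λ` meets the weights `λq^(-2k)` only at `k = 0` and `k = m`. This is what makes
`f` invertible away from one step. -/
lemma cc_ne_zero {m k : ℕ} (h0 : k ≠ 0) (hm : k ≠ m) : cc q s z m k ≠ 0 := by
  refine div_ne_zero (sub_ne_zero.mpr fun h => ?_) (mul_ne_zero hp.z0 hp.qp1)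
  rcases (ctilde_eq_wt_zero_iff hp m (wt_ne hp m k)).mp h with h | h
  · exact h0 (wt_injective hp m h)
  · exact hm (wt_injective hp m h)

/-- The commutator of `E` and `F` in terms of the central character. -/
lemma ctilde_shift {ν : ℂ} (hν : ν ≠ 0) :
    (ctilde q ν z - ctilde q ((q ^ 2)⁻¹ * ν) z) / (z * (q + 1)) =
      (q ^ 2 - 1)⁻¹ * (q * ν - ν⁻¹) := by
  have hq0 := hp.q0
  have hq1 := hp.q1
  have hqp := hp.qp1
  have hz := hp.z0
  have hqi3 : (q ^ 2 - 1)⁻¹ = 1 / ((q - 1) * (q + 1)) := by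
    have := hp.q21
    rw [inv_eq_iff_eq_inv]; field_simp; ring
  rw [ctilde, ctilde, q_sub_inv hp, hqi3]
  field_simp
  ring

/-- The commutator of `e` and `f` on a weight space is the difference of consecutive eigenvalues of
`fe`, so sums of commutators along a string telescope. -/
lemma cc_succ (m k : ℕ) : cc q s z m (k + 1) =
    cc q s z m k + (q ^ 2 - 1)⁻¹ * (q * wt s m k - (wt s m k)⁻¹) := by
  rw [← ctilde_shift hp (wt_ne hp m k), wt_succ' hp, cc, cc]
  ring

end Weights

/-! ### The `U_q(𝔰𝔩₂)`-module of a quiver representation -/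

/-- The vertex of the quiver governing the weight space of `λ q^(-2k)`. -/
def pos (m k : ℕ) : Vertex := if k < m then .two else .one

lemma pos_of_lt {m k : ℕ} (h : k < m) : pos m k = .two := if_pos h
lemma pos_of_le {m k : ℕ} (h : m ≤ k) : pos m k = .one := if_neg h.not_gt

/-- The linear maps of a quiver representation, with relation `ab = 0`; for `m = 0` the second
vertex is irrelevant. -/
structure QData (m : ℕ) (V : Vertex → Type) [∀ i, AddCommGroup (V i)]
    [∀ i, Module ℂ (V i)] where
  a : V .one →ₗ[ℂ] V .two
  b : V .two →ₗ[ℂ] V .one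
  ab : ∀ v, a (b v) = 0
  a_zero : m = 0 → a = 0

namespace QData

variable {q s z : ℂ} (hp : Par q s z) {m : ℕ} {V : Vertex → Type} [∀ i, AddCommGroup (V i)]
  [∀ i, Module ℂ (V i)] (d : QData m V)

/-- The action of `F` from one weight space to the next. -/
def step : (i j : Vertex) → V i →ₗ[ℂ] V j
  | .two, .two => LinearMap.id
  | .two, .one => d.b
  | .one, .one => LinearMap.id
  | .one, .two => 0

/-- The action of `E` from one weight space to the previous one. -/
def back (c : ℂ) : (i j : Vertex) → V i →ₗ[ℂ] V j
  | .two, .two => c • LinearMap.id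
  | .one, .two => d.a
  | .one, .one => c • LinearMap.id + d.b ∘ₗ d.a
  | .two, .one => 0

/-- The commutation relation of `e` and `f` on the middle one of three consecutive weight spaces,
governed by the vertices `i`, `j`, `l`. The hypotheses say that the vertices read `two, …, two, one,
…, one` and that the eigenvalue vanishes on entering `one`; `ab = 0` is needed when the jump comes
right after `j`. -/
lemma back_step (i j l : Vertex) (c c' : ℂ) (hij : j = .two → i = .two) (hjl : l = .two → j = .two)
    (h1 : j = .two → l = .one → c' = 0) (h2 : i = .two → j = .one → c = 0) (v : V j) :
    d.back c' l j (d.step j l v) = d.step i j (d.back c j i v) + (c' - c) • v := by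
  cases i <;> cases j <;> cases l <;> simp_all [back, step, d.ab, sub_smul] <;> abel

variable (m V) in
/-- The underlying space of the `U_q(𝔰𝔩₂)`-module. -/
abbrev Space : Type := DirectSum ℕ fun k => V (pos m k)

variable (m V) in
/-- The inclusion of a weight space. -/
abbrev inc (k : ℕ) : V (pos m k) →ₗ[ℂ] Space m V := DirectSum.lof ℂ ℕ (fun k => V (pos m k)) k

/-- The operator `E`. -/
def opE (q s z : ℂ) : Module.End ℂ (Space m V) :=
  DirectSum.toModule ℂ ℕ _ fun k => match k with
    | 0 => 0
    | k + 1 => inc m V k ∘ₗ d.back (cc q s z m (k + 1)) (pos m (k + 1)) (pos m k)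

/-- The operator `F`. -/
def opF : Module.End ℂ (Space m V) :=
  DirectSum.toModule ℂ ℕ _ fun k => inc m V (k + 1) ∘ₗ d.step (pos m k) (pos m (k + 1))

variable (m V) in
/-- The operator acting on weight spaces by given scalars. -/
def opDiag (c : ℕ → ℂ) : Module.End ℂ (Space m V) :=
  DirectSum.toModule ℂ ℕ _ fun k => c k • inc m V k

lemma opE_zero (v : V (pos m 0)) : d.opE q s z (inc m V 0 v) = 0 := by
  rw [opE, DirectSum.toModule_lof]; rfl

lemma opE_succ (k : ℕ) (v : V (pos m (k + 1))) : d.opE q s z (inc m V (k + 1) v) =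
    inc m V k (d.back (cc q s z m (k + 1)) _ _ v) := by
  rw [opE, DirectSum.toModule_lof]; rfl

lemma opF_inc (k : ℕ) (v : V (pos m k)) : d.opF (inc m V k v) =
    inc m V (k + 1) (d.step _ _ v) := by
  rw [opF, DirectSum.toModule_lof]; rfl

lemma opDiag_inc (c : ℕ → ℂ) (k : ℕ) (v : V (pos m k)) :
    opDiag m V c (inc m V k v) = c k • inc m V k v := by
  rw [opDiag, DirectSum.toModule_lof]; rfl

lemma hom_ext {W : Type} [AddCommGroup W] [Module ℂ W] {f g : Space m V →ₗ[ℂ] W}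
    (h : ∀ k v, f (inc m V k v) = g (inc m V k v)) : f = g :=
  DirectSum.linearMap_ext ℂ fun k => LinearMap.ext (h k)

/-- The operators of the `U_q(𝔰𝔩₂)`-module of a quiver representation. -/
def ops : Sl2Ops q (Space m V) where
  e := d.opE q s z
  f := d.opF
  k := opDiag m V (wt s m)
  ki := opDiag m V (fun k => (wt s m k)⁻¹)
  k_ki n := by
    refine LinearMap.congr_fun (f := opDiag m V (wt s m) ∘ₗ opDiag m V (fun k => (wt s m k)⁻¹))
      (g := LinearMap.id) (hom_ext fun k v => ?_) n
    rw [LinearMap.comp_apply, opDiag_inc, map_smul, opDiag_inc, smul_smul,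
      inv_mul_cancel₀ (wt_ne hp m k), one_smul, LinearMap.id_apply]
  ki_k n := by
    refine LinearMap.congr_fun (f := opDiag m V (fun k => (wt s m k)⁻¹) ∘ₗ opDiag m V (wt s m))
      (g := LinearMap.id) (hom_ext fun k v => ?_) n
    rw [LinearMap.comp_apply, opDiag_inc, map_smul, opDiag_inc, smul_smul,
      mul_inv_cancel₀ (wt_ne hp m k), one_smul, LinearMap.id_apply]
  k_e n := by
    refine LinearMap.congr_fun (f := opDiag m V (wt s m) ∘ₗ d.opE q s z)
      (g := q ^ 2 • d.opE q s z ∘ₗ opDiag m V (wt s m)) (hom_ext fun k v => ?_) n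
    rw [LinearMap.comp_apply, LinearMap.smul_apply, LinearMap.comp_apply, opDiag_inc, map_smul]
    rcases k with _ | k
    · rw [opE_zero, map_zero, smul_zero, smul_zero]
    · rw [opE_succ, opDiag_inc, smul_smul, wt_succ hp]
  k_f n := by
    refine LinearMap.congr_fun (f := opDiag m V (wt s m) ∘ₗ d.opF)
      (g := (q ^ 2)⁻¹ • d.opF ∘ₗ opDiag m V (wt s m)) (hom_ext fun k v => ?_) n
    rw [LinearMap.comp_apply, LinearMap.smul_apply, LinearMap.comp_apply, opDiag_inc, map_smul,
      opF_inc, opDiag_inc, smul_smul, wt_succ' hp]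
  e_f n := by
    refine LinearMap.congr_fun (f := d.opE q s z ∘ₗ d.opF)
      (g := d.opF ∘ₗ d.opE q s z + (q ^ 2 - 1)⁻¹ • (q • opDiag m V (wt s m) -
        opDiag m V (fun k => (wt s m k)⁻¹))) (hom_ext fun k v => ?_) n
    simp only [LinearMap.comp_apply, LinearMap.smul_apply, LinearMap.add_apply,
      LinearMap.sub_apply, opDiag_inc, opF_inc, opE_succ, smul_smul, ← sub_smul]
    have hc : (q ^ 2 - 1)⁻¹ * (q * wt s m k - (wt s m k)⁻¹) =
        cc q s z m (k + 1) - cc q s z m k := by rw [cc_succ hp]; ring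
    rw [hc]
    have hpos : ∀ k, pos m (k + 1) = .two → pos m k = .two := fun k h => by
      rcases lt_or_ge k m with h2 | h2
      · exact pos_of_lt h2
      · rw [pos_of_le (by omega)] at h; cases h
    have hcc : ∀ k, pos m k = .two → pos m (k + 1) = .one → cc q s z m (k + 1) = 0 := by
      intro k h1 h2
      have : k + 1 = m := by
        by_contra hne
        rcases lt_or_ge k m with h3 | h3
        · rw [pos_of_lt (by omega)] at h2; cases h2
        · rw [pos_of_le h3] at h1; cases h1
      rw [this, cc_self hp]
    rcases k with _ | k
    · rw [opE_zero, map_zero, zero_add, zero_add, ← map_smul]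
      congr 1
      -- At the highest weight `e` vanishes, so `ef` must be the scalar `cc q s z m 1` with no
      -- nilpotent part. For `m = 0` this weight already belongs to vertex `one`, and the condition
      -- `a = 0` removes the term `ba`.
      by_cases hm : m = 0
      · have h1 : ∀ (i j : Vertex) (c : ℂ) (v : V i), i = .one → j = .one →
            d.back c j i (d.step i j v) = c • v := by
          rintro i j c v rfl rfl
          simp [back, step, d.a_zero hm]
        rw [h1 _ _ _ _ (pos_of_le (by omega)) (pos_of_le (by omega)), cc_zero hp, sub_zero]
      -- No weight space lies above `k = 0`. A fictitious copy of vertex `two` takes its place, with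
      -- eigenvalue `0` so that `e` into it vanishes.
      · have h1 := d.back_step .two (pos m 0) (pos m 1) 0 (cc q s z m 1) (fun _ => rfl) (hpos 0)
          (hcc 0) (fun _ _ => rfl) v
        have h2 : ∀ (i : Vertex) (v : V i), i = .two → d.step .two i (d.back 0 i .two v) = 0 := by
          rintro i v rfl
          simp [step, back]
        rw [h1, h2 _ _ (pos_of_lt (by omega)), zero_add, cc_zero hp]
    · rw [opE_succ, opF_inc, ← map_smul, ← map_add]
      congr 1
      exact d.back_step _ _ _ _ _ (hpos k) (hpos (k + 1)) (hcc (k + 1)) (hcc k) v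

@[simp] lemma ops_e : (d.ops hp).e = d.opE q s z := rfl
@[simp] lemma ops_f : (d.ops hp).f = d.opF := rfl
@[simp] lemma ops_k : (d.ops hp).k = opDiag m V (wt s m) := rfl
@[simp] lemma ops_ki : (d.ops hp).ki = opDiag m V (fun k => (wt s m k)⁻¹) := rfl

end QData

/-! ### Powers of `f` on weight vectors, and maps out of the module of a quiver representation -/

namespace Sl2Ops

variable {q s z : ℂ} {N : Type} [AddCommGroup N] [Module ℂ N] (hp : Par q s z) (o : Sl2Ops q N)
include hp

lemma ki_of_k {n : N} {ν : ℂ} (hν : ν ≠ 0) (h : o.k n = ν • n) : o.ki n = ν⁻¹ • n := by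
  have h2 := o.ki_k n
  rw [h, map_smul] at h2
  rw [eq_inv_smul_iff₀ hν, h2]

lemma k_f_pow {m r : ℕ} {n : N} (h : o.k n = wt s m r • n) (t : ℕ) :
    o.k ((o.f ^ t) n) = wt s m (r + t) • (o.f ^ t) n := by
  induction t with
  | zero => simpa using h
  | succ t ih =>
    rw [pow_succ', Module.End.mul_apply, o.k_f, ih, map_smul, smul_smul, wt_succ' hp]
    rfl

/-- The commutators of `e` with the factors of `f^(t+1)` telescope. From weight `0` to weight `m`
the total is `cc m - cc 0 = 0`, which is the source of `ab = 0` and of the singular vector in the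
dominant Verma module. -/
lemma e_f_pow {m r : ℕ} {n : N} (h : o.k n = wt s m r • n) (t : ℕ) :
    o.e ((o.f ^ (t + 1)) n) = (o.f ^ (t + 1)) (o.e n) +
      (cc q s z m (r + t + 1) - cc q s z m r) • (o.f ^ t) n := by
  induction t with
  | zero =>
    rw [zero_add, pow_one, pow_zero, Module.End.one_apply, o.e_f, h, o.ki_of_k hp (wt_ne hp m r) h,
      smul_smul, ← sub_smul, smul_smul, add_zero, cc_succ hp, add_sub_cancel_left]
  | succ t ih =>
    have hk := o.k_f_pow hp h (t + 1)
    rw [pow_succ' o.f (t + 1), Module.End.mul_apply, o.e_f, ih, hk,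
      o.ki_of_k hp (wt_ne hp m _) hk, smul_smul, ← sub_smul, smul_smul, map_add, map_smul,
      ← Module.End.mul_apply, ← pow_succ', ← Module.End.mul_apply o.f, ← pow_succ', add_assoc,
      ← add_smul, show r + (t + 1) + 1 = (r + t + 1) + 1 by omega, cc_succ hp m (r + t + 1)]
    congr 2
    rw [show r + (t + 1) = r + t + 1 by omega]
    ring

end Sl2Ops

/-- A linear map commuting with the `U_q(𝔰𝔩₂)`-operators. -/
structure Sl2Hom {q : ℂ} {N N' : Type} [AddCommGroup N] [Module ℂ N] [AddCommGroup N']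
    [Module ℂ N'] (o : Sl2Ops q N) (o' : Sl2Ops q N') (φ : N →ₗ[ℂ] N') : Prop where
  e : ∀ n, φ (o.e n) = o'.e (φ n)
  f : ∀ n, φ (o.f n) = o'.f (φ n)
  k : ∀ n, φ (o.k n) = o'.k (φ n)

namespace QData

variable {q s z : ℂ} {m : ℕ} {V : Vertex → Type} [∀ i, AddCommGroup (V i)]
  [∀ i, Module ℂ (V i)] (d : QData m V) {N : Type} [AddCommGroup N] [Module ℂ N]
  (o : Sl2Ops q N)

/-- The power of `F` leading to the weight space of `λ q^(-2k)`. -/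
def expo (m k : ℕ) : ℕ := if k < m then k else k - m

/-- The conditions on a pair of maps `V i → N` to extend to a homomorphism. -/
structure Gens (s : ℂ) (g : ∀ i, V i →ₗ[ℂ] N) : Prop where
  k_two : ∀ v, o.k (g .two v) = wt s m 0 • g .two v
  k_one : ∀ v, o.k (g .one v) = wt s m m • g .one v
  e_two : ∀ v, o.e (g .two v) = 0
  e_one : ∀ v, o.e (g .one v) = (o.f ^ (m - 1)) (g .two (d.a v))
  f_two : 0 < m → ∀ v, (o.f ^ m) (g .two v) = g .one (d.b v)

/-- The linear map extending a pair of maps `V i → N`. -/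
def extend (m : ℕ) {V : Vertex → Type} [∀ i, AddCommGroup (V i)] [∀ i, Module ℂ (V i)]
    (o : Sl2Ops q N) (g : ∀ i, V i →ₗ[ℂ] N) : Space m V →ₗ[ℂ] N :=
  DirectSum.toModule ℂ ℕ _ fun k => (o.f ^ expo m k) ∘ₗ g (pos m k)

lemma extend_inc (g : ∀ i, V i →ₗ[ℂ] N) (k : ℕ) (v : V (pos m k)) :
    extend m o g (inc m V k v) = (o.f ^ expo m k) (g _ v) := by
  rw [extend, DirectSum.toModule_lof]; rfl

variable {d o}

lemma Gens.sl2Hom (hp : Par q s z) {g : ∀ i, V i →ₗ[ℂ] N} (hg : d.Gens o s g) :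
    Sl2Hom (d.ops hp) o (extend m o g) where
  e n := by
    refine LinearMap.congr_fun (f := extend m o g ∘ₗ d.opE q s z)
      (g := o.e ∘ₗ extend m o g) (hom_ext fun k v => ?_) n
    rw [LinearMap.comp_apply, LinearMap.comp_apply, extend_inc]
    rcases k with _ | k
    · rw [opE_zero, map_zero]
      have h : ∀ (i : Vertex) (v : V i), i = pos m 0 → o.e (g i v) = 0 := by
        rintro i v hi
        cases i
        · have hm : m = 0 := by
            by_contra h
            rw [pos_of_lt (by omega)] at hi; cases hi
          rw [hg.e_one, d.a_zero hm]; simp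
        · exact hg.e_two v
      rw [show expo m 0 = 0 by simp [expo], pow_zero, Module.End.one_apply, h _ _ rfl]
    · rw [opE_succ, extend_inc]
      have h : ∀ (i j : Vertex) (v : V i), i = pos m (k + 1) → j = pos m k →
          (o.f ^ expo m k) (g j (d.back (cc q s z m (k + 1)) i j v)) =
            o.e ((o.f ^ expo m (k + 1)) (g i v)) := by
        intro i j v hi hj
        -- Before the jump `e` is the scalar given by `e_f_pow`; at `k + 1 = m` it is `a` followed
        -- by `f^(m-1)`; beyond, `f^(k-m+1) f^(m-1) = f^(k-m) f^m` turns the contribution of `a`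
        -- into `ba`.
        rcases lt_trichotomy (k + 1) m with h1 | h1 | h1
        · rw [pos_of_lt h1] at hi
          rw [pos_of_lt (by omega)] at hj
          subst hi hj
          rw [expo, expo, if_pos h1, if_pos (by omega), o.e_f_pow hp (hg.k_two v), hg.e_two,
            map_zero, zero_add, cc_zero hp, sub_zero, zero_add]
          simp [back]
        · rw [pos_of_le h1.ge] at hi
          rw [pos_of_lt (by omega)] at hj
          subst hi hj
          rw [expo, expo, if_pos (by omega), if_neg (by omega), show k + 1 - m = 0 by omega, pow_zero,
            Module.End.one_apply, hg.e_one, show k = m - 1 by omega]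
          rfl
        · rw [pos_of_le (by omega)] at hi hj
          subst hi hj
          rw [expo, expo, if_neg (by omega), if_neg (by omega),
            show k + 1 - m = k - m + 1 by omega, o.e_f_pow hp (hg.k_one v), hg.e_one,
            cc_self hp, sub_zero, show m + (k - m) + 1 = k + 1 by omega]
          by_cases hm : m = 0
          · simp [back, d.a_zero hm]
          · rw [← Module.End.mul_apply, ← pow_add,
              show k - m + 1 + (m - 1) = k - m + m by omega, pow_add, Module.End.mul_apply,
              hg.f_two (by omega)]
            simp [back, add_comm]
      exact h _ _ v rfl rfl
  f n := by
    refine LinearMap.congr_fun (f := extend m o g ∘ₗ d.opF)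
      (g := o.f ∘ₗ extend m o g) (hom_ext fun k v => ?_) n
    rw [LinearMap.comp_apply, LinearMap.comp_apply, opF_inc, extend_inc, extend_inc]
    have h : ∀ (i j : Vertex) (v : V i), i = pos m k → j = pos m (k + 1) →
          (o.f ^ expo m (k + 1)) (g j (d.step i j v)) = o.f ((o.f ^ expo m k) (g i v)) := by
      intro i j v hi hj
      rw [← Module.End.mul_apply, ← pow_succ']
      rcases lt_trichotomy (k + 1) m with h1 | h1 | h1
      · rw [pos_of_lt h1] at hj
        rw [pos_of_lt (by omega)] at hi
        subst hi hj
        rw [expo, expo, if_pos h1, if_pos (by omega)]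
        rfl
      · rw [pos_of_le h1.ge] at hj
        rw [pos_of_lt (by omega)] at hi
        subst hi hj
        rw [expo, expo, if_neg (by omega), if_pos (by omega), show k + 1 - m = 0 by omega, pow_zero,
          Module.End.one_apply, show k + 1 = m from h1, hg.f_two (by omega)]
        rfl
      · rw [pos_of_le (by omega)] at hi hj
        subst hi hj
        rw [expo, expo, if_neg (by omega), if_neg (by omega), show k + 1 - m = k - m + 1 by omega]
        rfl
    exact h _ _ v rfl rfl
  k n := by
    refine LinearMap.congr_fun (f := extend m o g ∘ₗ opDiag m V (wt s m))
      (g := o.k ∘ₗ extend m o g) (hom_ext fun k v => ?_) n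
    rw [LinearMap.comp_apply, LinearMap.comp_apply, opDiag_inc, map_smul, extend_inc]
    have h : ∀ (i : Vertex) (v : V i), i = pos m k →
        o.k ((o.f ^ expo m k) (g i v)) = wt s m k • (o.f ^ expo m k) (g i v) := by
      intro i v hi
      rcases lt_or_ge k m with h1 | h1
      · rw [pos_of_lt h1] at hi
        subst hi
        rw [expo, if_pos h1, o.k_f_pow hp (hg.k_two v), zero_add]
      · rw [pos_of_le h1] at hi
        subst hi
        rw [expo, if_neg (by omega), o.k_f_pow hp (hg.k_one v), show m + (k - m) = k by omega]
    rw [h _ _ rfl]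

end QData

/-! ### Functoriality of induction -/

namespace Induced

variable {q s z : ℂ} {hp : Par q s z} {N N' : Type} [AddCommGroup N] [Module ℂ N]
  [AddCommGroup N'] [Module ℂ N'] {o : Sl2Ops q N} {o' : Sl2Ops q N'}
  {M : Type} [AddCommGroup M] [Module ℂ M] [Module (UqS q) M] [IsScalarTower ℂ (UqS q) M]

lemma _root_.QSchr.Sl2Hom.ki {ψ : N →ₗ[ℂ] N'} (hψ : Sl2Hom o o' ψ) (n : N) :
    ψ (o.ki n) = o'.ki (ψ n) := by
  rw [← o'.ki_k (ψ (o.ki n)), ← hψ.k, o.k_ki]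

lemma Compat.comp {φ : N' →ₗ[ℂ] M} (hφ : Compat (z := z) o' φ) {ψ : N →ₗ[ℂ] N'}
    (hψ : Sl2Hom o o' ψ) : Compat (z := z) o (φ ∘ₗ ψ) where
  X n := hφ.X _
  E n := by rw [LinearMap.comp_apply, hφ.E, LinearMap.comp_apply, hψ.e]
  K n := by rw [LinearMap.comp_apply, hφ.K, LinearMap.comp_apply, hψ.k]
  F n := by
    rw [LinearMap.comp_apply, hφ.F, LinearMap.comp_apply, hψ.f, LinearMap.comp_apply, hψ.ki]
  Z := hφ.Z

variable (hp o) in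
lemma compat_y : Compat (z := z) o (y hp o 0) where
  X n := by rw [X_y, Sl2Ops.cX_zero, zero_smul]
  E n := by rw [E_y, Sl2Ops.cE_zero, zero_smul, zero_add, pow_zero, inv_one, one_smul]
  K n := by rw [K_y, pow_zero, inv_one, one_smul]
  F n := by rw [F_y, Y_y, Y_y]
  Z := Z_smul hp o

variable (hp) in
/-- The map induced by a homomorphism. -/
def map {ψ : N →ₗ[ℂ] N'} (hψ : Sl2Hom o o' ψ) : Induced hp o →ₗ[UqS q] Induced hp o' :=
  lift hp ((compat_y hp o').comp hψ)

lemma Y_pow_y (i j : ℕ) (n : N) : gen q .Y ^ i • y hp o j n = y hp o (j + i) n := by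
  induction i with
  | zero => simp
  | succ i ih => rw [pow_succ', mul_smul, ih, Y_y]; rfl

lemma map_y {ψ : N →ₗ[ℂ] N'} (hψ : Sl2Hom o o' ψ) (j : ℕ) (n : N) :
    map hp hψ (y hp o j n) = y hp o' j (ψ n) := by
  rw [map, lift_y, LinearMap.comp_apply, Y_pow_y, zero_add]

lemma map_injective {ψ : N →ₗ[ℂ] N'} (hψ : Sl2Hom o o' ψ) (h : Function.Injective ψ) :
    Function.Injective (map hp hψ) := by
  refine injective_of_y_zero hp _ _ fun n hn => h ?_
  rw [map_y] at hn
  rw [map_zero, y_injective hp o' 0 (hn.trans (map_zero _).symm)]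

lemma map_surjective {ψ : N →ₗ[ℂ] N'} (hψ : Sl2Hom o o' ψ) (h : Function.Surjective ψ) :
    Function.Surjective (map hp hψ) := by
  intro v
  refine induction (P := fun v => ∃ w, map hp hψ w = v) ⟨0, map_zero _⟩ ?_ (fun j n => ?_) v
  · rintro _ _ ⟨a, rfl⟩ ⟨b, rfl⟩
    exact ⟨a + b, map_add _ _ _⟩
  · obtain ⟨n, rfl⟩ := h n
    exact ⟨y hp o j n, map_y hψ j n⟩

lemma Ctilde_y_zero {n : N} {ν : ℂ} (h : o.k n = ν • n) (hν : ν ≠ 0) :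
    Ctilde q • y hp o 0 n = ctilde q ν z • y hp o 0 n +
      (z * (q + 1)) • y hp o 0 (o.f (o.e n)) := by
  have hc := compat_y hp o
  have hz : ∀ v : Induced hp o, gen q .Z • v = z • v := Z_smul hp o
  let w : kerX q (Induced hp o) := ⟨y hp o 0 n, hc.X n⟩
  have h1 := Ctilde_smul_kerX hp hz (ν := ν) w (Subtype.ext (by
    change gen q .K • y hp o 0 n = ν • y hp o 0 n
    rw [hc.K, h, map_smul])) hν
  rw [coe_kerOps_f, coe_kerOps_e] at h1
  change Ctilde q • y hp o 0 n = ctilde q ν z • y hp o 0 n + _ • (gen q .F • gen q .E •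
    y hp o 0 n - _ • gen q .Y • gen q .Y • gen q .Ki • gen q .E • y hp o 0 n) at h1
  rw [h1, hc.E, hc.F, hc.Ki, add_sub_cancel_right]

end Induced

/-! ### The module of a quiver representation lies in the block -/

/-- The subspace spanned over `U_q(𝔰)` by the image of a finite-dimensional space is finitely
generated. -/
lemma fg_span_range {q : ℂ} {M W : Type} [AddCommGroup M] [Module ℂ M] [Module (UqS q) M]
    [IsScalarTower ℂ (UqS q) M] [AddCommGroup W] [Module ℂ W] [FiniteDimensional ℂ W]
    (f : W →ₗ[ℂ] M) : (Submodule.span (UqS q) (Set.range f)).FG := by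
  classical
  obtain ⟨b, hb⟩ := (Module.finite_def (R := ℂ) (M := W)).mp inferInstance
  refine ⟨b.image f, le_antisymm (Submodule.span_mono (by simp)) (Submodule.span_le.mpr ?_)⟩
  rintro _ ⟨w, rfl⟩
  have hw : w ∈ Submodule.span ℂ (b : Set W) := hb ▸ Submodule.mem_top
  induction hw using Submodule.span_induction with
  | mem x hx => exact Submodule.subset_span (by simpa using ⟨x, hx, rfl⟩)
  | zero => rw [map_zero]; exact Submodule.zero_mem _
  | add x y _ _ h1 h2 => rw [map_add]; exact Submodule.add_mem _ h1 h2
  | smul c x _ h =>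
    rw [map_smul, ← algebraMap_smul (UqS q)]
    exact Submodule.smul_mem _ _ h

namespace QData

variable {q s z : ℂ} (hp : Par q s z) {m : ℕ} {V V' : Vertex → Type} [∀ i, AddCommGroup (V i)]
  [∀ i, Module ℂ (V i)] (d : QData m V) [∀ i, AddCommGroup (V' i)]
  [∀ i, Module ℂ (V' i)] (d' : QData m V')

/-- The `U_q(𝔰)`-module of a quiver representation. -/
abbrev Mod : Type := Induced hp (d.ops hp)

/-- The vector `y^j ⊗ v` for `v` in the weight space of `λ q^(-2k)`. -/
def vec (j k : ℕ) : V (pos m k) →ₗ[ℂ] d.Mod hp := Induced.y hp _ j ∘ₗ inc m V k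

lemma vec_apply (j k : ℕ) (v : V (pos m k)) : d.vec hp j k v = Induced.y hp _ j (inc m V k v) :=
  rfl

variable {hp d} in
lemma Mod.induction {P : d.Mod hp → Prop} (h0 : P 0) (ha : ∀ u v, P u → P v → P (u + v))
    (hv : ∀ j k v, P (d.vec hp j k v)) (v : d.Mod hp) : P v := by
  refine Induced.induction h0 ha (fun j n => ?_) v
  induction n using DirectSum.induction_on with
  | zero => rw [map_zero]; exact h0
  | of k v => exact hv j k v
  | add x y h1 h2 => rw [map_add]; exact ha _ _ h1 h2

lemma Y_pow_vec (j k : ℕ) (v : V (pos m k)) :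
    gen q .Y ^ j • d.vec hp 0 k v = d.vec hp j k v := by
  rw [vec_apply, Induced.Y_pow_y, zero_add, vec_apply]

lemma vec_mem_weightSpace (j k : ℕ) (v : V (pos m k)) :
    d.vec hp j k v ∈ weightSpace q (d.Mod hp) (s ^ (2 * m - 3 - 4 * k - 2 * j : ℤ)) := by
  rw [mem_weightSpace, vec_apply, Induced.K_y, ops_k, opDiag_inc, map_smul, smul_smul,
    hp.q_pow_eq, wt, ← zpow_neg, ← zpow_add₀ hp.s0]
  congr 2
  ring

include hp in
lemma mem_coset (k : ℕ) (j : ℕ) : s ^ (2 * m - 3 - 4 * k - 2 * j : ℤ) ∈ coset q s := by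
  refine ⟨m - 2 - 2 * k - j, ?_⟩
  rw [← hp.sq, ← zpow_natCast, ← zpow_mul, ← zpow_one_add₀ hp.s0]
  congr 1
  push_cast
  ring

lemma iSup_weightSpace : ⨆ ν ∈ coset q s, weightSpace q (d.Mod hp) ν = ⊤ := by
  rw [eq_top_iff]
  rintro v -
  refine Mod.induction (P := fun v => v ∈ ⨆ ν ∈ coset q s, weightSpace q (d.Mod hp) ν)
    (Submodule.zero_mem _) (fun _ _ => Submodule.add_mem _) (fun j k v => ?_) v
  exact Submodule.mem_iSup_of_mem _ (Submodule.mem_iSup_of_mem (mem_coset hp k j)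
    (d.vec_mem_weightSpace hp j k v))

/-- The nilpotent part of the Casimir element. -/
def nilp : (i : Vertex) → V i →ₗ[ℂ] V i
  | .two => 0
  | .one => d.b ∘ₗ d.a

lemma nilp_nilp (i : Vertex) (v : V i) : d.nilp i (d.nilp i v) = 0 := by
  cases i <;> simp [nilp, d.ab]

-- Each occurrence of the jump eigenvalue is zero, so at `k = m` only `ba` survives; for `k < m`
-- there is no nilpotent part, and for `k > m` both terms appear.
include hp in
lemma opF_opE (k : ℕ) (v : V (pos m k)) : d.opF (d.opE q s z (inc m V k v)) =
    cc q s z m k • inc m V k v + inc m V k (d.nilp _ v) := by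
  rcases k with _ | k
  · rw [opE_zero, map_zero, cc_zero hp, zero_smul, zero_add]
    have h : ∀ (i : Vertex) (v : V i), i = pos m 0 → d.nilp i v = 0 := by
      rintro i v hi
      cases i
      · have hm : m = 0 := by
          by_contra h
          rw [pos_of_lt (by omega)] at hi; cases hi
        simp [nilp, d.a_zero hm]
      · rfl
    rw [h _ _ rfl, map_zero]
  · rw [opE_succ, opF_inc, ← map_smul, ← map_add]
    congr 1
    have h : ∀ (i j : Vertex) (v : V i), i = pos m (k + 1) → j = pos m k →
        d.step j i (d.back (cc q s z m (k + 1)) i j v) =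
          cc q s z m (k + 1) • v + d.nilp i v := by
      intro i j v hi hj
      rcases lt_trichotomy (k + 1) m with h1 | h1 | h1
      · rw [pos_of_lt h1] at hi
        rw [pos_of_lt (by omega)] at hj
        subst hi hj
        simp [step, back, nilp]
      · have hc : cc q s z m (k + 1) = 0 := by rw [h1, cc_self hp]
        rw [pos_of_le h1.ge] at hi
        rw [pos_of_lt (by omega)] at hj
        subst hi hj
        simp [step, back, nilp, hc]
      · rw [pos_of_le (by omega)] at hi hj
        subst hi hj
        simp [step, back, nilp]
    exact h _ _ v rfl rfl

lemma Ctilde_sub_vec (k : ℕ) (v : V (pos m k)) :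
    (Ctilde q - algebraMap ℂ (UqS q) (ctilde q (wt s m 0) z)) • d.vec hp 0 k v =
      (z * (q + 1)) • d.vec hp 0 k (d.nilp _ v) := by
  have hqp := hp.qp1
  have hz := hp.z0
  rw [sub_smul, algebraMap_smul, vec_apply, Induced.Ctilde_y_zero (ν := wt s m k) (by
    rw [ops_k, opDiag_inc]) (wt_ne hp m k), ops_f, ops_e, d.opF_opE hp, map_add, map_smul, cc,
    vec_apply, smul_add, smul_smul, mul_div_cancel₀ _ (mul_ne_zero hz hqp)]
  module

/-- `C̃` commutes with `Y`, so it suffices to look at `1 ⊗ N`. There `C̃ - c̃_λ` is a multiple of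
`0` or of `ba`, and `baba = 0`. -/
lemma Ctilde_sub_sq (v : d.Mod hp) :
    (Ctilde q - algebraMap ℂ (UqS q) (ctilde q (wt s m 0) z)) ^ 2 • v = 0 := by
  set u := Ctilde q - algebraMap ℂ (UqS q) (ctilde q (wt s m 0) z) with hu
  have hY : ∀ w : d.Mod hp, u • gen q .Y • w = gen q .Y • u • w := fun w => by
    rw [hu, sub_smul, sub_smul, Ctilde_Y_smul hp, algebraMap_smul, algebraMap_smul, smul_sub,
      gen_smul_comm]
  have hYj : ∀ (j : ℕ) (w : d.Mod hp), u • gen q .Y ^ j • w = gen q .Y ^ j • u • w := by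
    intro j
    induction j with
    | zero => simp
    | succ j ih => intro w; rw [pow_succ, mul_smul, ih, hY, mul_smul]
  refine Mod.induction (P := fun v : d.Mod hp => u ^ 2 • v = 0) (by rw [smul_zero])
    (fun a b ha hb => by rw [smul_add, ha, hb, zero_add]) (fun j k v => ?_) v
  rw [← Y_pow_vec, pow_two, mul_smul, hYj, hYj, d.Ctilde_sub_vec hp, gen_smul_comm,
    d.Ctilde_sub_vec hp, nilp_nilp, map_zero, smul_zero, smul_zero, smul_zero]

/-- `f` maps each weight space onto the next except into `k = m`, and `f` is expressed through `F`,
`Y` and `K⁻¹`. So the weight spaces at `0` and `m` generate. -/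
lemma span_top : Submodule.span (UqS q) (Set.range (d.vec hp 0 0)) ⊔
    Submodule.span (UqS q) (Set.range (d.vec hp 0 m)) = ⊤ := by
  set S := Submodule.span (UqS q) (Set.range (d.vec hp 0 0)) ⊔
    Submodule.span (UqS q) (Set.range (d.vec hp 0 m))
  have key : ∀ k v, d.vec hp 0 k v ∈ S := by
    intro k
    induction k with
    | zero => exact fun v => Submodule.mem_sup_left (Submodule.subset_span ⟨v, rfl⟩)
    | succ k ih =>
      intro v
      by_cases hk : k + 1 = m
      · have : ∀ r (w : V (pos m r)), r = m → d.vec hp 0 r w ∈ S := by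
          rintro r w rfl
          exact Submodule.mem_sup_right (Submodule.subset_span ⟨w, rfl⟩)
        exact this _ v hk
      · have hs : ∀ (i j : Vertex) (v : V j), i = j → ∃ w, d.step i j w = v := by
          rintro i j v rfl
          cases i <;> exact ⟨v, rfl⟩
        obtain ⟨w, rfl⟩ := hs (pos m k) (pos m (k + 1)) v (by
          rcases lt_or_gt_of_ne hk with h | h
          · rw [pos_of_lt h, pos_of_lt (by omega)]
          · rw [pos_of_le (by omega), pos_of_le (by omega)])
        have hF := Induced.F_y hp (d.ops hp) 0 (inc m V k w)
        rw [ops_f, opF_inc, ← vec_apply, ← vec_apply, ← sub_eq_iff_eq_add] at hF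
        rw [← hF, ops_ki, opDiag_inc, map_smul, ← vec_apply, smul_smul, zero_add, ← d.Y_pow_vec hp 2,
          ← algebraMap_smul (UqS q)]
        exact S.sub_mem (S.smul_mem _ (ih w)) (S.smul_mem _ (S.smul_mem _ (ih w)))
  rw [eq_top_iff]
  rintro v -
  refine Mod.induction (P := fun v => v ∈ S) S.zero_mem (fun _ _ => S.add_mem)
    (fun j k v => ?_) v
  rw [← Y_pow_vec]
  exact S.smul_mem _ (key k v)

/-- The module of a finite-dimensional quiver representation lies in the block. -/
lemma inBlock [∀ i, FiniteDimensional ℂ (V i)] :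
    InBlock q (d.Mod hp) (coset q s) (ctilde q (wt s m 0) z) z where
  inO := by
    refine ⟨⟨?_⟩, ?_, ?_⟩
    · rw [← d.span_top hp]
      exact (fg_span_range _).sup (fg_span_range _)
    · exact eq_top_iff.mpr ((d.iSup_weightSpace hp).ge.trans
        (iSup_mono fun ν => iSup_le fun _ => le_rfl))
    · intro v
      -- `E` and `X` raise neither the degree in `Y` nor the index of the weight space, so these
      -- finite-dimensional boxes are stable under `U_q(𝔫⁺)` and exhaust the module.
      let W : ℕ → Submodule ℂ (d.Mod hp) := fun r =>
        ⨆ j : Fin r, ⨆ k : Fin r, LinearMap.range (d.vec hp j k)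
      have hmem : ∀ r j k v, j < r → k < r → d.vec hp j k v ∈ W r := fun r j k v hj hk =>
        Submodule.mem_iSup_of_mem ⟨j, hj⟩ (Submodule.mem_iSup_of_mem ⟨k, hk⟩ ⟨v, rfl⟩)
      have hmono : Monotone W := fun r r' h => iSup_le fun j => iSup_le fun k => by
        rintro _ ⟨v, rfl⟩
        exact hmem _ _ _ _ (by omega) (by omega)
      have hind : ∀ r (P : d.Mod hp → Prop), P 0 → (∀ u v, P u → P v → P (u + v)) →
          (∀ j k v, j < r → k < r → P (d.vec hp j k v)) → ∀ v ∈ W r, P v := by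
        intro r P h0 ha hP v hv
        refine Submodule.iSup_induction _ (motive := P) hv (fun j v hv => ?_) h0 ha
        refine Submodule.iSup_induction _ (motive := P) hv (fun k v hv => ?_) h0 ha
        obtain ⟨v, rfl⟩ := hv
        exact hP _ _ _ j.2 k.2
      obtain ⟨r, hr⟩ : ∃ r, v ∈ W r := by
        refine Mod.induction (P := fun v => ∃ r, v ∈ W r) ⟨0, Submodule.zero_mem _⟩ ?_ ?_ v
        · rintro u v ⟨i, hi⟩ ⟨j, hj⟩
          exact ⟨max i j, Submodule.add_mem _ (hmono (le_max_left _ _) hi)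
            (hmono (le_max_right _ _) hj)⟩
        · exact fun j k v => ⟨max j k + 1, hmem _ _ _ _ (by omega) (by omega)⟩
      have hfin : FiniteDimensional ℂ (W r) := inferInstance
      refine Submodule.finiteDimensional_of_le (nPlusSpan_le (q := q) hr ?_ ?_)
      · refine hind r _ (by rw [smul_zero]; exact Submodule.zero_mem _)
          (fun u v hu hv => by rw [smul_add]; exact Submodule.add_mem _ hu hv)
          (fun j k v hj hk => ?_)
        rw [vec_apply, Induced.E_y, ops_e, ← vec_apply]
        refine Submodule.add_mem _ (Submodule.smul_mem _ _ (hmem _ _ _ _ (by omega) hk))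
          (Submodule.smul_mem _ _ ?_)
        rcases k with _ | k
        · rw [opE_zero, map_zero]; exact Submodule.zero_mem _
        · rw [opE_succ, ← vec_apply]
          exact hmem _ _ _ _ hj (by omega)
      · refine hind r _ (by rw [smul_zero]; exact Submodule.zero_mem _)
          (fun u v hu hv => by rw [smul_add]; exact Submodule.add_mem _ hu hv)
          (fun j k v hj hk => ?_)
        rw [vec_apply, Induced.X_y, ← vec_apply]
        exact Submodule.smul_mem _ _ (hmem _ _ _ _ (by omega) hk)
  supp_subset := supp_subset_of_span (d.iSup_weightSpace hp)
  centralCharge := Induced.Z_smul hp _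
  ctilde_nilpotent := ⟨2, d.Ctilde_sub_sq hp⟩

/-! ### Morphisms -/

/-- Morphisms of quiver representations. -/
structure Hom (φ : ∀ i, V i →ₗ[ℂ] V' i) : Prop where
  a : ∀ v, φ .two (d.a v) = d'.a (φ .one v)
  b : ∀ v, φ .one (d.b v) = d'.b (φ .two v)

/-- The direct sum of the linear maps of a morphism. -/
def spaceMap (m : ℕ) (φ : ∀ i, V i →ₗ[ℂ] V' i) : Space m V →ₗ[ℂ] Space m V' :=
  DirectSum.toModule ℂ ℕ _ fun k => inc m V' k ∘ₗ φ (pos m k)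

lemma spaceMap_inc (φ : ∀ i, V i →ₗ[ℂ] V' i) (k : ℕ) (v : V (pos m k)) :
    spaceMap m φ (inc m V k v) = inc m V' k (φ _ v) := by
  rw [spaceMap, DirectSum.toModule_lof]; rfl

variable {d d'} in
lemma Hom.spaceMap {φ : ∀ i, V i →ₗ[ℂ] V' i} (hφ : Hom d d' φ) :
    Sl2Hom (d.ops hp) (d'.ops hp) (spaceMap m φ) where
  e n := by
    refine LinearMap.congr_fun (f := QData.spaceMap m φ ∘ₗ d.opE q s z)
      (g := d'.opE q s z ∘ₗ QData.spaceMap m φ) (hom_ext fun k v => ?_) n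
    rw [LinearMap.comp_apply, LinearMap.comp_apply, spaceMap_inc]
    rcases k with _ | k
    · rw [opE_zero, opE_zero, map_zero]
    · rw [opE_succ, opE_succ, spaceMap_inc]
      congr 1
      have h : ∀ (c : ℂ) (i j : Vertex) (v : V i),
          φ j (d.back c i j v) = d'.back c i j (φ i v) := by
        intro c i j v
        cases i <;> cases j <;> simp [back, hφ.a, hφ.b]
      exact h _ _ _ v
  f n := by
    refine LinearMap.congr_fun (f := QData.spaceMap m φ ∘ₗ d.opF)
      (g := d'.opF ∘ₗ QData.spaceMap m φ) (hom_ext fun k v => ?_) n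
    rw [LinearMap.comp_apply, LinearMap.comp_apply, spaceMap_inc, opF_inc, opF_inc, spaceMap_inc]
    congr 1
    have h : ∀ (i j : Vertex) (v : V i), φ j (d.step i j v) = d'.step i j (φ i v) := by
      intro i j v
      cases i <;> cases j <;> simp [step, hφ.b]
    exact h _ _ v
  k n := by
    refine LinearMap.congr_fun (f := QData.spaceMap m φ ∘ₗ opDiag m V (wt s m))
      (g := opDiag m V' (wt s m) ∘ₗ QData.spaceMap m φ) (hom_ext fun k v => ?_) n
    rw [LinearMap.comp_apply, LinearMap.comp_apply, spaceMap_inc, opDiag_inc, opDiag_inc, map_smul,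
      spaceMap_inc]

variable {d d'} in
/-- The `U_q(𝔰)`-linear map of a morphism of quiver representations. -/
def modMap {φ : ∀ i, V i →ₗ[ℂ] V' i} (hφ : Hom d d' φ) : d.Mod hp →ₗ[UqS q] d'.Mod hp :=
  Induced.map hp (hφ.spaceMap hp)

variable {d d'} in
lemma modMap_vec {φ : ∀ i, V i →ₗ[ℂ] V' i} (hφ : Hom d d' φ) (j k : ℕ) (v : V (pos m k)) :
    modMap hp hφ (d.vec hp j k v) = d'.vec hp j k (φ _ v) := by
  rw [modMap, vec_apply, Induced.map_y, spaceMap_inc, vec_apply]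

variable {d} in
lemma mod_hom_ext {M : Type} [AddCommGroup M] [Module ℂ M] [Module (UqS q) M]
    [IsScalarTower ℂ (UqS q) M] {f g : d.Mod hp →ₗ[UqS q] M}
    (h : ∀ k v, f (d.vec hp 0 k v) = g (d.vec hp 0 k v)) : f = g := by
  refine LinearMap.ext fun v => Mod.induction (P := fun v => f v = g v) (by simp)
    (fun u v hu hv => by rw [map_add, map_add, hu, hv]) (fun j k v => ?_) v
  rw [← Y_pow_vec, map_smul, map_smul, h]

end QData

/-! ### Morphisms between modules of quiver representations -/

namespace QData

variable {q s z : ℂ} (hp : Par q s z) {m : ℕ} {V V' : Vertex → Type} [∀ i, AddCommGroup (V i)]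
  [∀ i, Module ℂ (V i)] (d : QData m V) [∀ i, AddCommGroup (V' i)]
  [∀ i, Module ℂ (V' i)] (d' : QData m V')

/-- The component of a vector at `1 ⊗ V (pos m k)`. -/
def comp (k : ℕ) : d.Mod hp →ₗ[ℂ] V (pos m k) :=
  DirectSum.component ℂ ℕ (fun k => V (pos m k)) k ∘ₗ Induced.coeff hp (d.ops hp) 0

lemma comp_vec (k : ℕ) (v : V (pos m k)) : d.comp hp k (d.vec hp 0 k v) = v := by
  rw [comp, vec_apply, LinearMap.comp_apply, Induced.coeff_y_self, DirectSum.component.lof_self]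

lemma component_opDiag (c : ℕ → ℂ) (k : ℕ) (n : Space m V) :
    DirectSum.component ℂ ℕ (fun k => V (pos m k)) k (opDiag m V c n) =
      c k • DirectSum.component ℂ ℕ (fun k => V (pos m k)) k n := by
  refine LinearMap.congr_fun (f := DirectSum.component ℂ ℕ (fun k => V (pos m k)) k ∘ₗ opDiag m V c)
    (g := c k • DirectSum.component ℂ ℕ (fun k => V (pos m k)) k) (hom_ext fun i v => ?_) n
  rw [LinearMap.comp_apply, opDiag_inc, map_smul, LinearMap.smul_apply]
  by_cases h : i = k
  · subst h
    rfl
  · rw [DirectSum.component.of, dif_neg h, smul_zero, smul_zero]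

/-- A vector killed by `X` lies in `1 ⊗ N`, and the weights `wt s m i` of the summands are distinct.
This forces a module morphism to respect the summands. -/
lemma eq_vec_of_weight {v : d.Mod hp} {k : ℕ} (hX : gen q .X • v = 0)
    (hK : gen q .K • v = wt s m k • v) : v = d.vec hp 0 k (d.comp hp k v) := by
  obtain ⟨n, rfl⟩ := Induced.exists_of_X_smul_eq_zero hp _ hX
  rw [Induced.K_y, pow_zero, inv_one, one_smul, ← map_smul] at hK
  have hn := Induced.y_injective hp _ 0 hK
  rw [vec_apply, comp, LinearMap.comp_apply, Induced.coeff_y_self]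
  congr 1
  refine DFinsupp.ext fun i => ?_
  change DirectSum.component ℂ ℕ (fun k => V (pos m k)) i n =
    DirectSum.component ℂ ℕ (fun k => V (pos m k)) i (inc m V k _)
  by_cases h : k = i
  · subst h
    rw [DirectSum.component.lof_self]
  · rw [DirectSum.component.of, dif_neg h]
    have h1 := component_opDiag (V := V) (wt s m) i n
    rw [ops_k] at hn
    rw [hn, map_smul, ← sub_eq_zero, ← sub_smul] at h1
    refine (smul_eq_zero_iff_right (sub_ne_zero.mpr fun h2 => h ?_)).mp h1
    exact wt_injective hp m h2

lemma X_vec (k : ℕ) (v : V (pos m k)) : gen q .X • d.vec hp 0 k v = 0 :=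
  (Induced.compat_y hp _).X _

lemma K_vec (k : ℕ) (v : V (pos m k)) :
    gen q .K • d.vec hp 0 k v = wt s m k • d.vec hp 0 k v := by
  rw [vec_apply, (Induced.compat_y hp _).K, ops_k, opDiag_inc, map_smul]

lemma E_vec (k : ℕ) (v : V (pos m (k + 1))) :
    gen q .E • d.vec hp 0 (k + 1) v = d.vec hp 0 k (d.back (cc q s z m (k + 1)) _ _ v) := by
  rw [vec_apply, (Induced.compat_y hp _).E, ops_e, opE_succ, vec_apply]

lemma E_vec_zero (v : V (pos m 0)) : gen q .E • d.vec hp 0 0 v = 0 := by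
  rw [vec_apply, (Induced.compat_y hp _).E, ops_e, opE_zero, map_zero]

lemma F_vec (k : ℕ) (v : V (pos m k)) :
    d.vec hp 0 (k + 1) (d.step _ _ v) = gen q .F • d.vec hp 0 k v -
      ((q + 1) * z)⁻¹ • gen q .Y • gen q .Y • gen q .Ki • d.vec hp 0 k v := by
  rw [vec_apply, vec_apply, (Induced.compat_y hp _).F, (Induced.compat_y hp _).Ki,
    add_sub_cancel_right, ops_f, opF_inc]

variable {d d'}

/-- The components of a `U_q(𝔰)`-linear map. -/
def homComp (ψ : d.Mod hp →ₗ[UqS q] d'.Mod hp) (k : ℕ) (i : Vertex) (h : pos m k = i) :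
    V i →ₗ[ℂ] V' i := by
  subst h
  exact d'.comp hp k ∘ₗ ψ.restrictScalars ℂ ∘ₗ d.vec hp 0 k

lemma hom_vec (ψ : d.Mod hp →ₗ[UqS q] d'.Mod hp) (k : ℕ) (v : V (pos m k)) :
    ψ (d.vec hp 0 k v) = d'.vec hp 0 k (homComp hp ψ k _ rfl v) := by
  refine d'.eq_vec_of_weight hp ?_ ?_
  · rw [← map_smul, X_vec, map_zero]
  · rw [← map_smul, K_vec, map_smul_complex]

lemma vec_injective (k : ℕ) : Function.Injective (d.vec hp 0 k) :=
  Function.LeftInverse.injective (d.comp_vec hp k)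

lemma homComp_step (ψ : d.Mod hp →ₗ[UqS q] d'.Mod hp) (k : ℕ) (i j : Vertex) (hi : pos m k = i)
    (hj : pos m (k + 1) = j) (v : V i) :
    homComp hp ψ (k + 1) j hj (d.step i j v) = d'.step i j (homComp hp ψ k i hi v) := by
  subst hi hj
  apply vec_injective hp (k + 1)
  rw [← hom_vec, F_vec, F_vec, ← hom_vec]
  simp only [map_sub, map_smul, map_smul_complex]

lemma homComp_back (ψ : d.Mod hp →ₗ[UqS q] d'.Mod hp) (k : ℕ) (i j : Vertex)
    (hi : pos m (k + 1) = i) (hj : pos m k = j) (v : V i) :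
    homComp hp ψ k j hj (d.back (cc q s z m (k + 1)) i j v) =
      d'.back (cc q s z m (k + 1)) i j (homComp hp ψ (k + 1) i hi v) := by
  subst hi hj
  apply vec_injective hp k
  rw [← hom_vec, ← E_vec, ← E_vec, ← hom_vec, map_smul]

/-- For `m > 0`, every `U_q(𝔰)`-linear map comes from a morphism of quiver representations. -/
lemma exists_modMap_eq (hm : 0 < m) (ψ : d.Mod hp →ₗ[UqS q] d'.Mod hp) :
    ∃ (φ : ∀ i, V i →ₗ[ℂ] V' i) (hφ : Hom d d' φ), modMap hp hφ = ψ := by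
  -- Inside each of the two strings `f` is the identity of `V i`, so commutation with `f` makes the
  -- components of `ψ` constant there; only one map per vertex remains.
  have h2 : ∀ k (hk : k < m), homComp hp ψ k .two (pos_of_lt hk) =
      homComp hp ψ 0 .two (pos_of_lt hm) := by
    intro k
    induction k with
    | zero => intro _; rfl
    | succ k ih =>
      intro hk
      rw [← ih (by omega)]
      exact LinearMap.ext fun v => homComp_step hp ψ k .two .two _ _ v
  have h1 : ∀ t, homComp hp ψ (m + t) .one (pos_of_le (by omega)) =
      homComp hp ψ m .one (pos_of_le le_rfl) := by
    intro t
    induction t with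
    | zero => rfl
    | succ t ih =>
      rw [← ih]
      exact LinearMap.ext fun v => homComp_step hp ψ (m + t) .one .one _ _ v
  let φ : ∀ i, V i →ₗ[ℂ] V' i := fun i => match i with
    | .two => homComp hp ψ 0 .two (pos_of_lt hm)
    | .one => homComp hp ψ m .one (pos_of_le le_rfl)
  -- The arrows sit at the step between the weights `m - 1` and `m`: there `e` is `a` and `f` is
  -- `b`.
  obtain ⟨k, rfl⟩ : ∃ k, m = k + 1 := ⟨m - 1, by omega⟩
  have hφ : Hom d d' φ := by
    refine ⟨fun v => ?_, fun v => ?_⟩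
    · have := homComp_back hp ψ k .one .two (pos_of_le le_rfl) (pos_of_lt (by omega)) v
      rw [h2 k (by omega)] at this
      exact this
    · have := homComp_step hp ψ k .two .one (pos_of_lt (by omega)) (pos_of_le le_rfl) v
      rw [h2 k (by omega)] at this
      exact this
  refine ⟨φ, hφ, mod_hom_ext hp fun r v => ?_⟩
  rw [modMap_vec, hom_vec]
  congr 1
  have key : ∀ (i : Vertex) (h : pos (k + 1) r = i) (v : V i), φ i v = homComp hp ψ r i h v := by
    intro i h v
    rcases lt_or_ge r (k + 1) with hr | hr
    · rw [pos_of_lt hr] at h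
      subst h
      rw [h2 r hr]
    · have hr2 := h
      rw [pos_of_le hr] at hr2
      subst hr2
      obtain ⟨t, rfl⟩ := Nat.exists_eq_add_of_le hr
      rw [h1 t]
  exact key _ rfl v

lemma modMap_injective (hm : 0 < m) {φ φ' : ∀ i, V i →ₗ[ℂ] V' i} (hφ : Hom d d' φ)
    (hφ' : Hom d d' φ') (h : modMap hp hφ = modMap hp hφ') : φ = φ' := by
  have key : ∀ k (i : Vertex) (_ : pos m k = i) (v : V i), φ i v = φ' i v := by
    rintro k i rfl v
    apply vec_injective hp k (d := d')
    rw [← modMap_vec hp hφ, h, modMap_vec]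
  funext i
  refine LinearMap.ext fun v => ?_
  cases i
  · exact key m _ (pos_of_le le_rfl) v
  · exact key 0 _ (pos_of_lt hm) v

end QData

/-! ### The structure of `U_q(𝔰𝔩₂)`-modules with a given central character -/

namespace Sl2Ops

variable {q s z : ℂ} {N : Type} [AddCommGroup N] [Module ℂ N] (hp : Par q s z) (o : Sl2Ops q N)

/-- The generalized eigenvalue of `FE` on the weight space of `ν`. -/
def gam (q s z : ℂ) (m : ℕ) (ν : ℂ) : ℂ :=
  (ctilde q (wt s m 0) z - ctilde q ν z) / (z * (q + 1))

/-- Weight modules with locally nilpotent `E` and generalized central character `c̃_λ`. -/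
structure Nice (s z : ℂ) (m : ℕ) (o : Sl2Ops q N) : Prop where
  weight : ⨆ ν : ℂ, o.k.eigenspace ν = ⊤
  nilp : ∀ n, ∃ i : ℕ, (o.e ^ i) n = 0
  central : ∃ r : ℕ, ∀ ν n, o.k n = ν • n → n ≠ 0 →
    ((o.f * o.e - gam q s z m ν • 1) ^ r) n = 0

variable {o}

lemma k_e_mem {n : N} {ν : ℂ} (h : o.k n = ν • n) : o.k (o.e n) = (q ^ 2 * ν) • o.e n := by
  rw [o.k_e, h, map_smul, smul_smul]

lemma k_f_mem {n : N} {ν : ℂ} (h : o.k n = ν • n) : o.k (o.f n) = ((q ^ 2)⁻¹ * ν) • o.f n := by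
  rw [o.k_f, h, map_smul, smul_smul]

lemma ne_zero_of_k {n : N} {ν : ℂ} (h : o.k n = ν • n) (hn : n ≠ 0) : ν ≠ 0 := by
  rintro rfl
  apply hn
  rw [← o.ki_k n, h, zero_smul, map_zero]

lemma pow_apply_of_eigen {A : Module.End ℂ N} {n : N} {c : ℂ} (h : A n = c • n) (r : ℕ) :
    (A ^ r) n = c ^ r • n := by
  induction r with
  | zero => simp
  | succ r ih => rw [pow_succ', Module.End.mul_apply, ih, map_smul, h, smul_smul, pow_succ]

include hp

lemma e_f_gam {m : ℕ} {n : N} {ν : ℂ} (h : o.k n = ν • n) :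
    o.e (o.f n) = o.f (o.e n) +
      (gam q s z m ((q ^ 2)⁻¹ * ν) - gam q s z m ν) • n := by
  by_cases hn : n = 0
  · simp [hn]
  have hν := ne_zero_of_k h hn
  rw [o.e_f, h, o.ki_of_k hp hν h, smul_smul, ← sub_smul, smul_smul, ← ctilde_shift hp hν, gam, gam]
  congr 2
  ring

namespace Nice

variable {m : ℕ} (ho : o.Nice s z m)
include ho

/-- On a weight space `fe` is the scalar `gam` plus a nilpotent, so it has no eigenvector for
another eigenvalue. -/
lemma eq_zero_of_f_e {n : N} {ν c : ℂ} (h : o.k n = ν • n) (hc : c ≠ 0)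
    (hn : o.f (o.e n) = (gam q s z m ν - c) • n) : n = 0 := by
  by_contra h0
  obtain ⟨r, hr⟩ := ho.central
  have h1 : (o.f * o.e - gam q s z m ν • 1) n = (-c) • n := by
    rw [LinearMap.sub_apply, Module.End.mul_apply, hn, LinearMap.smul_apply, Module.End.one_apply,
      ← sub_smul]
    congr 1
    ring
  have h2 := hr ν n h h0
  rw [pow_apply_of_eigen h1] at h2
  exact h0 ((smul_eq_zero_iff_right (pow_ne_zero r (neg_ne_zero.mpr hc))).mp h2)

/-- A nonzero scalar plus a nilpotent is invertible; the preimage is built by induction on the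
nilpotency exponent. -/
lemma exists_f_e_eq {n : N} {ν : ℂ} (h : o.k n = ν • n) (hc : gam q s z m ν ≠ 0) :
    ∃ n', o.k n' = ν • n' ∧ o.f (o.e n') = n := by
  by_cases h0 : n = 0
  · exact ⟨0, by simp, by simp [h0]⟩
  obtain ⟨r, hr'⟩ := ho.central
  have hr := hr' ν n h h0
  clear hr' h0
  induction r generalizing n with
  | zero => exact ⟨0, by simp, by simpa using hr.symm⟩
  | succ r ih =>
    have hA : o.k (o.f (o.e n)) = ν • o.f (o.e n) := by
      rw [k_f_mem (k_e_mem h), inv_mul_cancel_left₀ (pow_ne_zero 2 hp.q0)]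
    obtain ⟨n', hn', hn2⟩ := ih (n := (o.f * o.e - gam q s z m ν • 1) n) (by
      rw [LinearMap.sub_apply, Module.End.mul_apply, LinearMap.smul_apply, Module.End.one_apply,
        map_sub, hA, map_smul, h, smul_sub, smul_comm]) (by
      rw [← Module.End.mul_apply, ← pow_succ]; exact hr)
    -- Since `fe n' = (fe - γ)n`, one has `fe(n - n') = γn`.
    refine ⟨(gam q s z m ν)⁻¹ • (n - n'), ?_, ?_⟩
    · rw [map_smul, map_sub, h, hn', ← smul_sub, smul_comm]
    · rw [map_smul, map_smul, map_sub, map_sub, hn2, LinearMap.sub_apply, Module.End.mul_apply,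
        LinearMap.smul_apply, Module.End.one_apply, sub_sub_cancel, inv_smul_smul₀ hc]

/-- If `fn = 0`, then `efn = 0` makes `n` an eigenvector of `fe` whose eigenvalue differs from the
admissible one by `gam` at the next weight. -/
lemma f_injective {n : N} {ν : ℂ} (h : o.k n = ν • n) (hc : gam q s z m ((q ^ 2)⁻¹ * ν) ≠ 0)
    (hn : o.f n = 0) : n = 0 := by
  refine ho.eq_zero_of_f_e hp h hc ?_
  have := e_f_gam hp (m := m) h
  rw [hn, map_zero, eq_comm, add_eq_zero_iff_eq_neg, ← neg_smul] at this
  rw [this]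
  congr 1
  ring

lemma exists_f_eq {n : N} {ν : ℂ} (h : o.k n = ((q ^ 2)⁻¹ * ν) • n)
    (hc : gam q s z m ((q ^ 2)⁻¹ * ν) ≠ 0) : ∃ n', o.k n' = ν • n' ∧ o.f n' = n := by
  obtain ⟨n', h1, h2⟩ := ho.exists_f_e_eq hp h hc
  refine ⟨o.e n', ?_, h2⟩
  rw [k_e_mem h1, mul_inv_cancel_left₀ (pow_ne_zero 2 hp.q0)]

lemma gam_wt (k : ℕ) : gam q s z m (wt s m k) = cc q s z m k := rfl

/-- The weights are of the form `λ q^(-2k)`. -/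
lemma exists_eq_wt {n : N} {ν : ℂ} (h : o.k n = ν • n) (hn : n ≠ 0) : ∃ k, ν = wt s m k := by
  obtain ⟨i, hi⟩ := ho.nilp n
  induction i generalizing n ν with
  | zero => exact absurd hi hn
  | succ i ih =>
    -- Climbing with `e` ends at a vector killed by `e`. There `fe` is zero, so `c̃_ν = c̃_λ` and
    -- the weight is one of the two in the orbit of `λ`.
    by_cases he : o.e n = 0
    · have hγ : gam q s z m ν = 0 := by
        by_contra hc
        exact hn (ho.eq_zero_of_f_e hp h hc (by rw [he, map_zero, sub_self, zero_smul]))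
      rw [gam, div_eq_zero_iff, or_iff_left (mul_ne_zero hp.z0 hp.qp1), sub_eq_zero,
        ctilde_eq_wt_zero_iff hp m (ne_zero_of_k h hn)] at hγ
      rcases hγ with h | h
      · exact ⟨0, h⟩
      · exact ⟨m, h⟩
    · obtain ⟨k, hk⟩ := ih (k_e_mem h) he (by
        rw [← Module.End.mul_apply, ← pow_succ]; exact hi)
      refine ⟨k + 1, ?_⟩
      rw [← wt_succ' hp, ← hk, inv_mul_cancel_left₀ (pow_ne_zero 2 hp.q0)]

lemma e_wt_zero {n : N} (h : o.k n = wt s m 0 • n) : o.e n = 0 := by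
  by_contra hn
  obtain ⟨k, hk⟩ := ho.exists_eq_wt hp (k_e_mem h) hn
  rw [hp.q_pow_eq, wt, wt, ← zpow_add₀ hp.s0] at hk
  have := hp.s_zpow_inj hk
  push_cast at this
  omega

/-- The condition `hm` says that the `t` steps down from weight `r` never enter weight `m`, the only
place where `f` may degenerate. -/
lemma f_pow_injective (r t : ℕ) (hm : ∀ i < t, r + i + 1 ≠ m) {n : N}
    (h : o.k n = wt s m r • n) (hn : (o.f ^ t) n = 0) : n = 0 := by
  induction t with
  | zero => simpa using hn
  | succ t ih =>
    refine ih (fun i hi => hm i (by omega)) ?_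
    rw [pow_succ', Module.End.mul_apply] at hn
    refine ho.f_injective hp (o.k_f_pow hp h t) ?_ hn
    rw [wt_succ' hp, ho.gam_wt hp]
    exact cc_ne_zero hp (by omega) (hm t (by omega))

lemma exists_f_pow_eq (r t : ℕ) (hm : ∀ i < t, r + i + 1 ≠ m) {n : N}
    (h : o.k n = wt s m (r + t) • n) : ∃ n', o.k n' = wt s m r • n' ∧ (o.f ^ t) n' = n := by
  induction t generalizing n with
  | zero => exact ⟨n, h, rfl⟩
  | succ t ih =>
    rw [← add_assoc, ← wt_succ' hp] at h
    obtain ⟨n1, h1, h2⟩ := ho.exists_f_eq hp h (by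
      rw [wt_succ' hp, ho.gam_wt hp]
      exact cc_ne_zero hp (by omega) (hm t (by omega)))
    obtain ⟨n2, h3, h4⟩ := ih (fun i hi => hm i (by omega)) h1
    exact ⟨n2, h3, by rw [pow_succ', Module.End.mul_apply, h4, h2]⟩

end Nice

omit hp

/-- The weights attached to the vertices of the quiver. -/
def vwt (s : ℂ) (m : ℕ) : Vertex → ℂ
  | .one => wt s m m
  | .two => wt s m 0

/-- The weight spaces attached to the vertices of the quiver. -/
abbrev VSpace (o : Sl2Ops q N) (s : ℂ) (m : ℕ) (i : Vertex) : Type := o.k.eigenspace (vwt s m i)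

lemma mem_VSpace {i : Vertex} {m : ℕ} {n : N} (h : o.k n = vwt s m i • n) :
    n ∈ o.k.eigenspace (vwt s m i) := Module.End.mem_eigenspace_iff.mpr h

lemma k_VSpace {i : Vertex} {m : ℕ} (v : o.VSpace s m i) : o.k v = vwt s m i • (v : N) :=
  Module.End.mem_eigenspace_iff.mp v.2

include hp

/-- `f^(m-1)` is bijective from weight `0` to weight `m - 1`, so `a` is `e` followed by its inverse;
injectivity also gives linearity. -/
lemma Nice.exists_a {m : ℕ} (ho : o.Nice s z m) (hm : 0 < m) :
    ∃ a : o.VSpace s m .one →ₗ[ℂ] o.VSpace s m .two,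
      ∀ v, (o.f ^ (m - 1)) (a v : N) = o.e (v : N) := by
  have hinj : ∀ n : N, o.k n = wt s m 0 • n → (o.f ^ (m - 1)) n = 0 → n = 0 :=
    fun n h => ho.f_pow_injective hp 0 (m - 1) (fun i hi => by omega) h
  have hex : ∀ v : o.VSpace s m .one, ∃ n' : o.VSpace s m .two,
      (o.f ^ (m - 1)) (n' : N) = o.e (v : N) := by
    intro v
    obtain ⟨n', h1, h2⟩ := ho.exists_f_pow_eq hp 0 (m - 1) (fun i hi => by omega)
      (n := o.e (v : N)) (by
        rw [k_e_mem (k_VSpace v), zero_add]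
        obtain ⟨k, rfl⟩ : ∃ k, m = k + 1 := ⟨m - 1, by omega⟩
        rw [Nat.add_sub_cancel, wt_succ hp (k + 1) k]
        rfl)
    exact ⟨⟨n', mem_VSpace h1⟩, h2⟩
  choose a ha using hex
  refine ⟨{ toFun := a, map_add' := fun u v => ?_, map_smul' := fun c v => ?_ }, ha⟩
  · refine sub_eq_zero.mp (Subtype.ext (hinj _ (k_VSpace (a (u + v) - (a u + a v))) ?_))
    simp [map_sub, map_add, ha]
  · refine sub_eq_zero.mp (Subtype.ext (hinj _ (k_VSpace (a (c • v) - c • a v)) ?_))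
    simp [map_sub, map_smul, ha]

/-- The map `b` is `f^m`, and `ab = 0` holds because `e f^m` on the top weight space is `cc m - cc 0
= 0` times `f^(m-1)`. For `m = 0` both vertices carry the same weight space and both maps are taken
to be zero. -/
lemma Nice.exists_data {m : ℕ} (ho : o.Nice s z m) :
    ∃ d : QData m (o.VSpace s m),
      d.Gens o s (fun i => (o.k.eigenspace (vwt s m i)).subtype) ∧ (m = 0 → d.b = 0) := by
  rcases Nat.eq_zero_or_pos m with rfl | hm
  · refine ⟨⟨0, 0, fun _ => rfl, fun _ => rfl⟩, ⟨k_VSpace, k_VSpace,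
      fun v => ho.e_wt_zero hp (k_VSpace v), fun v => ?_, fun h => absurd h (lt_irrefl 0)⟩,
      fun _ => rfl⟩
    rw [LinearMap.zero_apply, map_zero, map_zero]
    exact ho.e_wt_zero hp (k_VSpace v)
  · obtain ⟨a, ha⟩ := ho.exists_a hp hm
    let b : o.VSpace s m .two →ₗ[ℂ] o.VSpace s m .one :=
      (o.f ^ m).restrict fun n hn => mem_VSpace (i := .one) (by
        have := o.k_f_pow hp (r := 0) (Module.End.mem_eigenspace_iff.mp hn) m
        rwa [zero_add] at this)
    have hb : ∀ v, (b v : N) = (o.f ^ m) (v : N) := fun v => rfl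
    refine ⟨⟨a, b, fun v => ?_, fun h => absurd h (by omega)⟩, ⟨k_VSpace, k_VSpace,
      fun v => ho.e_wt_zero hp (k_VSpace v), fun v => (ha v).symm, fun _ v => rfl⟩,
      fun h => absurd h (by omega)⟩
    refine Subtype.ext (ho.f_pow_injective hp 0 (m - 1) (fun i hi => by omega)
      (k_VSpace (a (b v))) ?_)
    have h1 := o.e_f_pow hp (r := 0) (k_VSpace v) (m - 1)
    rw [ho.e_wt_zero hp (k_VSpace v), map_zero, zero_add, zero_add,
      show m - 1 + 1 = m by omega, cc_self hp, cc_zero hp, sub_self, zero_smul] at h1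
    rw [ha, hb, h1]

/-- On each summand the map is a power of `f` that starts at weight `0` or `m` and does not cross
the jump, hence a bijection onto a weight space. The weight spaces are independent and, by
`exists_eq_wt`, exhaust `N`. -/
lemma Nice.extend_bijective {m : ℕ} (ho : o.Nice s z m) : Function.Bijective
    (QData.extend m o fun i => (o.k.eigenspace (vwt s m i)).subtype) := by
  have hk : ∀ (k : ℕ) (v : o.VSpace s m (pos m k)),
      (o.f ^ QData.expo m k) (v : N) ∈ o.k.eigenspace (wt s m k) := by
    intro k
    have : ∀ (i : Vertex) (_ : i = pos m k) (v : o.VSpace s m i),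
        (o.f ^ QData.expo m k) (v : N) ∈ o.k.eigenspace (wt s m k) := by
      intro i hi v
      rw [Module.End.mem_eigenspace_iff]
      rcases lt_or_ge k m with h | h
      · rw [pos_of_lt h] at hi
        subst hi
        rw [QData.expo, if_pos h, o.k_f_pow hp (k_VSpace v), zero_add]
      · rw [pos_of_le h] at hi
        subst hi
        rw [QData.expo, if_neg (by omega), o.k_f_pow hp (k_VSpace v), show m + (k - m) = k by omega]
    exact this _ rfl
  let ψ : ∀ k, o.VSpace s m (pos m k) →ₗ[ℂ] o.k.eigenspace (wt s m k) := fun k =>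
    ((o.f ^ QData.expo m k) ∘ₗ Submodule.subtype _).codRestrict _ (hk k)
  have hψ : ∀ k, Function.Bijective (ψ k) := by
    intro k
    have h1 : ∀ (i : Vertex) (_ : i = pos m k) (v : o.VSpace s m i),
        (o.f ^ QData.expo m k) (v : N) = 0 → v = 0 := by
      intro i hi v hv
      rcases lt_or_ge k m with h | h
      · rw [pos_of_lt h] at hi
        subst hi
        rw [QData.expo, if_pos h] at hv
        exact Subtype.ext (ho.f_pow_injective hp 0 k (by omega) (k_VSpace v) hv)
      · rw [pos_of_le h] at hi
        subst hi
        rw [QData.expo, if_neg (by omega)] at hv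
        exact Subtype.ext (ho.f_pow_injective hp m _ (by omega) (k_VSpace v) hv)
    have h2 : ∀ (i : Vertex) (_ : i = pos m k) (n : N), o.k n = wt s m k • n →
        ∃ v : o.VSpace s m i, (o.f ^ QData.expo m k) (v : N) = n := by
      intro i hi n hn
      rcases lt_or_ge k m with h | h
      · rw [pos_of_lt h] at hi
        subst hi
        rw [QData.expo, if_pos h]
        obtain ⟨v, hv, hv2⟩ := ho.exists_f_pow_eq hp 0 k (by omega) (n := n) (by rwa [zero_add])
        exact ⟨⟨v, mem_VSpace hv⟩, hv2⟩
      · rw [pos_of_le h] at hi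
        subst hi
        rw [QData.expo, if_neg (by omega)]
        obtain ⟨v, hv, hv2⟩ := ho.exists_f_pow_eq hp m (k - m) (by omega) (n := n)
          (by rwa [show m + (k - m) = k by omega])
        exact ⟨⟨v, mem_VSpace hv⟩, hv2⟩
    refine ⟨?_, fun n => ?_⟩
    · rw [injective_iff_map_eq_zero]
      exact fun v hv => h1 _ rfl v (congrArg Subtype.val hv)
    · obtain ⟨v, hv⟩ := h2 _ rfl n (Module.End.mem_eigenspace_iff.mp n.2)
      exact ⟨v, Subtype.ext hv⟩
  have hfac : ∀ n, QData.extend m o (fun i => (o.k.eigenspace (vwt s m i)).subtype) n =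
      DFinsupp.lsum ℕ (fun k => (o.k.eigenspace (wt s m k)).subtype)
        (DFinsupp.mapRange.linearMap ψ n) := by
    intro n
    refine LinearMap.congr_fun (f := QData.extend m o
      (fun i => (o.k.eigenspace (vwt s m i)).subtype))
      (g := (DFinsupp.lsum ℂ (fun k => (o.k.eigenspace (wt s m k)).subtype)) ∘ₗ
        (DFinsupp.mapRange.linearMap ψ)) (QData.hom_ext fun k v => ?_) n
    rw [QData.extend_inc, LinearMap.comp_apply]
    erw [DFinsupp.mapRange.linearMap_apply, DFinsupp.mapRange_single, DFinsupp.lsum_single]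
    rfl
  refine ⟨?_, ?_⟩
  · have hind := (Module.End.eigenspaces_iSupIndep o.k).comp (wt_injective hp m)
    have h1 := hind.dfinsupp_lsum_injective
    intro u v huv
    rw [hfac, hfac] at huv
    have h2 := h1 huv
    exact (DFinsupp.mapRange_injective (fun k => ψ k) (fun k => map_zero _)).mpr
      (fun k => (hψ k).1) h2
  · rw [← LinearMap.range_eq_top, eq_top_iff, ← ho.weight]
    refine iSup_le fun ν n hn => ?_
    by_cases h0 : n = 0
    · rw [h0]; exact Submodule.zero_mem _
    obtain ⟨k, rfl⟩ := ho.exists_eq_wt hp (Module.End.mem_eigenspace_iff.mp hn) h0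
    obtain ⟨v, hv⟩ := (hψ k).2 ⟨n, hn⟩
    refine ⟨QData.inc m _ k v, ?_⟩
    rw [QData.extend_inc]
    exact congrArg Subtype.val hv

end Sl2Ops

/-! ### Every module in the block comes from a quiver representation -/

section Structure

variable {q s z : ℂ} {M : Type} [AddCommGroup M] [Module ℂ M] [Module (UqS q) M]
  [IsScalarTower ℂ (UqS q) M] (hp : Par q s z) {m : ℕ} {ξ : Set ℂ}

lemma kerOps_weight (hz : ∀ v : M, gen q .Z • v = z • v)
    (hw : ⨆ ν : ℂ, weightSpace q M ν = ⊤) :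
    ⨆ ν : ℂ, (kerOps hp hz).k.eigenspace ν = ⊤ := by
  have h := le_iSup_inf_eigenspace (Algebra.lsmul ℂ ℂ M (gen q .K)) hw (kerX q M)
    (fun x hx => ((kerOps hp hz).k ⟨x, hx⟩).2)
  apply Submodule.map_injective_of_injective (kerX q M).injective_subtype
  rw [Submodule.map_subtype_top, Submodule.map_iSup]
  refine le_antisymm (iSup_le fun ν => Submodule.map_subtype_le _ _)
    (h.trans (iSup_mono fun ν v hv => ⟨⟨v, hv.1⟩, ?_, rfl⟩))
  exact Module.End.mem_eigenspace_iff.mpr (Subtype.ext (Module.End.mem_eigenspace_iff.mp hv.2))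

lemma coe_kerOps_e_pow (hz : ∀ v : M, gen q .Z • v = z • v) (i : ℕ) (n : kerX q M) :
    (((kerOps hp hz).e ^ i) n : M) = gen q .E ^ i • (n : M) := by
  induction i with
  | zero => simp
  | succ i ih => rw [pow_succ', Module.End.mul_apply, coe_kerOps_e, ih, pow_succ', mul_smul]

/-- `gam` is normalized so that `C̃ - c̃_λ` equals `z(q+1)(fe - gam)` on a weight space of `ker X`.
Nilpotency passes to `fe - gam` because `z(q+1) ≠ 0`. -/
lemma Ctilde_sub_pow_smul_kerX (hz : ∀ v : M, gen q .Z • v = z • v) {ν : ℂ} (hν : ν ≠ 0)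
    (r : ℕ) (n : kerX q M) (hn : (kerOps hp hz).k n = ν • n) :
    (Ctilde q - algebraMap ℂ (UqS q) (ctilde q (wt s m 0) z)) ^ r • (n : M) =
      (z * (q + 1)) ^ r • ((((kerOps hp hz).f * (kerOps hp hz).e -
        Sl2Ops.gam q s z m ν • 1) ^ r) n : M) := by
  induction r generalizing n with
  | zero => simp
  | succ r ih =>
    have hκ : z * (q + 1) ≠ 0 := mul_ne_zero hp.z0 hp.qp1
    have hfe : (kerOps hp hz).k ((kerOps hp hz).f ((kerOps hp hz).e n)) =
        ν • (kerOps hp hz).f ((kerOps hp hz).e n) := by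
      rw [Sl2Ops.k_f_mem (Sl2Ops.k_e_mem hn), inv_mul_cancel_left₀ (pow_ne_zero 2 hp.q0)]
    have h1 : (Ctilde q - algebraMap ℂ (UqS q) (ctilde q (wt s m 0) z)) • (n : M) =
        (z * (q + 1)) • ((((kerOps hp hz).f * (kerOps hp hz).e -
          Sl2Ops.gam q s z m ν • 1) n : kerX q M) : M) := by
      rw [sub_smul, algebraMap_smul, Ctilde_smul_kerX hp hz n hn hν, LinearMap.sub_apply,
        LinearMap.smul_apply, Module.End.one_apply, Module.End.mul_apply, Submodule.coe_sub,
        Submodule.coe_smul, smul_sub, smul_smul, Sl2Ops.gam, mul_div_cancel₀ _ hκ, sub_smul]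
      abel
    rw [pow_succ, mul_smul, h1, gen_smul_comm, ih _ ?_, smul_smul, ← pow_succ',
      ← Module.End.mul_apply, ← pow_succ]
    rw [LinearMap.sub_apply, LinearMap.smul_apply, Module.End.one_apply, Module.End.mul_apply,
      map_sub, hfe, map_smul, hn, smul_sub, smul_comm ν]

lemma InBlock.nice (hM : InBlock q M ξ (ctilde q (wt s m 0) z) z) :
    (kerOps hp hM.centralCharge).Nice s z m where
  weight := kerOps_weight hp _ hM.inO.weight
  nilp n := by
    obtain ⟨i, hi⟩ := E_locally_nilpotent hp hM.inO (n : M)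
    exact ⟨i, Subtype.ext (by rw [coe_kerOps_e_pow, hi, Submodule.coe_zero])⟩
  central := by
    obtain ⟨r, hr⟩ := hM.ctilde_nilpotent
    refine ⟨r, fun ν n hn h0 => Subtype.ext ?_⟩
    have h := hr (n : M)
    rw [Ctilde_sub_pow_smul_kerX hp _ (Sl2Ops.ne_zero_of_k hn h0) r n hn] at h
    exact (smul_eq_zero_iff_right (pow_ne_zero r (mul_ne_zero hp.z0 hp.qp1))).mp h

/-- Two isomorphisms are composed: `ker X` is rebuilt from its quiver data, and `M` is `ℂ[Y] ⊗ ker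
X`. -/
lemma InBlock.exists_equiv (hM : InBlock q M ξ (ctilde q (wt s m 0) z) z) :
    ∃ d : QData m ((kerOps hp hM.centralCharge).VSpace s m),
      Nonempty (d.Mod hp ≃ₗ[UqS q] M) ∧ (m = 0 → d.b = 0) := by
  have ho := hM.nice hp
  obtain ⟨d, hd, hb0⟩ := ho.exists_data hp
  have hb := ho.extend_bijective hp
  refine ⟨d, ⟨(LinearEquiv.ofBijective (Induced.map hp (hd.sl2Hom hp))
    ⟨Induced.map_injective _ hb.1, Induced.map_surjective _ hb.2⟩).trans
    (LinearEquiv.ofBijective (kerLift hp hM.centralCharge)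
      (kerLift_bijective hp _ (X_locally_nilpotent hp hM.inO)))⟩, hb0⟩

end Structure

/-! ### Quotients of quiver representations and finite-dimensionality -/

namespace QData

variable {q s z : ℂ} (hp : Par q s z) {m : ℕ} {V : Vertex → Type}
  [∀ i, AddCommGroup (V i)] [∀ i, Module ℂ (V i)] (d : QData m V)

/-- The quotient of a quiver representation. -/
def quot (P : ∀ i, Submodule ℂ (V i)) (ha : ∀ v ∈ P .one, d.a v ∈ P .two)
    (hb : ∀ v ∈ P .two, d.b v ∈ P .one) : QData m (fun i => V i ⧸ P i) where
  a := (P .one).mapQ (P .two) d.a ha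
  b := (P .two).mapQ (P .one) d.b hb
  ab v := by
    obtain ⟨v, rfl⟩ := (P .two).mkQ_surjective v
    simp [d.ab]
  a_zero hm := by
    refine LinearMap.ext fun v => ?_
    obtain ⟨v, rfl⟩ := (P .one).mkQ_surjective v
    simp [d.a_zero hm]

lemma hom_mkQ (P : ∀ i, Submodule ℂ (V i)) (ha : ∀ v ∈ P .one, d.a v ∈ P .two)
    (hb : ∀ v ∈ P .two, d.b v ∈ P .one) : Hom d (d.quot P ha hb) (fun i => (P i).mkQ) :=
  ⟨fun _ => rfl, fun _ => rfl⟩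

/-- An element involves finitely many vectors of the representation, and it dies in the quotient by
any subrepresentation containing them. -/
lemma exists_finite_support (x : d.Mod hp) : ∃ A : ∀ i, Submodule ℂ (V i),
    (∀ i, FiniteDimensional ℂ (A i)) ∧ ∀ P ha hb, (∀ i, A i ≤ P i) →
      modMap hp (d.hom_mkQ P ha hb) x = 0 := by
  induction x using Mod.induction with
  | h0 => exact ⟨fun _ => ⊥, fun _ => inferInstance, fun _ _ _ _ => map_zero _⟩
  | ha u v hu hv =>
    obtain ⟨A, hA, h1⟩ := hu
    obtain ⟨B, hB, h2⟩ := hv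
    refine ⟨fun i => A i ⊔ B i, fun i => inferInstance, fun P ha hb hP => ?_⟩
    rw [map_add, h1 P ha hb fun i => le_sup_left.trans (hP i),
      h2 P ha hb fun i => le_sup_right.trans (hP i), add_zero]
  | hv j k v =>
    have key : ∀ (i : Vertex) (v : V i), ∃ A : ∀ i, Submodule ℂ (V i),
        (∀ i, FiniteDimensional ℂ (A i)) ∧ v ∈ A i := by
      rintro (_ | _) v
      · exact ⟨fun | .one => ℂ ∙ v | .two => ⊥, by rintro (_ | _) <;> dsimp only <;> infer_instance,
          Submodule.mem_span_singleton_self v⟩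
      · exact ⟨fun | .two => ℂ ∙ v | .one => ⊥, by rintro (_ | _) <;> dsimp only <;> infer_instance,
          Submodule.mem_span_singleton_self v⟩
    obtain ⟨A, hA, hv⟩ := key _ v
    refine ⟨A, hA, fun P ha hb hP => ?_⟩
    rw [modMap_vec, (Submodule.mkQ_apply _ _).trans ((Submodule.Quotient.mk_eq_zero _).mpr
      (hP _ hv)), map_zero]

/-- Finitely many generators are supported in a finite-dimensional subrepresentation `P`. The map to
the module of the quotient by `P` kills all generators, hence is zero, so `P` fills the weight
space. -/
lemma finiteDimensional [hfg : Module.Finite (UqS q) (d.Mod hp)] (k : ℕ) :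
    FiniteDimensional ℂ (V (pos m k)) := by
  obtain ⟨S, hS⟩ := hfg.fg_top
  choose A hA h using d.exists_finite_support hp
  let B : ∀ i, Submodule ℂ (V i) := fun i => S.sup fun x => A x i
  have hB : ∀ i, FiniteDimensional ℂ (B i) := fun i =>
    Submodule.finiteDimensional_finset_sup S fun x => A x i
  -- Applying `a` and then `b` once already closes up to a subrepresentation, since `ab = 0`.
  let P2 := B .two ⊔ (B .one).map d.a
  let P1 := B .one ⊔ P2.map d.b
  let P : ∀ i, Submodule ℂ (V i) := fun | .one => P1 | .two => P2
  have hP : ∀ i, FiniteDimensional ℂ (P i) := by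
    rintro (_ | _)
    · exact inferInstanceAs (FiniteDimensional ℂ P1)
    · exact inferInstanceAs (FiniteDimensional ℂ P2)
  have hBP : ∀ i, B i ≤ P i := by
    rintro (_ | _)
    · exact le_sup_left
    · exact le_sup_left
  have hb : ∀ v ∈ P .two, d.b v ∈ P .one := fun v hv =>
    Submodule.mem_sup_right (Submodule.mem_map_of_mem hv)
  have ha : ∀ v ∈ P .one, d.a v ∈ P .two := by
    intro v hv
    obtain ⟨v1, h1, v2, h2, rfl⟩ := Submodule.mem_sup.mp hv
    obtain ⟨w, -, rfl⟩ := h2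
    rw [map_add, d.ab, add_zero]
    exact Submodule.mem_sup_right (Submodule.mem_map_of_mem h1)
  have h0 : modMap hp (d.hom_mkQ P ha hb) = 0 := by
    refine LinearMap.ext_on hS fun x hx => ?_
    exact h x P ha hb fun i => (Finset.le_sup (f := fun x => A x i) hx).trans (hBP i)
  have htop : P (pos m k) = ⊤ := by
    refine Submodule.eq_top_iff'.mpr fun v => ?_
    have h1 := modMap_vec hp (d.hom_mkQ P ha hb) 0 k v
    rw [h0, LinearMap.zero_apply, eq_comm] at h1
    rw [← (Submodule.Quotient.mk_eq_zero _)]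
    exact vec_injective hp k (d := d.quot P ha hb) (h1.trans (map_zero _).symm)
  have := hP (pos m k)
  rw [htop] at this
  exact Module.Finite.equiv (Submodule.topEquiv (R := ℂ) (M := V (pos m k)))

end QData

/-! ### Objects of the block come from finite-dimensional data -/

section Structure

variable {q s z : ℂ} {M : Type} [AddCommGroup M] [Module ℂ M] [Module (UqS q) M]
  [IsScalarTower ℂ (UqS q) M] (hp : Par q s z) {m : ℕ} {ξ : Set ℂ}

/-- Every module in the block is the module of a finite-dimensional quiver representation. -/
theorem InBlock.exists_finite_equiv (hM : InBlock q M ξ (ctilde q (wt s m 0) z) z) :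
    ∃ d : QData m ((kerOps hp hM.centralCharge).VSpace s m),
      (∀ i, FiniteDimensional ℂ ((kerOps hp hM.centralCharge).VSpace s m i)) ∧
      Nonempty (d.Mod hp ≃ₗ[UqS q] M) ∧ (m = 0 → d.b = 0) := by
  obtain ⟨d, ⟨e⟩, hb0⟩ := hM.exists_equiv hp
  have := hM.inO.finitelyGenerated
  have : Module.Finite (UqS q) (d.Mod hp) := Module.Finite.equiv e.symm
  refine ⟨d, ?_, ⟨e⟩, hb0⟩
  have h1 := d.finiteDimensional hp m
  rw [pos_of_le le_rfl] at h1
  rintro (_ | _)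
  · exact h1
  · rcases Nat.eq_zero_or_pos m with rfl | hm
    · exact h1
    · have h2 := d.finiteDimensional hp 0
      rwa [pos_of_lt hm] at h2

end Structure

/-! ### Verma modules in the block -/

section Generators

variable {q s z : ℂ} {M : Type} [AddCommGroup M] [Module ℂ M] [Module (UqS q) M]
  [IsScalarTower ℂ (UqS q) M] (hp : Par q s z) {m : ℕ} {V : Vertex → Type}
  [∀ i, AddCommGroup (V i)] [∀ i, Module ℂ (V i)] {d : QData m V}

/-- The map out of the module of a quiver representation given by vectors killed by `X`. -/
def gensLift (hz : ∀ v : M, gen q .Z • v = z • v) {g : ∀ i, V i →ₗ[ℂ] kerX q M}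
    (hg : d.Gens (kerOps hp hz) s g) : d.Mod hp →ₗ[UqS q] M :=
  kerLift hp hz ∘ₗ Induced.map hp (hg.sl2Hom hp)

lemma gensLift_vec (hz : ∀ v : M, gen q .Z • v = z • v) {g : ∀ i, V i →ₗ[ℂ] kerX q M}
    (hg : d.Gens (kerOps hp hz) s g) (k : ℕ) (v : V (pos m k)) :
    gensLift hp hz hg (d.vec hp 0 k v) = (((kerOps hp hz).f ^ QData.expo m k) (g _ v) : M) := by
  rw [gensLift, LinearMap.comp_apply, QData.vec_apply, Induced.map_y, kerLift_y, pow_zero,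
    one_smul, QData.extend_inc]

/-- The images of the spanning vectors lie in `W` or in other weight spaces. Independence of weight
spaces then removes the other part. -/
lemma weightSpace_le_of_surjective (φ : d.Mod hp →ₗ[UqS q] M) (hφ : Function.Surjective φ)
    {ν : ℂ} {W : Submodule ℂ M} (hW : W ≤ weightSpace q M ν)
    (h : ∀ (j k : ℕ) (v : V (pos m k)), s ^ (2 * m - 3 - 4 * k - 2 * j : ℤ) = ν →
      φ (d.vec hp j k v) ∈ W) : weightSpace q M ν ≤ W := by
  have key : ∀ x, φ x ∈ W ⊔ ⨆ μ, ⨆ (_ : μ ≠ ν), weightSpace q M μ := by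
    intro x
    induction x using QData.Mod.induction with
    | h0 => rw [map_zero]; exact Submodule.zero_mem _
    | ha u v hu hv => rw [map_add]; exact Submodule.add_mem _ hu hv
    | hv j k v =>
      by_cases hk : s ^ (2 * m - 3 - 4 * k - 2 * j : ℤ) = ν
      · exact Submodule.mem_sup_left (h j k v hk)
      · exact Submodule.mem_sup_right (Submodule.mem_iSup_of_mem _ (Submodule.mem_iSup_of_mem hk
          (map_mem_weightSpace φ (d.vec_mem_weightSpace hp j k v))))
  intro v hv
  obtain ⟨x, rfl⟩ := hφ v
  obtain ⟨w, hw, u, hu, huv⟩ := Submodule.mem_sup.mp (key x)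
  have hd := Module.End.eigenspaces_iSupIndep (Algebra.lsmul ℂ ℂ M (gen q .K)) ν
  have h0 : φ x - w = 0 := by
    refine Submodule.disjoint_def.mp hd _ (Submodule.sub_mem _ hv (hW hw)) ?_
    rw [← huv, add_sub_cancel_left]
    exact hu
  rw [sub_eq_zero.mp h0]
  exact hw

lemma Z_smul_verma (ν : ℂ) (v : Verma q ν z) : gen q .Z • v = z • v := by
  obtain ⟨u, rfl⟩ := (vermaIdeal q ν z).mkQ_surjective v
  rw [← smul_vermaOne]
  have h : ∀ u : UqS q, gen q .Z * u = u * gen q .Z := by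
    intro u
    induction u using UqS_induction with
    | hc c => exact (Algebra.commutes c _).symm
    | hg x => exact Z_gen x
    | ha u v hu hv => rw [mul_add, hu, hv, add_mul]
    | hm u v hu hv => rw [← mul_assoc, hu, mul_assoc, hv, mul_assoc]
  rw [← mul_smul, h, mul_smul, (isHighest_vermaOne ν).Z, gen_smul_comm]

/-- The generator of the Verma module, as a vector killed by `X`. -/
def kerOne (q ν z : ℂ) : kerX q (Verma q ν z) :=
  ⟨vermaOne q ν z, (isHighest_vermaOne ν).X⟩

lemma k_kerOne (ν : ℂ) : (kerOps hp (Z_smul_verma (z := z) ν)).k (kerOne q ν z) =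
    ν • kerOne q ν z := Subtype.ext (isHighest_vermaOne ν).K

lemma e_kerOne (ν : ℂ) : (kerOps hp (Z_smul_verma (z := z) ν)).e (kerOne q ν z) = 0 :=
  Subtype.ext (isHighest_vermaOne ν).E

lemma weightSpace_verma_ge (ν : ℂ) :
    (ℂ ∙ vermaOne q ν z) ≤ weightSpace q (Verma q ν z) ν := by
  rw [Submodule.span_singleton_le_iff_mem]
  exact mem_weightSpace.mpr (isHighest_vermaOne ν).K

/-- This replaces a PBW theorem. A nonzero highest weight vector in an explicit module shows that
the generator is nonzero, and a surjection from that module bounds the top weight space. -/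
lemma VermaNice.of_surjective [∀ i, FiniteDimensional ℂ (V i)] {ν : ℂ}
    (φ : d.Mod hp →ₗ[UqS q] Verma q ν z) (hφ : Function.Surjective φ)
    {x : d.Mod hp} (hx : IsHighest q ν z x) (hx0 : x ≠ 0)
    (h : ∀ (j k : ℕ) (v : V (pos m k)), s ^ (2 * m - 3 - 4 * k - 2 * j : ℤ) = ν →
      φ (d.vec hp j k v) ∈ ℂ ∙ vermaOne q ν z) :
    VermaNice q ν z where
  ne_zero h0 := hx0 (by rw [← vermaLift_one x hx, h0, map_zero])
  weight := ((d.inBlock hp).of_surjective φ hφ).inO.weight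
  highest v hv := by
    obtain ⟨c, hc⟩ := Submodule.mem_span_singleton.mp
      (weightSpace_le_of_surjective hp φ hφ (weightSpace_verma_ge ν) h hv)
    exact ⟨c, hc.symm⟩

end Generators

/-! ### The antidominant Verma module -/

/-- The dimension vector of the simple representation at the vertex `1`. -/
def dimOne : Vertex → ℕ
  | .one => 1
  | .two => 0

section Antidominant

variable {q s z : ℂ} (hp : Par q s z) (m : ℕ)

/-- The simple representation at the vertex `1`. -/
def dataOne : QData m (fun i => Fin (dimOne i) → ℂ) where
  a := 0
  b := 0
  ab _ := rfl
  a_zero _ := rfl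

/-- The generators of the antidominant Verma module. -/
def genOne (q s z : ℂ) (m : ℕ) :
    ∀ i, (Fin (dimOne i) → ℂ) →ₗ[ℂ] kerX q (Verma q (wt s m m) z)
  | .one => (LinearMap.proj (0 : Fin 1)).smulRight (kerOne q (wt s m m) z)
  | .two => 0

lemma genOne_one (v : Fin (dimOne .one) → ℂ) :
    genOne q s z m .one v = v (0 : Fin 1) • kerOne q (wt s m m) z := rfl

lemma genOne_mem (i : Vertex) (v : Fin (dimOne i) → ℂ) :
    (genOne q s z m i v : Verma q (wt s m m) z) ∈ ℂ ∙ vermaOne q (wt s m m) z := by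
  cases i
  · exact Submodule.smul_mem _ _ (Submodule.mem_span_singleton_self _)
  · exact Submodule.zero_mem _

lemma gens_genOne : (dataOne m).Gens (kerOps hp (Z_smul_verma (z := z) (wt s m m))) s
    (genOne q s z m) where
  k_two v := by simp [genOne]
  k_one v := by
    rw [genOne_one, map_smul, k_kerOne, smul_comm]
  e_two v := by simp [genOne]
  e_one v := by
    rw [genOne_one, map_smul, e_kerOne, smul_zero]
    simp [genOne]
  f_two _ v := by
    simp only [genOne, LinearMap.zero_apply, map_zero, dataOne]

/-- The surjection onto the antidominant Verma module. -/
def projOne : (dataOne m).Mod hp →ₗ[UqS q] Verma q (wt s m m) z :=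
  gensLift hp _ (gens_genOne hp m)

lemma expo_self : QData.expo m m = 0 := by simp [QData.expo]

lemma projOne_surjective : Function.Surjective (projOne hp m) := by
  rw [← LinearMap.range_eq_top]
  apply eq_top_of_vermaOne_mem
  have key : ∀ (i : Vertex) (_ : i = .one), ∃ v, genOne q s z m i v = kerOne q (wt s m m) z := by
    rintro i rfl
    exact ⟨fun _ => 1, one_smul _ _⟩
  obtain ⟨v, hv⟩ := key _ (pos_of_le (m := m) le_rfl)
  refine ⟨(dataOne m).vec hp 0 m v, ?_⟩
  rw [projOne, gensLift_vec, expo_self, pow_zero, Module.End.one_apply, hv]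
  rfl

lemma vec_dataOne_eq_zero {k : ℕ} (hk : k < m) (j : ℕ) (v : Fin (dimOne (pos m k)) → ℂ) :
    (dataOne m).vec hp j k v = 0 := by
  have : v = 0 := by
    have : ∀ (i : Vertex) (_ : i = .two) (v : Fin (dimOne i) → ℂ), v = 0 := by
      rintro i rfl v
      exact funext fun j => j.elim0
    exact this _ (pos_of_lt hk) v
  rw [this, map_zero]

include hp in
lemma vermaNice_antidominant : VermaNice q (wt s m m) z := by
  have key : ∀ (i : Vertex) (_ : i = .one), ∃ v : Fin (dimOne i) → ℂ, v ≠ 0 := by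
    rintro i rfl
    exact ⟨fun _ => 1, fun h => one_ne_zero (congrFun h (0 : Fin 1))⟩
  obtain ⟨v, hv⟩ := key _ (pos_of_le (m := m) le_rfl)
  refine VermaNice.of_surjective hp (projOne hp m) (projOne_surjective hp m)
    (x := (dataOne m).vec hp 0 m v) ⟨?_, QData.X_vec hp (dataOne m) m v,
      QData.K_vec hp (dataOne m) m v,
      Induced.Z_smul hp _ _⟩ (fun h => hv (QData.vec_injective hp m (h.trans (map_zero _).symm)))
    fun j k w hk => ?_
  · rcases Nat.eq_zero_or_pos m with rfl | hm
    · exact QData.E_vec_zero hp (dataOne 0) v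
    · obtain ⟨k, rfl⟩ : ∃ k, m = k + 1 := ⟨m - 1, by omega⟩
      rw [QData.E_vec, vec_dataOne_eq_zero hp _ k.lt_succ_self]
  · rw [wt] at hk
    have hk := hp.s_zpow_inj hk
    -- Equality of weights means `4k + 2j = 4m`. Vectors with `k < m` are zero, so only `k = m`, `j
    -- = 0` contributes.
    rcases lt_or_ge k m with hkm | hkm
    · rw [vec_dataOne_eq_zero hp m hkm, map_zero]
      exact Submodule.zero_mem _
    · obtain ⟨rfl, rfl⟩ : k = m ∧ j = 0 := by omega
      rw [projOne, gensLift_vec, expo_self, pow_zero, Module.End.one_apply]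
      exact genOne_mem k _ w

include hp in
lemma inBlock_antidominant : InBlock q (Verma q (wt s m m) z) (coset q s)
    (ctilde q (wt s m 0) z) z :=
  ((dataOne m).inBlock hp).of_surjective (projOne hp m) (projOne_surjective hp m)

include hp in
lemma weightSpace_antidominant (hm : 0 < m) :
    weightSpace q (Verma q (wt s m m) z) (wt s m 0) = ⊥ := by
  refine le_bot_iff.mp (weightSpace_le_of_surjective hp (projOne hp m) (projOne_surjective hp m)
    bot_le fun j k v hk => ?_)
  rw [wt] at hk
  have hk := hp.s_zpow_inj hk
  rw [vec_dataOne_eq_zero hp m (by omega), map_zero]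
  exact Submodule.zero_mem _

end Antidominant

/-! ### The dominant Verma module -/

section Dominant

variable {q s z : ℂ} (hp : Par q s z) {m : ℕ}

/-- The indecomposable representation with `b = 1` and `a = 0`. -/
def dataTwo (m : ℕ) : QData m (fun _ => ℂ) where
  a := 0
  b := LinearMap.id
  ab _ := rfl
  a_zero _ := rfl

/-- The generators of the dominant Verma module. -/
def genTwo (m : ℕ) : Vertex → ℂ →ₗ[ℂ] kerX q (Verma q (wt s m 0) z)
  | .one => LinearMap.id.smulRight (((kerOps hp (Z_smul_verma _)).f ^ m) (kerOne q (wt s m 0) z))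
  | .two => LinearMap.id.smulRight (kerOne q (wt s m 0) z)

lemma genTwo_one (v : ℂ) : genTwo hp m .one v =
    v • ((kerOps hp (Z_smul_verma (wt s m 0))).f ^ m) (kerOne q (wt s m 0) z) := rfl

lemma genTwo_two (v : ℂ) : genTwo hp m .two v = v • kerOne q (wt s m 0) z := rfl

/-- The vector `f^m` applied to the generator is again killed by `e`, since `cc` vanishes at both
`0` and `m`. Hence the dominant Verma module is described by `a = 0`, `b = 1`. -/
lemma gens_genTwo (hm : 0 < m) :
    (dataTwo m).Gens (kerOps hp (Z_smul_verma (z := z) (wt s m 0))) s (genTwo hp m) where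
  k_two v := by
    rw [genTwo_two, map_smul, k_kerOne, smul_comm]
  k_one v := by
    rw [genTwo_one, map_smul, Sl2Ops.k_f_pow hp _ (k_kerOne hp (wt s m 0)), zero_add, smul_comm]
  e_two v := by
    rw [genTwo_two, map_smul, e_kerOne, smul_zero]
  e_one v := by
    have h := Sl2Ops.e_f_pow hp _ (m := m) (r := 0) (k_kerOne hp (wt s m 0)) (m - 1)
    rw [e_kerOne, map_zero, zero_add, zero_add, show m - 1 + 1 = m by omega, cc_self hp,
      cc_zero hp, sub_self, zero_smul] at h
    rw [genTwo_one, map_smul, h, smul_zero]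
    simp [dataTwo]
  f_two _ v := map_smul _ v _

/-- The surjection onto the dominant Verma module. -/
def projTwo (hm : 0 < m) : (dataTwo m).Mod hp →ₗ[UqS q] Verma q (wt s m 0) z :=
  gensLift hp _ (gens_genTwo hp hm)

lemma projTwo_vec (hm : 0 < m) (v : ℂ) :
    projTwo hp hm ((dataTwo m).vec hp 0 0 v) = v • vermaOne q (wt s m 0) z := by
  have key : ∀ i (_ : i = Vertex.two), genTwo hp m i v = v • kerOne q (wt s m 0) z := by
    rintro i rfl
    rfl
  rw [projTwo, gensLift_vec, key _ (pos_of_lt hm)]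
  simp only [QData.expo, if_pos hm, pow_zero, Module.End.one_apply]
  rfl

lemma projTwo_surjective (hm : 0 < m) : Function.Surjective (projTwo hp hm) := by
  rw [← LinearMap.range_eq_top]
  exact eq_top_of_vermaOne_mem ⟨_, (projTwo_vec hp hm 1).trans (one_smul _ _)⟩

include hp in
lemma vermaNice_dominant (m : ℕ) : VermaNice q (wt s m 0) z := by
  rcases Nat.eq_zero_or_pos m with rfl | hm
  · exact vermaNice_antidominant hp 0
  refine VermaNice.of_surjective hp (projTwo hp hm) (projTwo_surjective hp hm)
    (x := (dataTwo m).vec hp 0 0 1) ⟨QData.E_vec_zero hp (dataTwo m) _, QData.X_vec hp (dataTwo m) 0 _,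
      QData.K_vec hp (dataTwo m) 0 _, Induced.Z_smul hp _ _⟩ (fun h => one_ne_zero
        (QData.vec_injective hp 0 (h.trans (map_zero _).symm)))
    fun j k w hk => ?_
  rw [wt] at hk
  have hk := hp.s_zpow_inj hk
  obtain ⟨rfl, rfl⟩ : k = 0 ∧ j = 0 := by omega
  rw [projTwo_vec]
  exact Submodule.smul_mem _ _ (Submodule.mem_span_singleton_self _)

include hp in
lemma inBlock_dominant (m : ℕ) : InBlock q (Verma q (wt s m 0) z) (coset q s)
    (ctilde q (wt s m 0) z) z := by
  rcases Nat.eq_zero_or_pos m with rfl | hm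
  · exact inBlock_antidominant hp 0
  · exact ((dataTwo m).inBlock hp).of_surjective (projTwo hp hm) (projTwo_surjective hp hm)

end Dominant

/-! ### Simple modules in the block -/

section SimpleModules

variable {q s z : ℂ} (hp : Par q s z) {m : ℕ} {M : Type} [AddCommGroup M] [Module ℂ M]
  [Module (UqS q) M] [IsScalarTower ℂ (UqS q) M] {ξ : Set ℂ}
include hp

/-- `C̃ - c̃_λ` acts on a highest weight vector by `c̃_ν - c̃_λ`; being nilpotent, this scalar is
zero. -/
lemma InBlock.highest_weight (hM : InBlock q M ξ (ctilde q (wt s m 0) z) z) {ν : ℂ} {v : M}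
    (hν : ν ≠ 0) (hv : IsHighest q ν z v) (hv0 : v ≠ 0) : ν = wt s m 0 ∨ ν = wt s m m := by
  rw [← ctilde_eq_wt_zero_iff hp (z := z) m hν]
  by_contra hne
  obtain ⟨r, hr⟩ := hM.ctilde_nilpotent
  have h1 : (Ctilde q - algebraMap ℂ (UqS q) (ctilde q (wt s m 0) z)) • v =
      (ctilde q ν z - ctilde q (wt s m 0) z) • v := by
    rw [sub_smul, algebraMap_smul, Ctilde_smul_of_highest hp.q0 hp.q2 hν v hv.E hv.X hv.K hv.Z,
      sub_smul]
  have h2 : ∀ i : ℕ, (Ctilde q - algebraMap ℂ (UqS q) (ctilde q (wt s m 0) z)) ^ i • v =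
      (ctilde q ν z - ctilde q (wt s m 0) z) ^ i • v := by
    intro i
    induction i with
    | zero => simp
    | succ i ih => rw [pow_succ', mul_smul, ih, gen_smul_comm, h1, smul_smul, pow_succ]
  have h3 := hr v
  rw [h2] at h3
  exact hv0 ((smul_eq_zero_iff_right (pow_ne_zero r (sub_ne_zero.mpr fun h => hne h.symm))).mp h3)

lemma InBlock.exists_highest (hM : InBlock q M ξ (ctilde q (wt s m 0) z) z) [Nontrivial M] :
    ∃ v : M, v ≠ 0 ∧ (IsHighest q (wt s m 0) z v ∨ IsHighest q (wt s m m) z v) := by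
  obtain ⟨ν, v, hv0, hν, hv⟩ := hM.inO.exists_highest hp hM.centralCharge
  rcases hM.highest_weight hp hν hv hv0 with rfl | rfl
  · exact ⟨v, hv0, Or.inl hv⟩
  · exact ⟨v, hv0, Or.inr hv⟩

-- A nonzero submodule contains a nonzero cyclic one, which lies in the block and has a highest
-- weight vector. The weight `λ` does not occur when `m > 0`, so this vector has weight `λq^(-2m)`
-- and is a multiple of the generator.
variable (m) in
lemma isSimpleModule_antidominant : IsSimpleModule (UqS q) (Verma q (wt s m m) z) := by
  have hn := vermaNice_antidominant hp m
  have : Nontrivial (Verma q (wt s m m) z) := ⟨⟨_, 0, hn.ne_zero⟩⟩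
  refine { eq_bot_or_eq_top := fun N => or_iff_not_imp_left.mpr fun hN => ?_ }
  obtain ⟨x, hx, hx0⟩ := N.ne_bot_iff.mp hN
  let P : Submodule (UqS q) (Verma q (wt s m m) z) := UqS q ∙ x
  have hP : InBlock q P _ _ z := (inBlock_antidominant hp m).submodule P
    (Submodule.fg_span_singleton x)
  have : Nontrivial P := ⟨⟨⟨x, Submodule.mem_span_singleton_self x⟩, 0,
    fun h => hx0 (congrArg Subtype.val h)⟩⟩
  obtain ⟨v, hv0, hv⟩ := hP.exists_highest hp
  have hv1 : (v : Verma q (wt s m m) z) ∈ weightSpace q (Verma q (wt s m m) z) (wt s m m) := by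
    rcases hv with hv | hv
    · have hw := map_mem_weightSpace P.subtype (mem_weightSpace.mpr hv.K)
      rcases Nat.eq_zero_or_pos m with rfl | hm
      · exact hw
      · rw [weightSpace_antidominant hp m hm] at hw
        exact absurd (Subtype.ext ((Submodule.mem_bot ℂ).mp hw)) hv0
    · exact map_mem_weightSpace P.subtype (mem_weightSpace.mpr hv.K)
  obtain ⟨c, hc⟩ := hn.highest _ hv1
  have hc0 : c ≠ 0 := by
    rintro rfl
    rw [zero_smul] at hc
    exact hv0 (Subtype.ext hc)
  apply eq_top_of_vermaOne_mem
  have hvN : (v : Verma q (wt s m m) z) ∈ N :=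
    (Submodule.span_singleton_le_iff_mem x N).mpr hx v.2
  rw [← inv_smul_smul₀ hc0 (vermaOne q (wt s m m) z), ← hc,
    ← algebraMap_smul (UqS q) c⁻¹]
  exact N.smul_mem _ hvN

variable (m) in
lemma simpleQuot_equiv_antidominant :
    Nonempty (SimpleQuot q (wt s m m) z ≃ₗ[UqS q] Verma q (wt s m m) z) :=
  have := isSimpleModule_antidominant hp (m := m)
  (vermaNice_antidominant hp m).equiv_of_isSimple (isHighest_vermaOne _)
    (vermaNice_antidominant hp m).ne_zero

/-- The simple modules in the block. -/
lemma InBlock.isSimpleModule_iff (hM : InBlock q M ξ (ctilde q (wt s m 0) z) z) :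
    IsSimpleModule (UqS q) M ↔ Nonempty (M ≃ₗ[UqS q] Verma q (wt s m m) z) ∨
      Nonempty (M ≃ₗ[UqS q] SimpleQuot q (wt s m 0) z) := by
  constructor
  · intro h
    have : Nontrivial M := IsSimpleModule.nontrivial (UqS q) M
    obtain ⟨v, hv0, hv | hv⟩ := hM.exists_highest hp
    · obtain ⟨e⟩ := (vermaNice_dominant hp m).equiv_of_isSimple hv hv0
      exact Or.inr ⟨e.symm⟩
    · obtain ⟨e⟩ := (vermaNice_antidominant hp m).equiv_of_isSimple hv hv0
      obtain ⟨e'⟩ := simpleQuot_equiv_antidominant hp m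
      exact Or.inl ⟨e.symm.trans e'⟩
  · rintro (⟨⟨e⟩⟩ | ⟨⟨e⟩⟩)
    · have := isSimpleModule_antidominant (z := z) hp (m := m)
      exact IsSimpleModule.congr e
    · have := (vermaNice_dominant hp (z := z) m).isSimple
      exact IsSimpleModule.congr e

/-- The weight `λ` occurs in `L(λ)` and, for `m > 0`, not in `Δ(λq^(-2m))`. -/
lemma isEmpty_verma_equiv_simpleQuot (hm : 0 < m) :
    IsEmpty (Verma q (wt s m m) z ≃ₗ[UqS q] SimpleQuot q (wt s m 0) z) := by
  refine ⟨fun e => ?_⟩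
  have hn := vermaNice_dominant hp (z := z) m
  let x : SimpleQuot q (wt s m 0) z := (vermaRad q (wt s m 0) z).mkQ (vermaOne q (wt s m 0) z)
  have hx : x ∈ weightSpace q (SimpleQuot q (wt s m 0) z) (wt s m 0) :=
    map_mem_weightSpace _ (mem_weightSpace.mpr (isHighest_vermaOne _).K)
  have h1 := map_mem_weightSpace e.symm.toLinearMap hx
  rw [weightSpace_antidominant hp m hm, Submodule.mem_bot] at h1
  have h2 : x = 0 := e.symm.injective (h1.trans (map_zero e.symm).symm)
  exact hn.vermaRad_ne_top (eq_top_of_vermaOne_mem ((Submodule.Quotient.mk_eq_zero _).mp h2))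

end SimpleModules

/-! ### The equivalence with quiver representations -/

namespace QData

variable {q s z : ℂ} (hp : Par q s z) {m : ℕ} {V V' V'' : Vertex → Type}
  [∀ i, AddCommGroup (V i)] [∀ i, Module ℂ (V i)] [∀ i, AddCommGroup (V' i)]
  [∀ i, Module ℂ (V' i)] [∀ i, AddCommGroup (V'' i)] [∀ i, Module ℂ (V'' i)]
  {d : QData m V} {d' : QData m V'} {d'' : QData m V''}

lemma modMap_id {φ : ∀ i, V i →ₗ[ℂ] V i} (hφ : Hom d d φ) (h : ∀ i v, φ i v = v)
    (x : d.Mod hp) : modMap hp hφ x = x := by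
  refine LinearMap.congr_fun (f := modMap hp hφ) (g := LinearMap.id)
    (mod_hom_ext hp fun k v => ?_) x
  rw [modMap_vec, h, LinearMap.id_apply]

lemma modMap_comp {φ : ∀ i, V i →ₗ[ℂ] V' i} (hφ : Hom d d' φ) {ψ : ∀ i, V' i →ₗ[ℂ] V'' i}
    (hψ : Hom d' d'' ψ) {χ : ∀ i, V i →ₗ[ℂ] V'' i} (hχ : Hom d d'' χ)
    (h : ∀ i v, χ i v = ψ i (φ i v)) (x : d.Mod hp) :
    modMap hp hψ (modMap hp hφ x) = modMap hp hχ x := by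
  refine LinearMap.congr_fun (f := modMap hp hψ ∘ₗ modMap hp hφ) (g := modMap hp hχ)
    (mod_hom_ext hp fun k v => ?_) x
  rw [LinearMap.comp_apply, modMap_vec, modMap_vec, modMap_vec, h]

lemma modMap_add {φ ψ χ : ∀ i, V i →ₗ[ℂ] V' i} (hφ : Hom d d' φ) (hψ : Hom d d' ψ)
    (hχ : Hom d d' χ) (h : ∀ i v, χ i v = φ i v + ψ i v) (x : d.Mod hp) :
    modMap hp hχ x = modMap hp hφ x + modMap hp hψ x := by
  refine LinearMap.congr_fun (f := modMap hp hχ) (g := modMap hp hφ + modMap hp hψ)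
    (mod_hom_ext hp fun k v => ?_) x
  rw [LinearMap.add_apply, modMap_vec, modMap_vec, modMap_vec, h, map_add]

lemma modMap_smul {φ χ : ∀ i, V i →ₗ[ℂ] V' i} (hφ : Hom d d' φ) (hχ : Hom d d' χ) (c : ℂ)
    (h : ∀ i v, χ i v = c • φ i v) (x : d.Mod hp) :
    modMap hp hχ x = c • modMap hp hφ x := by
  induction x using Mod.induction with
  | h0 => rw [map_zero, map_zero, smul_zero]
  | ha u v hu hv => rw [map_add, map_add, hu, hv, smul_add]
  | hv j k v => rw [modMap_vec, modMap_vec, h, map_smul]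

end QData

section Equivalence

open scoped ModuleCat

variable {q s z : ℂ} (hp : Par q s z) (n : ℕ)

/-- The linear data of a representation of the quiver. -/
def repData (F : QuiverRep) :
    QData (n + 1) (fun i => F.obj.obj ((Paths.of Vertex).obj i)) where
  a := (F.obj.map pathA).hom
  b := (F.obj.map pathB).hom
  ab v := by
    have h := F.property.relation
    exact congrArg (fun k => k.hom v) h
  a_zero h := absurd h n.succ_ne_zero

lemma hom_app {F G : QuiverRep} (f : F ⟶ G) : QData.Hom (repData n F) (repData n G)
    (fun i => (f.hom.app ((Paths.of Vertex).obj i)).hom) where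
  a v := congrArg (fun k => k.hom v) (f.hom.naturality pathA)
  b v := congrArg (fun k => k.hom v) (f.hom.naturality pathB)

instance (F : QuiverRep) (i : Vertex) :
    FiniteDimensional ℂ (F.obj.obj ((Paths.of Vertex).obj i)) := F.property.finiteDimensional _

/-- The functor from quiver representations to the block. -/
def repFunctor : QuiverRep ⥤ Block q (coset q s) (ctilde q (wt s (n + 1) 0) z) z where
  obj F := ⟨ModuleCat.of (UqS q) ((repData n F).Mod hp),
    block_of_inBlock ((repData n F).inBlock hp)⟩
  map f := ObjectProperty.homMk (ModuleCat.ofHom (QData.modMap hp (hom_app n f)))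
  map_id F := Block.hom_ext' fun x => QData.modMap_id hp (hom_app n (𝟙 F)) (fun _ _ => rfl) x
  map_comp f g := Block.hom_ext' fun x => (QData.modMap_comp hp (hom_app n f) (hom_app n g)
    (hom_app n (f ≫ g)) (fun _ _ => rfl) x).symm

instance : (repFunctor hp n).Additive where
  map_add {_ _ f g} := Block.hom_ext' fun x => QData.modMap_add hp (hom_app n f) (hom_app n g)
    (hom_app n (f + g)) (fun _ _ => rfl) x

instance : (repFunctor hp n).Linear ℂ where
  map_smul f c := Block.hom_ext' fun x =>
    (QData.modMap_smul hp (hom_app n f) (hom_app n (c • f)) c (fun _ _ => rfl) x).trans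
      (algebraMap_smul (UqS q) c _).symm

instance : (repFunctor hp n).Faithful where
  map_injective {F G f g} h := by
    have h1 : QData.modMap hp (hom_app n f) = QData.modMap hp (hom_app n g) :=
      congrArg (fun k => k.hom.hom) h
    have h2 := QData.modMap_injective hp n.succ_pos _ _ h1
    refine ObjectProperty.hom_ext _ (NatTrans.ext (funext fun i => ModuleCat.hom_ext ?_))
    exact congrFun h2 i

/-- A morphism of linear data is a morphism of representations. -/
def natTransOfHom {F G : QuiverRep}
    {φ : ∀ i : Paths Vertex, F.obj.obj i →ₗ[ℂ] G.obj.obj i}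
    (hφ : QData.Hom (repData n F) (repData n G) fun i => φ ((Paths.of Vertex).obj i)) : F.obj ⟶ G.obj where
  app i := ModuleCat.ofHom (φ i)
  naturality i j p := by
    -- Naturality along a path follows from naturality along the arrows `a` and `b`.
    induction p using Paths.induction with
    | id => rw [CategoryTheory.Functor.map_id, CategoryTheory.Functor.map_id, Category.id_comp, Category.comp_id]
    | comp p e h =>
      rw [Functor.map_comp, Functor.map_comp, Category.assoc]
      have he : ∀ {v w : Vertex} (e : v ⟶ w),
          F.obj.map ((Paths.of Vertex).map e) ≫ ModuleCat.ofHom (φ ((Paths.of Vertex).obj w)) =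
            ModuleCat.ofHom (φ ((Paths.of Vertex).obj v)) ≫ G.obj.map ((Paths.of Vertex).map e) := by
        rintro _ _ (_ | _)
        · exact ModuleCat.hom_ext (LinearMap.ext hφ.a)
        · exact ModuleCat.hom_ext (LinearMap.ext hφ.b)
      rw [he e, ← Category.assoc, h, Category.assoc]

instance : (repFunctor hp n).Full where
  map_surjective {F G} f := by
    obtain ⟨φ, hφ, h⟩ := QData.exists_modMap_eq hp n.succ_pos f.hom.hom
    refine ⟨ObjectProperty.homMk (natTransOfHom n (φ := φ) hφ), Block.hom_ext' fun v => ?_⟩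
    rw [← h]
    rfl

/-- The quiver representation given by linear data. -/
def repOfData {m : ℕ} {V : Vertex → Type} [∀ i, AddCommGroup (V i)] [∀ i, Module ℂ (V i)]
    (d : QData m V) : Paths Vertex ⥤ ModuleCat.{0} ℂ :=
  Paths.lift
    { obj := fun i => ModuleCat.of ℂ (V i)
      map := fun e => match e with
        | .a => ModuleCat.ofHom d.a
        | .b => ModuleCat.ofHom d.b }

section

variable {m : ℕ} {V : Vertex → Type} [∀ i, AddCommGroup (V i)] [∀ i, Module ℂ (V i)]
    (d : QData m V)

lemma repOfData_a : (repOfData d).map pathA = ModuleCat.ofHom d.a :=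
  Paths.lift_toPath _ _

lemma repOfData_b : (repOfData d).map pathB = ModuleCat.ofHom d.b :=
  Paths.lift_toPath _ _

lemma isQuiverRep_repOfData [h : ∀ i, FiniteDimensional ℂ (V i)] :
    IsQuiverRep (repOfData d) where
  finiteDimensional i := h i
  relation := by
    rw [repOfData_a, repOfData_b]
    exact ModuleCat.hom_ext (LinearMap.ext d.ab)

end

lemma repData_repOfData {V : Vertex → Type} [∀ i, AddCommGroup (V i)] [∀ i, Module ℂ (V i)]
    [∀ i, FiniteDimensional ℂ (V i)] (d : QData (n + 1) V) :
    repData n ⟨repOfData d, isQuiverRep_repOfData d⟩ = d := by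
  have ha := congrArg ModuleCat.Hom.hom (repOfData_a d)
  have hb := congrArg ModuleCat.Hom.hom (repOfData_b d)
  obtain ⟨a, b, h1, h2⟩ := d
  unfold repData
  congr 1

instance : (repFunctor hp n).EssSurj where
  mem_essImage M := by
    obtain ⟨d, hd, ⟨e⟩, -⟩ := M.inBlock.exists_finite_equiv hp
    refine ⟨⟨repOfData d, isQuiverRep_repOfData d⟩, (Block.nonempty_iso_iff _ _).mpr ?_⟩
    have h : Nonempty (((repData n ⟨repOfData d, isQuiverRep_repOfData d⟩).Mod hp)
        ≃ₗ[UqS q] M.obj) := by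
      have := repData_repOfData n d
      exact this ▸ ⟨e⟩
    exact h

instance : (repFunctor hp n).IsEquivalence where

include hp in
/-- The block is equivalent to the category of representations of the quiver. -/
theorem exists_equivalence :
    ∃ e : Block q (coset q s) (ctilde q (wt s (n + 1) 0) z) z ≌ QuiverRep,
      e.functor.Additive ∧ e.functor.Linear ℂ := by
  -- The functor runs from representations to modules; additivity and linearity are transferred to
  -- its inverse.
  let e := (repFunctor hp n).asEquivalence
  have : e.functor.Additive := inferInstanceAs (repFunctor hp n).Additive
  have : e.functor.Linear ℂ := inferInstanceAs ((repFunctor hp n).Linear ℂ)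
  have h1 : e.inverse.Additive := inferInstance
  exact ⟨e.symm, h1, CategoryTheory.Equivalence.inverseLinear ℂ e⟩

end Equivalence

/-! ### The semisimple block -/

section Semisimple

open scoped ModuleCat

variable {q s z : ℂ} (hp : Par q s z)

/-- The inclusion of a line into a representation of the vertex `1`. -/
def lineIncl {V : Vertex → Type} [∀ i, AddCommGroup (V i)] [∀ i, Module ℂ (V i)] (w : V .one) :
    ∀ i, (Fin (dimOne i) → ℂ) →ₗ[ℂ] V i
  | .one => (LinearMap.proj (0 : Fin 1)).smulRight w
  | .two => 0

/-- The projection of a representation of the vertex `1` to a line. -/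
def lineProj {V : Vertex → Type} [∀ i, AddCommGroup (V i)] [∀ i, Module ℂ (V i)]
    (f : V .one →ₗ[ℂ] ℂ) : ∀ i, V i →ₗ[ℂ] (Fin (dimOne i) → ℂ)
  | .one => LinearMap.pi fun _ => f
  | .two => 0

section

variable {V : Vertex → Type} [∀ i, AddCommGroup (V i)] [∀ i, Module ℂ (V i)] {d : QData 0 V}

lemma lineIncl_one (w : V .one) (v : Fin (dimOne .one) → ℂ) :
    lineIncl w .one v = v (0 : Fin 1) • w := rfl

lemma lineProj_one (f : V .one →ₗ[ℂ] ℂ) (v : V .one) :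
    lineProj f .one v = fun _ => f v := rfl

lemma hom_lineIncl (hb : d.b = 0) (w : V .one) : QData.Hom (dataOne 0) d (lineIncl w) where
  a v := by rw [d.a_zero rfl]; rfl
  b v := by rw [hb]; exact map_zero _

lemma hom_lineProj (hb : d.b = 0) (f : V .one →ₗ[ℂ] ℂ) :
    QData.Hom d (dataOne 0) (lineProj f) where
  a v := rfl
  b v := by rw [hb]; exact map_zero _

end

variable {ξ : Set ℂ} {c : ℂ}

lemma Block.sum_apply {ι : Type} {M N : Block q ξ c z} (t : Finset ι) (f : ι → (M ⟶ N))
    (v : M.obj) : (∑ i ∈ t, f i).hom.hom v = ∑ i ∈ t, (f i).hom.hom v := by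
  classical
  induction t using Finset.induction_on with
  | empty => rfl
  | insert i t hi ih => rw [Finset.sum_insert hi, Finset.sum_insert hi, ← ih]; rfl

/-- The simple object of the semisimple block. -/
def simpleObj : Block q (coset q s) (ctilde q (wt s 0 0) z) z :=
  ⟨ModuleCat.of (UqS q) ((dataOne 0).Mod hp), block_of_inBlock ((dataOne 0).inBlock hp)⟩

lemma exists_eq_smul_one (v : Fin (dimOne .one) → ℂ) : ∃ c : ℂ, v = c • fun _ => 1 := by
  refine ⟨v (0 : Fin 1), funext fun i => ?_⟩
  have : i = (0 : Fin 1) := Subsingleton.elim (α := Fin 1) _ _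
  rw [this]
  exact (mul_one _).symm

/-- Simplicity of the Verma module gives injectivity. For `m = 0` the two generating weight spaces
in `span_top` coincide and form a line spanned by the image of the generator, which gives
surjectivity. -/
lemma verma_equiv_dataOne :
    Nonempty (Verma q (wt s 0 0) z ≃ₗ[UqS q] (dataOne 0).Mod hp) := by
  have h1 := isSimpleModule_antidominant (z := z) hp 0
  let x : (dataOne 0).Mod hp := (dataOne 0).vec hp 0 0 (fun _ => 1)
  have hx : IsHighest q (wt s 0 0) z x := ⟨QData.E_vec_zero hp (dataOne 0) _,
    QData.X_vec hp (dataOne 0) 0 _, QData.K_vec hp (dataOne 0) 0 _, Induced.Z_smul hp _ _⟩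
  have hx0 : x ≠ 0 := fun h => one_ne_zero
    (congrFun (QData.vec_injective hp (d := dataOne 0) 0 (h.trans (map_zero _).symm)) (0 : Fin 1))
  have hne : vermaLift x hx ≠ 0 := fun h => hx0 (by rw [← vermaLift_one x hx, h]; rfl)
  refine ⟨LinearEquiv.ofBijective (vermaLift x hx) ⟨LinearMap.injective_of_ne_zero hne, ?_⟩⟩
  rw [← LinearMap.range_eq_top, eq_top_iff, ← (dataOne 0).span_top hp, sup_idem,
    Submodule.span_le]
  rintro _ ⟨v, rfl⟩
  obtain ⟨c, hc⟩ : ∃ c : ℂ, v = c • (fun _ => 1 : Fin (dimOne (pos 0 0)) → ℂ) :=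
    exists_eq_smul_one v
  rw [hc, map_smul, ← algebraMap_smul (UqS q)]
  exact Submodule.smul_mem _ _ ⟨_, vermaLift_one x hx⟩

lemma simple_simpleObj : Simple (simpleObj hp) := by
  rw [Block.simple_iff]
  obtain ⟨e⟩ := verma_equiv_dataOne hp
  have := isSimpleModule_antidominant (z := z) hp 0
  exact IsSimpleModule.congr e.symm

/-- The object of the semisimple block attached to a vector space. -/
def spaceObj {V : Vertex → Type} [∀ i, AddCommGroup (V i)] [∀ i, Module ℂ (V i)]
    [∀ i, FiniteDimensional ℂ (V i)] (d : QData 0 V) :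
    Block q (coset q s) (ctilde q (wt s 0 0) z) z :=
  ⟨ModuleCat.of (UqS q) (d.Mod hp), block_of_inBlock (d.inBlock hp)⟩

section

variable {V : Vertex → Type} [∀ i, AddCommGroup (V i)] [∀ i, Module ℂ (V i)]
    [∀ i, FiniteDimensional ℂ (V i)] (d : QData 0 V) (hb : d.b = 0) {n : ℕ}
    (β : Module.Basis (Fin n) ℂ (V .one))

/-- The decomposition of an object of the semisimple block given by a basis. -/
def basisBicone : Bicone fun _ : Fin n => simpleObj hp where
  pt := spaceObj hp d
  π i := ObjectProperty.homMk (ModuleCat.ofHom (QData.modMap hp (hom_lineProj hb (β.coord i))))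
  ι i := ObjectProperty.homMk (ModuleCat.ofHom (QData.modMap hp (hom_lineIncl hb (β i))))
  ι_π i j := by
    refine Block.hom_ext' (LinearMap.congr_fun (f := QData.modMap hp (hom_lineProj hb (β.coord j))
      ∘ₗ QData.modMap hp (hom_lineIncl hb (β i))) (QData.mod_hom_ext hp fun k v => ?_))
    rw [LinearMap.comp_apply, QData.modMap_vec, QData.modMap_vec]
    have key : ∀ (x : Vertex) (v : Fin (dimOne x) → ℂ),
        lineProj (β.coord j) x (lineIncl (β i) x v) = if i = j then v else 0 := by
      rintro (_ | _) v
      · rw [lineIncl_one, lineProj_one, map_smul, Module.Basis.coord_apply,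
          Module.Basis.repr_self, Finsupp.single_apply]
        funext l
        have : l = (0 : Fin 1) := Subsingleton.elim (α := Fin 1) _ _
        split_ifs <;> simp [this]
      · exact funext fun l => l.elim0
    rw [key]
    split_ifs with h
    · subst h
      rfl
    · exact map_zero _

lemma isBilimit_basisBicone : Nonempty (basisBicone hp d hb β).IsBilimit := by
  refine ⟨isBilimitOfTotal _ (Block.hom_ext' fun x => ?_)⟩
  rw [Block.sum_apply]
  change ∑ i, QData.modMap hp (hom_lineIncl hb (β i))
    (QData.modMap hp (hom_lineProj hb (β.coord i)) x) = x
  have h : ∑ i, QData.modMap hp (hom_lineIncl hb (β i)) ∘ₗ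
      QData.modMap hp (hom_lineProj hb (β.coord i)) = LinearMap.id := by
    refine QData.mod_hom_ext hp fun k v => ?_
    simp only [LinearMap.sum_apply, LinearMap.comp_apply, QData.modMap_vec, LinearMap.id_apply]
    rw [← map_sum]
    congr 1
    have key : ∀ (x : Vertex) (_ : x = .one) (v : V x),
        ∑ i, lineIncl (β i) x (lineProj (β.coord i) x v) = v := by
      rintro x rfl v
      exact β.sum_repr v
    exact key _ (pos_of_le (Nat.zero_le k)) v
  have h2 : ∀ y : d.Mod hp, ∑ i, QData.modMap hp (hom_lineIncl hb (β i))
      (QData.modMap hp (hom_lineProj hb (β.coord i)) y) = y := fun y => by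
    simpa only [LinearMap.sum_apply, LinearMap.comp_apply, LinearMap.id_apply] using
      LinearMap.congr_fun h y
  exact h2 x

end

-- For `m = 0` both arrows are zero and only vertex `one` contributes. A basis of its vector space
-- splits the module into copies of the simple one.
include hp in
theorem isSemisimpleCategory :
    IsSemisimpleCategory (Block q (coset q s) (ctilde q (wt s 0 0) z) z) := by
  intro M
  obtain ⟨d, hd, ⟨e⟩, hb⟩ := M.inBlock.exists_finite_equiv hp
  exact ⟨_, _, basisBicone hp d (hb rfl) (Module.finBasis ℂ _), fun _ => simple_simpleObj hp,
    isBilimit_basisBicone hp d _ _, (Block.nonempty_iso_iff _ _).mpr ⟨e⟩⟩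

end Semisimple

/-! ### The simple objects -/

section SimpleObjects

open scoped ModuleCat

variable {q s z : ℂ} (hp : Par q s z)
include hp

lemma block_Delta (m : ℕ) :
    block q (coset q s) (ctilde q (wt s m 0) z) z (Delta q (wt s m m) z) :=
  block_of_inBlock (inBlock_antidominant hp m)

lemma block_L (m : ℕ) :
    block q (coset q s) (ctilde q (wt s m 0) z) z (L q (wt s m 0) z) :=
  block_of_inBlock ((inBlock_dominant hp m).of_surjective (vermaRad q (wt s m 0) z).mkQ
    (Submodule.mkQ_surjective _))

theorem Block.simple_iff_iso {m : ℕ} (M : Block q (coset q s) (ctilde q (wt s m 0) z) z) :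
    Simple M ↔ Nonempty (M ≅ ⟨Delta q (wt s m m) z, block_Delta hp m⟩) ∨
      Nonempty (M ≅ ⟨L q (wt s m 0) z, block_L hp m⟩) := by
  rw [Block.simple_iff, M.inBlock.isSimpleModule_iff hp, Block.nonempty_iso_iff,
    Block.nonempty_iso_iff]
  rfl

/-- For `m = 0` the two candidates coincide: the antidominant and the dominant Verma module are the
same, and it is simple. -/
theorem Block.simple_iff_iso_Delta (M : Block q (coset q s) (ctilde q (wt s 0 0) z) z) :
    Simple M ↔ Nonempty (M ≅ ⟨Delta q (wt s 0 0) z, block_Delta hp 0⟩) := by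
  rw [Block.simple_iff_iso hp, Block.nonempty_iso_iff, Block.nonempty_iso_iff, or_iff_left_iff_imp]
  rintro ⟨e⟩
  obtain ⟨e'⟩ := simpleQuot_equiv_antidominant (z := z) hp 0
  exact ⟨e.trans e'⟩

lemma isEmpty_Delta_iso_L {m : ℕ} (hm : 0 < m) :
    IsEmpty (Delta q (wt s m m) z ≅ L q (wt s m 0) z) :=
  ⟨fun e => (isEmpty_verma_equiv_simpleQuot (z := z) hp hm).false e.toLinearEquiv⟩

end SimpleObjects

end QSchr

end

open CategoryTheory QSchr in
theorem mainTheorem5 (q s z : ℂ) (hq0 : q ≠ 0) (hq : ∀ k : ℕ, 0 < k → q ^ k ≠ 1)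
    (hs : s ^ 2 = q) (hz : z ≠ 0) :
    (∃ hΔ : block q (coset q s) (ctilde q (s ^ (-3 : ℤ)) z) z (Delta q (s ^ (-3 : ℤ)) z),
      (∀ M : Block q (coset q s) (ctilde q (s ^ (-3 : ℤ)) z) z,
        Simple M ↔ Nonempty (M ≅ ⟨Delta q (s ^ (-3 : ℤ)) z, hΔ⟩)) ∧
      IsSemisimpleCategory (Block q (coset q s) (ctilde q (s ^ (-3 : ℤ)) z) z)) ∧
    ∀ n : ℕ,
      (∃ (hΔ : block q (coset q s) (ctilde q (s ^ (2 * n - 1 : ℤ)) z) z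
            (Delta q (s ^ (-2 * n - 5 : ℤ)) z))
          (hL : block q (coset q s) (ctilde q (s ^ (2 * n - 1 : ℤ)) z) z
            (L q (s ^ (2 * n - 1 : ℤ)) z)),
        (∀ M : Block q (coset q s) (ctilde q (s ^ (2 * n - 1 : ℤ)) z) z,
          Simple M ↔ Nonempty (M ≅ ⟨Delta q (s ^ (-2 * n - 5 : ℤ)) z, hΔ⟩) ∨
            Nonempty (M ≅ ⟨L q (s ^ (2 * n - 1 : ℤ)) z, hL⟩)) ∧
        IsEmpty (Delta q (s ^ (-2 * n - 5 : ℤ)) z ≅ L q (s ^ (2 * n - 1 : ℤ)) z)) ∧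
      ∃ e : Block q (coset q s) (ctilde q (s ^ (2 * n - 1 : ℤ)) z) z ≌ QuiverRep,
        e.functor.Additive ∧ e.functor.Linear ℂ := by
  have hp : Par q s z := ⟨hq0, hq, hs, hz⟩
  have h0 : s ^ (-3 : ℤ) = wt s 0 0 := by simp [wt]
  -- With `m = n + 1`, the exponent of `λ` is `2m - 3 = 2n - 1` and that of `λq^(-2m)` is `2m - 3 -
  -- 4m = -2n - 5`.
  have h1 : ∀ n : ℕ, s ^ (2 * n - 1 : ℤ) = wt s (n + 1) 0 := fun n => by
    rw [wt]
    congr 1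
    push_cast
    ring
  have h2 : ∀ n : ℕ, s ^ (-2 * n - 5 : ℤ) = wt s (n + 1) (n + 1) := fun n => by
    rw [wt]
    congr 1
    push_cast
    ring
  rw [h0]
  refine ⟨⟨block_Delta hp 0, Block.simple_iff_iso_Delta hp, isSemisimpleCategory hp⟩, fun n => ?_⟩
  rw [h1, h2]
  exact ⟨⟨block_Delta hp (n + 1), block_L hp (n + 1), Block.simple_iff_iso hp,
    isEmpty_Delta_iso_L hp n.succ_pos⟩, exists_equivalence hp n⟩
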